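/- **Conventions.** $\mathcal S_\infty$ is the group of permutations of $\{1,2,\dots\}$ fixing all but finitely many integers (product = composition of functions), $s_i=(i,i+1)$, $\ell$ is the number of inversions, and $\mathfrak S_w$ ($w\in\mathcal S_\infty$) are the Schubert polynomials, $\mathfrak S_w=\partial_{w^{-1}\omega_0}(x_1^{n-1}x_2^{n-2}\cdots x_{n-1})$ for $w\in\mathcal S_n$ with $\omega_0$ the longest element of $\mathcal S_n$. $\Lambda=\mathbb Z[h_1,h_2,\dots]$ is the ring of symmetric functions in $x_1,x_2,\dots$, $h_i$ is the complete homogeneous symmetric function, $h_\alpha=h_{\alpha_1}\cdots h_{\alpha_k}$, and $S_\lambda$, $S_{\lambda/\mu}$ are the Schur and skew Schur functions (generating functions of semistandard tableaux). **Labeled posets.** A *labeled poset* is a finite poset $P$ that is ranked (all maximal chains have the same length, the rank $m$ of $P$), with an integer label on each cover. The word of a maximal chain is its sequence of edge labels $w_1\cdots w_m$, with descent set $\{j\mid 1\le j<m,\ w_j>w_{j+1}\}$. For a sequence $\alpha=(\alpha_1,\dots,\alpha_k)$ of non-negative integers with sum $m$, $H_\alpha(P)$ is the set of maximal chains whose word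 has descent set contained in $\{\alpha_1,\alpha_1+\alpha_2,\dots\}$; if the sum of $\alpha$ is not $m$, $H_\alpha(P)=\emptyset$. $P$ is *symmetric* if $\#H_\alpha(P)$ does not depend on the order of the parts of $\alpha$. An isomorphism of labeled posets is an isomorphism of posets $f$ such that, for any two edges $e,e'$, the label of $e$ is at most that of $e'$ if and only if the label of $f(e)$ is at most that of $f(e')$. For a symmetric labeled poset $P$ of rank $m$, let $\chi_P:\Lambda\to\mathbb Z$ be the linear map with $\chi_P(h_\alpha)=\#H_\alpha(P)$ for all $\alpha$, and $$S_P:=\sum_{\lambda\vdash m}\chi_P(S_\lambda)\,S_\lambda .$$ **Orders.** (a) For $k\ge1$, $u\le_k w$ if and only if $a\le k<b$ implies $u(a)\le w(a)$ and $u(b)\ge w(b)$, and moreover $a<b$, $u(a)<u(b)$, $w(a)>w(b)$ imply $a\le k<b$. A cover $u\lessdot w$ in an interval $[u',w']_k$ is labeled with $b$, where $wu^{-1}=(a,b)$, $a<b$. (b) $\eta\preceq\zeta$ if and only if $u\le_k\eta u\le_k\zeta u$ for some $u\in\mathcal S_\infty$ and $k\geq 1$; a cover $\eta\prec\zeta$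 is labeled with $b$, where $\zeta\eta^{-1}=(a,b)$, $a<b$. (c) In Young's lattice, a cover $\mu\subset\lambda$ with $\mu_i+1=\lambda_i$ is labeled with $\lambda_i-i$. (d) The weak order on $\mathcal S_\infty$ is generated by the covers $u\lessdot s_iu$ with $\ell(s_iu)=\ell(u)+1$; such a cover is labeled with $i$. **Skew Schubert and Stanley functions.** For $u\le_k w$ let $c^w_{u,v(\lambda,k)}$ be the coefficient of $\mathfrak S_w$ in the expansion of $\mathfrak S_u\cdot S_\lambda(x_1,\dots,x_k)$ in Schubert polynomials. The skew Schubert function of $\zeta\in\mathcal S_\infty$ is $S_\zeta=\sum_\lambda c^{\zeta u}_{u,v(\lambda,k)}S_\lambda$ for any $u,k$ with $u\le_k\zeta u$. The Stanley symmetric function is $F_w=\sum x_{i_1}\cdots x_{i_l}$, over all reduced words $a_1\cdots a_l$ of $w=s_{a_1}\cdots s_{a_l}$, $l=\ell(w)$, and all $1\le i_1\le\dots\le i_l$ with $i_j<i_{j+1}$ whenever $a_j<a_{j+1}$. **Theorem.** The symmetric function $S_P$ is well defined for every symmetric labeled poset $P$: each $S_\lambda$ lies in $\Lambda$, and $\chi_P$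 exists and is unique. The skew Schubert function is well defined: for each $\zeta\in\mathcal S_\infty$ there are $u,k$ with $u\le_k\zeta u$, and $\sum_\lambda c^{\zeta u}_{u,v(\lambda,k)}S_\lambda$ is the same for all such $u,k$. Moreover: 1. If $P$ and $Q$ are symmetric labeled posets and $P\simeq Q$, then $S_P=S_Q$. (2) If $u\le_k w$, then $[u,w]_k$ is a symmetric labeled poset and $S_{[u,w]_k}=S_{wu^{-1}}$, the skew Schubert function. (2$'$) For $\zeta\in\mathcal S_\infty$, $[1,\zeta]_\preceq$ is a symmetric labeled poset and $S_{[1,\zeta]_\preceq}=S_\zeta$, the skew Schubert function. (3) If $\mu\subset\lambda$ are partitions, then $[\mu,\lambda]_\subset$ is a symmetric labeled poset and $S_{[\mu,\lambda]_\subset}=S_{\lambda/\mu}$, the skew Schur function. (4) For $w\in\mathcal S_\infty$, $[1,w]_{\rm weak}$ is a symmetric labeled poset and $S_{[1,w]_{\rm weak}}=F_w$, the Stanley symmetric function. -/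

import Mathlib

universe u v

namespace SkewSchubert

open scoped Classical

noncomputable section

/-! ### The infinite symmetric group -/

/-- The group `S_∞` of the permutations of the positive integers that fix all but finitely many
integers. The product is composition of functions, `(v * w) i = v (w i)`. -/
def SInfSubgroup : Subgroup (Equiv.Perm ℕ+) where
  carrier := {w | {i | w i ≠ i}.Finite}
  one_mem' := by simp
  mul_mem' := by
    intro v w hv hw
    refine (Set.Finite.union hv hw).subset ?_
    intro i hi
    by_contra h
    simp only [Set.mem_union, Set.mem_ofPred_eq, not_or, not_not] at h
    exact hi (by simp [h.1, h.2])
  inv_mem' := by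
    intro w hw
    refine hw.subset ?_
    intro i hi h
    exact hi (by rw [Equiv.Perm.inv_eq_iff_eq, h])

/-- `S_∞` as a type. -/
abbrev SInf : Type := SInfSubgroup

namespace SInf

/-- The transposition `(a, b)`. -/
def swap (a b : ℕ+) : SInf :=
  ⟨Equiv.swap a b, by
    refine (Set.toFinite {a, b}).subset ?_
    intro i hi
    by_contra h
    simp only [Set.mem_insert_iff, Set.mem_singleton_iff, not_or] at h
    exact hi (Equiv.swap_apply_of_ne_of_ne h.1 h.2)⟩

/-- The simple transposition `(i, i+1)`. -/
def s (i : ℕ+) : SInf := swap i (i + 1)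

/-- The inversions of `w`, as pairs of positions. -/
def inversions (w : SInf) : Set (ℕ+ × ℕ+) := {p | p.1 < p.2 ∧ w.1 p.2 < w.1 p.1}

/-- The length `ℓ(w)`. -/
def len (w : SInf) : ℕ := w.inversions.ncard

/-- `a = (a_1, …, a_l)` is a reduced word of `w`: `w = s_{a_1} ⋯ s_{a_l}` and `l = ℓ(w)`. -/
def IsReducedWord (w : SInf) (a : List ℕ+) : Prop :=
  (a.map s).prod = w ∧ a.length = w.len

theorem exists_bound (w : SInf) : ∃ n : ℕ, ∀ i : ℕ+, n < (i : ℕ) → w.1 i = i := by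
  obtain ⟨M, hM⟩ := Set.Finite.bddAbove (s := {i | w.1 i ≠ i}) w.2
  refine ⟨M, fun i hi => ?_⟩
  by_contra h
  exact absurd (hM h) (not_le.2 (by exact_mod_cast hi))

/-- The least `n` such that `w ∈ S_n`, that is, such that `w` fixes all `i > n`. -/
def size (w : SInf) : ℕ := Nat.find w.exists_bound

/-- The underlying function of the longest element of `S_n`: `i ↦ n + 1 - i` for `i ≤ n`. -/
def longestFun (n : ℕ) (i : ℕ+) : ℕ+ :=
  if h : (i : ℕ) ≤ n then ⟨n + 1 - i, by omega⟩ else i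

theorem longestFun_involutive (n : ℕ) : Function.Involutive (longestFun n) := by
  intro i
  have hi := i.pos
  by_cases h : (i : ℕ) ≤ n
  · have h1 : ((longestFun n i : ℕ+) : ℕ) = n + 1 - i := by simp [longestFun, h]
    have h2 : ((longestFun n i : ℕ+) : ℕ) ≤ n := by omega
    apply PNat.coe_injective
    have h3 : ∀ j : ℕ+, (j : ℕ) ≤ n → ((longestFun n j : ℕ+) : ℕ) = n + 1 - j := by
      intro j hj
      simp [longestFun, hj]
    have h4 := h3 _ h2
    omega
  · have h1 : longestFun n i = i := by simp [longestFun, h]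
    rw [h1, h1]

/-- The longest element of `S_n`. -/
def longest (n : ℕ) : SInf :=
  ⟨(longestFun_involutive n).toPerm, by
    refine (Set.finite_Iic (n.succPNat)).subset ?_
    intro i hi
    by_contra h
    have h' : ¬ ((i : ℕ) ≤ n) := by
      intro h2
      apply h
      rw [Set.mem_Iic, ← PNat.coe_le_coe, Nat.succPNat_coe]
      omega
    exact hi (by simp [Function.Involutive.toPerm, longestFun, h'])⟩

/-- The permutations that fix every integer outside a finite set are finite in number. -/
theorem finite_of_fixes {A : Set ℕ+} (hA : A.Finite) :
    {v : SInf | ∀ i, i ∉ A → v.1 i = i}.Finite := by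
  have hfin : Finite {i // i ∈ A} := hA
  have h1 : Finite {f : Equiv.Perm ℕ+ // ∀ a, ¬ (a ∈ A) → f a = a} :=
    Finite.of_equiv _ (Equiv.Perm.subtypeEquivSubtypePerm (fun i => i ∈ A))
  have h2 : {f : Equiv.Perm ℕ+ | ∀ a, ¬ (a ∈ A) → f a = a}.Finite := h1
  refine Set.Finite.of_finite_image (f := Subtype.val)
    (h2.subset ?_) Subtype.val_injective.injOn
  rintro _ ⟨v, hv, rfl⟩ a ha
  exact hv a ha

theorem finite_inversions (w : SInf) : w.inversions.Finite := by
  obtain ⟨n, hn⟩ := w.exists_bound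
  have key : ∀ a b : ℕ+, a < b → w.1 b < w.1 a → (b : ℕ) ≤ n := by
    intro a b hab hw
    by_contra hb
    rw [hn b (by omega)] at hw
    have h1 : n < ((w.1 a : ℕ+) : ℕ) := by
      have : (b : ℕ) < (w.1 a : ℕ+) := by exact_mod_cast hw
      omega
    have h2 := w.1.injective (hn _ h1)
    rw [h2] at hw
    exact absurd hab (not_lt.2 hw.le)
  refine ((Set.finite_Iic n.succPNat).prod (Set.finite_Iic n.succPNat)).subset ?_
  rintro ⟨a, b⟩ ⟨hab, hw⟩
  have hb := key a b hab hw
  have hb' : b ≤ n.succPNat := by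
    rw [← PNat.coe_le_coe, Nat.succPNat_coe]; omega
  exact ⟨hab.le.trans hb', hb'⟩

end SInf

/-! ### Schubert polynomials -/

theorem X_sub_X_dvd (i : ℕ+) (f : MvPolynomial ℕ+ ℤ) :
    (MvPolynomial.X i - MvPolynomial.X (i + 1) : MvPolynomial ℕ+ ℤ) ∣
      f - MvPolynomial.rename (Equiv.swap i (i + 1)) f := by
  induction f using MvPolynomial.induction_on with
  | C a => simp
  | add p q hp hq =>
    have : p + q - MvPolynomial.rename (Equiv.swap i (i + 1)) (p + q) =
        (p - MvPolynomial.rename (Equiv.swap i (i + 1)) p) +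
        (q - MvPolynomial.rename (Equiv.swap i (i + 1)) q) := by
      rw [map_add]; ring
    rw [this]
    exact dvd_add hp hq
  | mul_X p k hp =>
    have h1 : (MvPolynomial.X i - MvPolynomial.X (i + 1) : MvPolynomial ℕ+ ℤ) ∣
        MvPolynomial.X k - MvPolynomial.X (Equiv.swap i (i + 1) k) := by
      by_cases h : k = i
      · subst h; simp
      · by_cases h' : k = i + 1
        · subst h'
          rw [Equiv.swap_apply_right]
          exact ⟨-1, by ring⟩
        · rw [Equiv.swap_apply_of_ne_of_ne h h']; simp
    have : p * MvPolynomial.X k -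
          MvPolynomial.rename (Equiv.swap i (i + 1)) (p * MvPolynomial.X k) =
        (p - MvPolynomial.rename (Equiv.swap i (i + 1)) p) * MvPolynomial.X k +
        MvPolynomial.rename (Equiv.swap i (i + 1)) p *
          (MvPolynomial.X k - MvPolynomial.X (Equiv.swap i (i + 1) k)) := by
      rw [map_mul, MvPolynomial.rename_X]; ring
    rw [this]
    exact dvd_add (Dvd.dvd.mul_right hp _) (Dvd.dvd.mul_left h1 _)

/-- The divided difference `∂_i f = (f - s_i f) / (x_i - x_{i+1})`. -/
def dividedDiff (i : ℕ+) (f : MvPolynomial ℕ+ ℤ) : MvPolynomial ℕ+ ℤ :=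
  (X_sub_X_dvd i f).choose

/-- `∂_v = ∂_{a_1} ∘ ⋯ ∘ ∂_{a_l}` for a reduced word `a` of `v`. -/
def dividedDiffPerm (v : SInf) (f : MvPolynomial ℕ+ ℤ) : MvPolynomial ℕ+ ℤ :=
  if h : ∃ a, v.IsReducedWord a then h.choose.foldr dividedDiff f else 0

/-- The staircase monomial `x_1^{n-1} x_2^{n-2} ⋯ x_{n-1}`. -/
def staircase (n : ℕ) : MvPolynomial ℕ+ ℤ :=
  ∏ i ∈ Finset.range n, MvPolynomial.X i.succPNat ^ (n - 1 - i)

/-- The Schubert polynomial `𝔖_w = ∂_{w⁻¹ω₀} (x_1^{n-1} x_2^{n-2} ⋯ x_{n-1})`, where `w ∈ S_n`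
and `ω₀` is the longest element of `S_n`. -/
def schubert (w : SInf) : MvPolynomial ℕ+ ℤ :=
  dividedDiffPerm (w⁻¹ * SInf.longest w.size) (staircase w.size)

/-- The coefficient of `𝔖_w` in the expansion of `f` in the basis of Schubert polynomials. -/
def schubertCoeff (f : MvPolynomial ℕ+ ℤ) (w : SInf) : ℤ :=
  if h : ∃ c : SInf →₀ ℤ, f = c.sum (fun v a => a • schubert v) then h.choose w else 0

/-! ### Symmetric functions

Symmetric functions are formal power series in `x_1, x_2, …` with integer coefficients. Partitions
are Young diagrams, a cell `(i, j)` standing in row `i` and column `j` (both counted from `0`). -/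

/-- Formal power series over `ℤ` in the variables `x_1, x_2, …`. -/
abbrev Series : Type := MvPowerSeries ℕ+ ℤ

/-- The complete homogeneous symmetric function `h_n`, the sum of all monomials of degree `n`. -/
def hSym (n : ℕ) : Series := fun d => if d.degree = n then 1 else 0

/-- `h_α = h_{α_1} ⋯ h_{α_k}`. -/
def hList (α : List ℕ) : Series := (α.map hSym).prod

/-- The ring of symmetric functions `Λ = ℤ[h_1, h_2, …]`. -/
def Λ : Subalgebra ℤ Series := Algebra.adjoin ℤ (Set.range hSym)

theorem hList_mem (α : List ℕ) : hList α ∈ Λ := by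
  refine Subalgebra.list_prod_mem _ ?_
  intro x hx
  obtain ⟨n, -, rfl⟩ := List.mem_map.1 hx
  exact Algebra.subset_adjoin ⟨n, rfl⟩

/-- The cells of the skew shape `lam/μ`. -/
abbrev SkewCell (lam μ : YoungDiagram) : Type := {c : ℕ × ℕ // c ∈ lam ∧ c ∉ μ}

/-- `T` is a semistandard tableau of shape `lam/μ` (weakly increasing along rows, strictly
increasing along columns). -/
def IsSSYT {lam μ : YoungDiagram} (T : SkewCell lam μ → ℕ+) : Prop :=
  (∀ c c', c.1.1 = c'.1.1 → c.1.2 < c'.1.2 → T c ≤ T c') ∧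
  (∀ c c', c.1.2 = c'.1.2 → c.1.1 < c'.1.1 → T c < T c')

/-- The skew Schur function `S_{lam/μ}`: the sum of `x^T` over all semistandard tableaux `T` of
shape `lam/μ`. -/
def skewSchur (lam μ : YoungDiagram) : Series := fun d =>
  ({T : SkewCell lam μ → ℕ+ | IsSSYT T ∧ ∀ i, {c | T c = i}.ncard = d i}.ncard : ℤ)

/-- The Schur function `S_lam`. -/
def schur (lam : YoungDiagram) : Series := skewSchur lam ⊥

/-- The Schur polynomial `S_lam(x_1, …, x_k)`. -/
def schurPoly (lam : YoungDiagram) (k : ℕ+) : MvPolynomial ℕ+ ℤ :=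
  ∑ᶠ T ∈ {T : SkewCell lam ⊥ → ℕ+ | IsSSYT T ∧ ∀ c, T c ≤ k},
    ∏ᶠ c, (MvPolynomial.X (T c) : MvPolynomial ℕ+ ℤ)

theorem finite_diagrams (m : ℕ) : {lam : YoungDiagram | lam.card = m}.Finite := by
  have hinj : Function.Injective YoungDiagram.cells := fun a b hab => YoungDiagram.ext hab
  refine Set.Finite.of_finite_image (f := YoungDiagram.cells) (Set.Finite.subset
    (Finset.finite_toSet (Finset.range m ×ˢ Finset.range m).powerset) ?_) hinj.injOn
  rintro _ ⟨lam, hlam, rfl⟩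
  have hm : lam.cells.card = m := hlam
  simp only [Finset.coe_powerset, Set.mem_preimage, Set.mem_powerset_iff, Finset.coe_subset]
  rintro ⟨i, j⟩ hij
  have hij' : (i, j) ∈ lam := hij
  rw [Finset.mem_product, Finset.mem_range, Finset.mem_range]
  constructor
  · have h1 : i < lam.colLen j := YoungDiagram.mem_iff_lt_colLen.1 hij'
    have h2 : (lam.col j).card ≤ lam.cells.card :=
      Finset.card_le_card (Finset.filter_subset _ _)
    rw [← YoungDiagram.colLen_eq_card] at h2
    omega
  · have h1 : j < lam.rowLen i := YoungDiagram.mem_iff_lt_rowLen.1 hij'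
    have h2 : (lam.row i).card ≤ lam.cells.card :=
      Finset.card_le_card (Finset.filter_subset _ _)
    rw [← YoungDiagram.rowLen_eq_card] at h2
    omega

/-- The partitions of `m`. -/
def partitions (m : ℕ) : Finset YoungDiagram := (finite_diagrams m).toFinset

/-- The Stanley symmetric function
`F_w = ∑ x_{i_1} ⋯ x_{i_l}`, over all reduced words `a_1 ⋯ a_l` of `w = s_{a_1} ⋯ s_{a_l}` and all
`i_1 ≤ ⋯ ≤ i_l` with `i_j < i_{j+1}` whenever `a_j < a_{j+1}`. A pair of such sequences is given as
the list `(a_1, i_1), …, (a_l, i_l)`. -/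
def stanley (w : SInf) : Series := fun d =>
  ({p : List (ℕ+ × ℕ+) | w.IsReducedWord (p.map Prod.fst) ∧
      p.IsChain (fun x y => x.2 ≤ y.2 ∧ (x.1 < y.1 → x.2 < y.2)) ∧
      ∀ i, (p.map Prod.snd).count i = d i}.ncard : ℤ)

/-! ### Labeled posets -/

/-- A finite poset with an integer label for each cover. -/
structure LabeledPoset where
  carrier : Type u
  [order : PartialOrder carrier]
  [finite : Finite carrier]
  label : ∀ {x y : carrier}, x ⋖ y → ℤ

attribute [instance] LabeledPoset.order LabeledPoset.finite

namespace LabeledPoset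

/-- The maximal chains `x_0 ⋖ x_1 ⋖ ⋯ ⋖ x_n`, with `x_0` minimal and `x_n` maximal. -/
def MaxChain (P : LabeledPoset.{u}) : Type u :=
  {c : RelSeries {p : P.carrier × P.carrier | p.1 ⋖ p.2} // IsMin c.head ∧ IsMax c.last}

/-- The word of a maximal chain: the sequence of its edge labels. -/
def MaxChain.word {P : LabeledPoset.{u}} (c : P.MaxChain) : List ℤ :=
  List.ofFn (fun i : Fin c.1.length => P.label (c.1.step i))

/-- The total rank: the largest length of a maximal chain. -/
def rank (P : LabeledPoset.{u}) : ℕ := sSup (Set.range (fun c : P.MaxChain => c.1.length))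

/-- `P` is ranked: all maximal chains have the same length. -/
def IsRanked (P : LabeledPoset.{u}) : Prop := ∀ c : P.MaxChain, c.1.length = P.rank

/-- The descent set `{j | w_j > w_{j+1}}` of a word `w_1 ⋯ w_m`. -/
def descents (w : List ℤ) : Set ℕ := {j | ∃ hj : j < w.length, 0 < j ∧ w[j] < w[j - 1]}

/-- The partial sums of `α`. -/
def partialSums (α : List ℕ) : Set ℕ := {n | ∃ i, n = (α.take i).sum}

/-- `H_α(P)`: the maximal chains whose length is `α_1 + ⋯ + α_k` and whose word has its descent
set contained in the set of the partial sums of `α`. -/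
def H (P : LabeledPoset.{u}) (α : List ℕ) : Set P.MaxChain :=
  {c | c.word.length = α.sum ∧ descents c.word ⊆ partialSums α}

/-- `P` is a symmetric labeled poset: it is ranked, and the cardinality of `H_α(P)` depends only
on the parts of `α` and not on their order. -/
def IsSymmetric (P : LabeledPoset.{u}) : Prop :=
  P.IsRanked ∧ ∀ α β : List ℕ, α.Perm β → (P.H α).ncard = (P.H β).ncard

/-- `χ : Λ → ℤ` maps `h_α` to `#H_α(P)` for all `α`. -/
def IsChi (P : LabeledPoset.{u}) (χ : Λ →ₗ[ℤ] ℤ) : Prop :=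
  ∀ α : List ℕ, χ ⟨hList α, hList_mem α⟩ = ((P.H α).ncard : ℤ)

/-- The linear map `χ_P : Λ → ℤ`, `h_α ↦ #H_α(P)`. -/
def chi (P : LabeledPoset.{u}) : Λ →ₗ[ℤ] ℤ :=
  if hχ : ∃ χ, P.IsChi χ then hχ.choose else 0

/-- The skew coefficient `c^P_lam = χ_P(S_lam)`. -/
def skewCoeff (P : LabeledPoset.{u}) (lam : YoungDiagram) : ℤ :=
  if hl : schur lam ∈ Λ then P.chi ⟨schur lam, hl⟩ else 0

/-- The symmetric function `S_P = ∑ c^P_lam S_lam`, over the partitions `lam` of the total rank. -/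
def S (P : LabeledPoset.{u}) : Series :=
  ∑ lam ∈ partitions P.rank, P.skewCoeff lam • schur lam

/-- Isomorphisms of labeled posets: order isomorphisms that preserve the relative order of the
edge labels. -/
structure Iso (P : LabeledPoset.{u}) (Q : LabeledPoset.{v}) where
  toOrderIso : P.carrier ≃o Q.carrier
  label_le_label_iff : ∀ {x y x' y' : P.carrier} (e : x ⋖ y) (e' : x' ⋖ y')
    (f : toOrderIso x ⋖ toOrderIso y) (f' : toOrderIso x' ⋖ toOrderIso y'),
    Q.label f ≤ Q.label f' ↔ P.label e ≤ P.label e'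

end LabeledPoset

/-! ### The `k`-Bruhat order -/

/-- The `k`-Bruhat order `u ≤_k w`. -/
def KBruhat (k : ℕ+) (u w : SInf) : Prop :=
  (∀ a b : ℕ+, a ≤ k → k < b → u.1 a ≤ w.1 a ∧ w.1 b ≤ u.1 b) ∧
  (∀ a b : ℕ+, a < b → u.1 a < u.1 b → w.1 b < w.1 a → a ≤ k ∧ k < b)

namespace KBruhat

variable {k : ℕ+} {u v w : SInf}

theorem refl (k : ℕ+) (u : SInf) : KBruhat k u u :=
  ⟨fun _ _ _ _ => ⟨le_rfl, le_rfl⟩, fun _ _ _ h1 h2 => absurd h1 (not_lt.2 h2.le)⟩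

theorem le_left (huw : KBruhat k u w) {a : ℕ+} (ha : a ≤ k) : u.1 a ≤ w.1 a :=
  (huw.1 a (k + 1) ha (PNat.lt_add_right k 1)).1

theorem le_right (huw : KBruhat k u w) {b : ℕ+} (hb : k < b) : w.1 b ≤ u.1 b :=
  (huw.1 k b le_rfl hb).2

theorem trans (h1 : KBruhat k u v) (h2 : KBruhat k v w) : KBruhat k u w := by
  refine ⟨fun a b ha hb => ⟨(h1.le_left ha).trans (h2.le_left ha),
    (h2.le_right hb).trans (h1.le_right hb)⟩, fun a b hab hu hw => ?_⟩
  rcases lt_trichotomy (v.1 a) (v.1 b) with h | h | h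
  · exact h2.2 a b hab h hw
  · exact absurd (v.1.injective h) hab.ne
  · exact h1.2 a b hab hu h

theorem antisymm (h1 : KBruhat k u w) (h2 : KBruhat k w u) : u = w := by
  apply Subtype.ext
  apply Equiv.ext
  intro i
  rcases le_or_gt i k with h | h
  · exact le_antisymm (h1.le_left h) (h2.le_left h)
  · exact le_antisymm (h2.le_right h) (h1.le_right h)

theorem apply_eq (h1 : KBruhat k u v) (h2 : KBruhat k v w) {i : ℕ+} (hi : w.1 i = u.1 i) :
    v.1 i = u.1 i := by
  rcases le_or_gt i k with h | h
  · exact le_antisymm ((h2.le_left h).trans hi.le) (h1.le_left h)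
  · exact le_antisymm (h1.le_right h) (hi.ge.trans (h2.le_right h))

end KBruhat

/-- The label `b` of a cover `u ⋖ w` with `w u⁻¹ = (a, b)` and `a < b`. -/
def transpositionLabel (u w : SInf) : ℤ :=
  Classical.epsilon (fun l : ℤ =>
    ∃ a b : ℕ+, a < b ∧ w * u⁻¹ = SInf.swap a b ∧ l = ((b : ℕ) : ℤ))

/-- The interval `[u, w]_k` of the `k`-Bruhat order, labeled by `transpositionLabel`. -/
def kBruhatInterval (k : ℕ+) (u w : SInf) : LabeledPoset.{0} where
  carrier := {v : SInf // KBruhat k u v ∧ KBruhat k v w}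
  order :=
    { le := fun x y => KBruhat k x.1 y.1
      le_refl := fun x => KBruhat.refl k x.1
      le_trans := fun _ _ _ h1 h2 => h1.trans h2
      le_antisymm := fun _ _ h1 h2 => Subtype.ext (h1.antisymm h2) }
  finite := by
    refine Set.Finite.of_finite_image (f := fun v : SInf => u⁻¹ * v)
      (Set.Finite.subset (SInf.finite_of_fixes (u⁻¹ * w).2) ?_) (mul_right_injective _).injOn
    rintro _ ⟨v, ⟨h1, h2⟩, rfl⟩ i hi
    have hi' : w.1 i = u.1 i := by
      have : (u.1)⁻¹ (w.1 i) = i := not_not.1 hi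
      rwa [Equiv.Perm.inv_eq_iff_eq] at this
    change (u.1)⁻¹ (v.1 i) = i
    rw [Equiv.Perm.inv_eq_iff_eq]
    exact h1.apply_eq h2 hi'
  label := fun {x y} _ => transpositionLabel x.1 y.1

/-! ### Skew Schubert functions -/

/-- `c^w_{u, v(lam,k)}`: the coefficient of `𝔖_w` in `𝔖_u · S_lam(x_1, …, x_k)`. -/
def schubertSchurCoeff (k : ℕ+) (u w : SInf) (lam : YoungDiagram) : ℤ :=
  schubertCoeff (schubert u * schurPoly lam k) w

/-- `∑_lam c^w_{u, v(lam,k)} S_lam`. -/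
def skewSchubertOf (k : ℕ+) (u w : SInf) : Series :=
  ∑ᶠ lam : YoungDiagram, schubertSchurCoeff k u w lam • schur lam

/-- The skew Schubert function `S_ζ = ∑_lam c^ζ_lam S_lam`, where
`c^ζ_lam = c^w_{u, v(lam,k)}` for any `u ≤_k w` with `w = ζ u`. -/
def skewSchubert (ζ : SInf) : Series :=
  if hζ : ∃ p : ℕ+ × SInf, KBruhat p.1 p.2 (ζ * p.2) then
    skewSchubertOf hζ.choose.1 hζ.choose.2 (ζ * hζ.choose.2)
  else 0

/-! ### The order `≼` -/

/-- `η ≼ ζ`: there are `u` and `k` with `u ≤_k η u ≤_k ζ u`. -/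
def Preceq (η ζ : SInf) : Prop :=
  ∃ (u : SInf) (k : ℕ+), KBruhat k u (η * u) ∧ KBruhat k (η * u) (ζ * u)

namespace Preceq

variable {η ζ ξ : SInf}

theorem between (hp : Preceq η ζ) {v : SInf} {l : ℕ+} (hv : KBruhat l v (ζ * v)) :
    KBruhat l v (η * v) ∧ KBruhat l (η * v) (ζ * v) := by
  obtain ⟨u, k, h1, h2⟩ := hp
  have h3 := h1.trans h2
  have dich : ∀ a : ℕ+, (u.1⁻¹ a ≤ k ∧ a ≤ η.1 a ∧ η.1 a ≤ ζ.1 a) ∨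
      (k < u.1⁻¹ a ∧ η.1 a ≤ a ∧ ζ.1 a ≤ η.1 a) := by
    intro a
    have e : u.1 (u.1⁻¹ a) = a := Equiv.apply_symm_apply u.1 a
    rcases le_or_gt (u.1⁻¹ a) k with h | h
    · left
      have x1 : u.1 (u.1⁻¹ a) ≤ η.1 (u.1 (u.1⁻¹ a)) := h1.le_left h
      have x2 : η.1 (u.1 (u.1⁻¹ a)) ≤ ζ.1 (u.1 (u.1⁻¹ a)) := h2.le_left h
      rw [e] at x1 x2
      exact ⟨h, x1, x2⟩
    · right
      have x1 : η.1 (u.1 (u.1⁻¹ a)) ≤ u.1 (u.1⁻¹ a) := h1.le_right h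
      have x2 : ζ.1 (u.1 (u.1⁻¹ a)) ≤ η.1 (u.1 (u.1⁻¹ a)) := h2.le_right h
      rw [e] at x1 x2
      exact ⟨h, x1, x2⟩
  have c1 : ∀ a b : ℕ+, u.1⁻¹ a < u.1⁻¹ b → a < b → η.1 b < η.1 a →
      u.1⁻¹ a ≤ k ∧ k < u.1⁻¹ b := by
    intro a b hab hlt hη
    have ea : u.1 (u.1⁻¹ a) = a := Equiv.apply_symm_apply u.1 a
    have eb : u.1 (u.1⁻¹ b) = b := Equiv.apply_symm_apply u.1 b
    refine h1.2 _ _ hab ?_ ?_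
    · rw [ea, eb]; exact hlt
    · change η.1 (u.1 _) < η.1 (u.1 _)
      rw [ea, eb]; exact hη
  have c2 : ∀ a b : ℕ+, u.1⁻¹ a < u.1⁻¹ b → η.1 a < η.1 b → ζ.1 b < ζ.1 a →
      u.1⁻¹ a ≤ k ∧ k < u.1⁻¹ b := by
    intro a b hab hlt hη
    have ea : u.1 (u.1⁻¹ a) = a := Equiv.apply_symm_apply u.1 a
    have eb : u.1 (u.1⁻¹ b) = b := Equiv.apply_symm_apply u.1 b
    refine h2.2 _ _ hab ?_ ?_
    · change η.1 (u.1 _) < η.1 (u.1 _)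
      rw [ea, eb]; exact hlt
    · change ζ.1 (u.1 _) < ζ.1 (u.1 _)
      rw [ea, eb]; exact hη
  have up : ∀ i : ℕ+, i ≤ l → v.1 i ≤ ζ.1 (v.1 i) := fun i hi => hv.le_left hi
  have dn : ∀ i : ℕ+, l < i → ζ.1 (v.1 i) ≤ v.1 i := fun i hi => hv.le_right hi
  have nc : ∀ i j : ℕ+, i < j → v.1 i < v.1 j → ¬ (i ≤ l ∧ l < j) →
      ζ.1 (v.1 i) < ζ.1 (v.1 j) := by
    intro i j hij hlt hn
    rcases lt_trichotomy (ζ.1 (v.1 i)) (ζ.1 (v.1 j)) with h | h | h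
    · exact h
    · exact absurd (v.1.injective (ζ.1.injective h)) hij.ne
    · exact absurd (hv.2 i j hij hlt h) hn
  have neq : ∀ a b : ℕ+, a ≠ b → u.1⁻¹ a ≠ u.1⁻¹ b :=
    fun a b hab h => hab ((u.1⁻¹).injective h)
  have bl : ∀ a : ℕ+, a ≤ ζ.1 a → a ≤ η.1 a ∧ η.1 a ≤ ζ.1 a := by
    intro a ha
    rcases dich a with ⟨-, x, y⟩ | ⟨-, x, y⟩
    · exact ⟨x, y⟩
    · have : a = ζ.1 a := le_antisymm ha (y.trans x)
      have h5 : η.1 a = a := le_antisymm x (this.le.trans y)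
      rw [h5]; exact ⟨le_rfl, ha⟩
  have br : ∀ a : ℕ+, ζ.1 a ≤ a → η.1 a ≤ a ∧ ζ.1 a ≤ η.1 a := by
    intro a ha
    rcases dich a with ⟨-, x, y⟩ | ⟨-, x, y⟩
    · have : a = ζ.1 a := le_antisymm (x.trans y) ha
      have h5 : η.1 a = a := le_antisymm (y.trans ha) x
      rw [h5]; exact ⟨le_rfl, ha⟩
    · exact ⟨x, y⟩
  refine ⟨⟨fun i j hi hj => ⟨(bl _ (up i hi)).1, (br _ (dn j hj)).1⟩, ?_⟩,
    ⟨fun i j hi hj => ⟨(bl _ (up i hi)).2, (br _ (dn j hj)).2⟩, ?_⟩⟩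
  · intro i j hij hlt hη
    change η.1 (v.1 j) < η.1 (v.1 i) at hη
    by_contra hn
    have hζ := nc i j hij hlt hn
    have side : (j ≤ l) ∨ (l < i) := by
      rcases le_or_gt j l with h | h
      · exact Or.inl h
      · right; by_contra h'; exact hn ⟨not_lt.1 h', h⟩
    have key : u.1⁻¹ (v.1 i) ≤ k ∧ k < u.1⁻¹ (v.1 j) := by
      rcases lt_or_gt_of_ne (neq _ _ hlt.ne) with h | h
      · exact c1 _ _ h hlt hη
      · have := c2 _ _ h hη hζ
        exfalso
        rcases dich (v.1 i) with ⟨x, -, -⟩ | ⟨-, x1, x2⟩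
        · exact absurd this.2 (not_lt.2 x)
        · rcases dich (v.1 j) with ⟨-, y1, y2⟩ | ⟨y, -, -⟩
          · exact absurd (hη.trans_le (x1.trans (hlt.le.trans y1))) (lt_irrefl _)
          · exact absurd this.1 (not_le.2 y)
    rcases dich (v.1 i) with ⟨-, x1, x2⟩ | ⟨x, -, -⟩
    · rcases dich (v.1 j) with ⟨y, -, -⟩ | ⟨-, y1, y2⟩
      · exact absurd key.2 (not_lt.2 y)
      · rcases side with h | h
        · have := (bl _ (up j h)).1
          exact absurd (hη.trans_le (x2.trans (hζ.le.trans y2))) (lt_irrefl _)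
        · have := (br _ (dn i h)).1
          exact absurd (hη.trans_le (x2.trans (hζ.le.trans y2))) (lt_irrefl _)
    · exact absurd key.1 (not_le.2 x)
  · intro i j hij hη hζ
    change η.1 (v.1 i) < η.1 (v.1 j) at hη
    change ζ.1 (v.1 j) < ζ.1 (v.1 i) at hζ
    rcases lt_trichotomy (v.1 i) (v.1 j) with hlt | heq | hgt
    · exact hv.2 i j hij hlt hζ
    · exact absurd (v.1.injective heq) hij.ne
    · exfalso
      rcases lt_or_gt_of_ne (neq _ _ hgt.ne) with h | h
      · have hk := c1 _ _ h hgt hη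
        rcases dich (v.1 i) with ⟨x, -, -⟩ | ⟨-, x1, x2⟩
        · exact absurd hk.2 (not_lt.2 x)
        · rcases dich (v.1 j) with ⟨-, y1, y2⟩ | ⟨y, -, -⟩
          · exact absurd (hη.trans_le (y2.trans (hζ.le.trans x2))) (lt_irrefl _)
          · exact absurd hk.1 (not_le.2 y)
      · have hk := c2 _ _ h hη hζ
        rcases dich (v.1 i) with ⟨-, x1, x2⟩ | ⟨x, -, -⟩
        · rcases dich (v.1 j) with ⟨y, -, -⟩ | ⟨-, y1, y2⟩
          · exact absurd hk.2 (not_lt.2 y)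
          · exact absurd (hη.trans_le (y1.trans (hgt.le.trans x1))) (lt_irrefl _)
        · exact absurd hk.1 (not_le.2 x)

theorem refl_of_le (hp : Preceq η ζ) : Preceq η η := by
  obtain ⟨u, k, h1, -⟩ := hp
  exact ⟨u, k, h1, KBruhat.refl _ _⟩

theorem trans (h1 : Preceq η ζ) (h2 : Preceq ζ ξ) : Preceq η ξ := by
  obtain ⟨v, l, x, y⟩ := h2
  obtain ⟨p, q⟩ := h1.between x
  exact ⟨v, l, p, q.trans y⟩

theorem antisymm (h1 : Preceq η ζ) (h2 : Preceq ζ η) : η = ζ := by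
  obtain ⟨v, l, x, y⟩ := h1
  obtain ⟨-, q⟩ := h2.between x
  exact mul_right_cancel (y.antisymm q)

theorem fixes (hp : Preceq η ζ) {i : ℕ+} (hi : ζ.1 i = i) : η.1 i = i := by
  obtain ⟨u, k, h1, h2⟩ := hp
  have e : u.1 (u.1⁻¹ i) = i := Equiv.apply_symm_apply u.1 i
  have : η.1 (u.1 (u.1⁻¹ i)) = u.1 (u.1⁻¹ i) := h1.apply_eq h2 (by
    change ζ.1 (u.1 (u.1⁻¹ i)) = u.1 (u.1⁻¹ i)
    rw [e, hi])
  rwa [e] at this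

end Preceq

/-- The interval `[1, ζ]_≼`, labeled by `transpositionLabel`. -/
def preceqInterval (ζ : SInf) : LabeledPoset.{0} where
  carrier := {η : SInf // Preceq 1 η ∧ Preceq η ζ}
  order :=
    { le := fun x y => Preceq x.1 y.1
      le_refl := fun x => x.2.2.refl_of_le
      le_trans := fun _ _ _ h1 h2 => h1.trans h2
      le_antisymm := fun _ _ h1 h2 => Subtype.ext (h1.antisymm h2) }
  finite := (SInf.finite_of_fixes ζ.2).subset (fun _ hη _ hi => hη.2.fixes (not_not.1 hi))
  label := fun {x y} _ => transpositionLabel x.1 y.1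

/-! ### Young's lattice -/

/-- The label `lam_i - i` of a cover `μ ⋖ lam` with `μ_i + 1 = lam_i`, where the rows are counted
from `1` (`YoungDiagram.rowLen` counts them from `0`). -/
def youngLabel (μ lam : YoungDiagram) : ℤ :=
  Classical.epsilon (fun l : ℤ =>
    ∃ i : ℕ, μ.rowLen i + 1 = lam.rowLen i ∧ l = (lam.rowLen i : ℤ) - ((i : ℤ) + 1))

/-- The interval `[μ, lam]` in Young's lattice. -/
def youngInterval (μ lam : YoungDiagram) : LabeledPoset.{0} where
  carrier := {ν : YoungDiagram // μ ≤ ν ∧ ν ≤ lam}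
  finite := by
    have hinj : Function.Injective YoungDiagram.cells := fun a b hab => YoungDiagram.ext hab
    refine Set.Finite.of_finite_image (f := YoungDiagram.cells) (Set.Finite.subset
      (Finset.finite_toSet lam.cells.powerset) ?_) hinj.injOn
    rintro _ ⟨ν, hν, rfl⟩
    simpa using YoungDiagram.cells_subset_iff.2 hν.2
  label := fun {x y} _ => youngLabel x.1 y.1

/-! ### The weak order -/

/-- The covers of the weak order: `w = s_i u` with `ℓ(w) = ℓ(u) + 1`. -/
def WeakCover (u w : SInf) : Prop := ∃ i : ℕ+, w = SInf.s i * u ∧ w.len = u.len + 1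

/-- The weak order on `S_∞`. -/
def Weak : SInf → SInf → Prop := Relation.ReflTransGen WeakCover

namespace Weak

theorem len_le {u w : SInf} (huw : Weak u w) : u.len ≤ w.len := by
  induction huw with
  | refl => exact le_rfl
  | tail _ hc ih =>
    obtain ⟨i, -, hi⟩ := hc
    omega

theorem antisymm {u w : SInf} (h1 : Weak u w) (h2 : Weak w u) : u = w := by
  rcases Relation.ReflTransGen.cases_tail h1 with h | ⟨v, hv, i, -, hi⟩
  · exact h.symm
  · have := len_le hv
    have := len_le h2
    omega

theorem fixes_of_cover {u w : SInf} (hc : WeakCover u w) {n : ℕ}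
    (hw : ∀ i : ℕ+, n < (i : ℕ) → w.1 i = i) : ∀ i : ℕ+, n < (i : ℕ) → u.1 i = i := by
  obtain ⟨i, rfl, hlen⟩ := hc
  have hval : ∀ j, (SInf.s i * u).1 j = Equiv.swap i (i + 1) (u.1 j) := fun _ => rfl
  -- if the value `i` does not come after the value `i + 1` in `s_i u`, then `ℓ(s_i u) ≤ ℓ(u)`
  have hpos : u.1⁻¹ i < u.1⁻¹ (i + 1) := by
    by_contra hcon
    have hne : u.1⁻¹ (i + 1) ≠ u.1⁻¹ i := fun h =>
      (PNat.lt_add_right i 1).ne' ((u.1⁻¹).injective h)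
    have hlt : u.1⁻¹ (i + 1) < u.1⁻¹ i := lt_of_le_of_ne (not_lt.1 hcon) hne
    have hsub : (SInf.s i * u).inversions ⊆ u.inversions := by
      rintro ⟨a, b⟩ ⟨hab, hinv⟩
      refine ⟨hab, ?_⟩
      simp only [hval] at hinv
      change a < b at hab
      change u.1 b < u.1 a
      by_contra hge
      have hne' : u.1 a ≠ u.1 b := fun h => hab.ne (u.1.injective h)
      have hlt' : u.1 a < u.1 b := lt_of_le_of_ne (not_lt.1 hge) hne'
      by_cases ha : u.1 a = i
      · by_cases hb : u.1 b = i + 1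
        · have ea : u.1⁻¹ i = a := by rw [Equiv.Perm.inv_eq_iff_eq, ha]
          have eb : u.1⁻¹ (i + 1) = b := by rw [Equiv.Perm.inv_eq_iff_eq, hb]
          rw [ea, eb] at hlt
          exact absurd hab (not_lt.2 hlt.le)
        · rw [ha, Equiv.swap_apply_left, Equiv.swap_apply_of_ne_of_ne
            (by rw [← ha]; exact hne'.symm) hb] at hinv
          rw [ha] at hlt'
          exact absurd (PNat.add_one_le_iff.2 hlt') (not_le.2 hinv)
      · by_cases ha' : u.1 a = i + 1
        · rw [ha', Equiv.swap_apply_right, Equiv.swap_apply_of_ne_of_ne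
            (fun h => by
              rw [ha', h] at hlt'
              exact absurd hlt' (not_lt.2 (PNat.lt_add_right i 1).le))
            (by rw [← ha']; exact hne'.symm)] at hinv
          rw [ha'] at hlt'
          exact absurd ((PNat.lt_add_right i 1).trans hlt') (not_lt.2 hinv.le)
        · rw [Equiv.swap_apply_of_ne_of_ne ha ha'] at hinv
          by_cases hb : u.1 b = i
          · rw [hb, Equiv.swap_apply_left] at hinv
            rw [hb] at hlt'
            exact absurd (hlt'.trans (PNat.lt_add_right i 1)) (not_lt.2 hinv.le)
          · by_cases hb' : u.1 b = i + 1
            · rw [hb', Equiv.swap_apply_right] at hinv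
              rw [hb'] at hlt'
              exact absurd (PNat.lt_add_one_iff.1 hlt') (not_le.2 hinv)
            · rw [Equiv.swap_apply_of_ne_of_ne hb hb'] at hinv
              exact absurd hinv (not_lt.2 hlt'.le)
    have := Set.ncard_le_ncard hsub u.finite_inversions
    unfold SInf.len at hlen
    omega
  -- hence `i + 1 ≤ n`
  have key : ((i + 1 : ℕ+) : ℕ) ≤ n := by
    by_contra hcon
    have e1 : u.1 (i + 1) = i := by
      have := hw (i + 1) (by omega)
      rw [hval, Equiv.swap_apply_eq_iff, Equiv.swap_apply_right] at this
      exact this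
    have e2 : u.1⁻¹ i = i + 1 := by rw [Equiv.Perm.inv_eq_iff_eq, e1]
    rw [e2] at hpos
    have e3 := hw (u.1⁻¹ (i + 1)) (by
      have : ((i + 1 : ℕ+) : ℕ) < (u.1⁻¹ (i + 1) : ℕ+) := by exact_mod_cast hpos
      omega)
    have e4 : u.1 (u.1⁻¹ (i + 1)) = i + 1 := Equiv.apply_symm_apply u.1 (i + 1)
    rw [hval, e4, Equiv.swap_apply_right] at e3
    rw [← e3] at hpos
    exact absurd hpos (not_lt.2 (PNat.lt_add_right i 1).le)
  intro j hj
  have := hw j hj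
  rw [hval, Equiv.swap_apply_eq_iff, Equiv.swap_apply_of_ne_of_ne] at this
  · exact this
  · rintro rfl
    rw [PNat.add_coe] at key
    omega
  · rintro rfl
    omega

theorem fixes {u w : SInf} (huw : Weak u w) {n : ℕ}
    (hw : ∀ i : ℕ+, n < (i : ℕ) → w.1 i = i) : ∀ i : ℕ+, n < (i : ℕ) → u.1 i = i := by
  induction huw with
  | refl => exact hw
  | tail _ hc ih => exact ih (fixes_of_cover hc hw)

end Weak

/-- The label `i` of a cover `u ⋖ w` of the weak order with `w u⁻¹ = (i, i+1)`. -/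
def weakLabel (u w : SInf) : ℤ :=
  Classical.epsilon (fun l : ℤ => ∃ i : ℕ+, w * u⁻¹ = SInf.s i ∧ l = ((i : ℕ) : ℤ))

/-- The interval `[1, w]` of the weak order, labeled by `weakLabel`. -/
def weakInterval (w : SInf) : LabeledPoset.{0} where
  carrier := {v : SInf // Weak 1 v ∧ Weak v w}
  order :=
    { le := fun x y => Weak x.1 y.1
      le_refl := fun _ => Relation.ReflTransGen.refl
      le_trans := fun _ _ _ h1 h2 => Relation.ReflTransGen.trans h1 h2
      le_antisymm := fun _ _ h1 h2 => Subtype.ext (h1.antisymm h2) }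
  finite := by
    obtain ⟨n, hn⟩ := w.exists_bound
    refine (SInf.finite_of_fixes (Set.finite_Iic n.succPNat)).subset ?_
    intro v hv i hi
    refine hv.2.fixes hn i ?_
    by_contra hcon
    apply hi
    rw [Set.mem_Iic, ← PNat.coe_le_coe, Nat.succPNat_coe]
    omega
  label := fun {x y} _ => weakLabel x.1 y.1

end

end SkewSchubert

open SkewSchubert

/-!
The symmetric function `S_P` of a symmetric labeled poset is determined by the numbers `#H_α(P)` in
the simplest way: the coefficient of `x^α` in `S_P` is `#H_α(P)` (`LabeledPoset.coeff_S`). Indeed,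
the Kostka number `K_{lam, α}` is both the coefficient of `x^α` in `S_lam` and that of `S_lam` in
`h_α`. The latter is the Pieri rule (`hSym_mul_schurMap`), which follows from the commutation
relation of the operators that add and remove horizontal strips, hence from a bijection of Young
diagrams (`card_upStrips_inter`). The triangularity of the Kostka numbers shows that the `S_lam`
form a basis of `Λ` and that `χ_P` exists and is unique (`LabeledPoset.existsUnique_isChi`). In
particular, posets with the same numbers `#H_α(P)`, such as isomorphic ones, have the same `S_P`
(`LabeledPoset.S_eq_of_ncard_H`).

A maximal chain of each of the intervals in question is a path in a graph with labeled edges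
(`IsPathInterval`), and `#H_α(P)` counts the paths whose word splits into weakly increasing blocks
of sizes `α_1, α_2, …`. If the operator `A n` counts the paths of length `n` with weakly increasing
labels, then `#H_α(P)` is a matrix coefficient of `⋯ A α_2 A α_1` (`IsPathInterval.ncard_H_eq`), and
the symmetry of `P` is a consequence of relations between these operators.

* In Young's lattice, a path with weakly increasing labels adds the cells of a horizontal strip from
  left to right (`existsUnique_sorted`). So `#H_α` counts chains of horizontal strips, that is,
  semistandard tableaux of content `α` (`coeff_skewSchur`).
* In the weak order, the maximal chains of `[1, w]` are the reduced words of `w` read backwards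
  (`isReducedWord_iff_exists_path`), and the factorizations of a word into increasing blocks
  correspond to the monomials of `F_w` (`blockSorted_revContent_iff`). The operators commute, as the
  generating products `(1 + x u_n) ⋯ (1 + x u_1)` in the nilCoxeter algebra do (`genProd_comm`).
* In the `k`-Bruhat order, `#H_α([u, w]_k)` is the coefficient of `𝔖_w` in `𝔖_u h_α(x_1, …, x_k)`
  (`ncard_H_kBruhat`), which is clearly symmetric. By linearity, `χ_P(S_lam)` is the coefficient of
  `𝔖_w` in `𝔖_u S_lam(x_1, …, x_k)` (`chi_schur_kBruhat`), and `S_P` is the skew Schubert function.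

The assertion on the `k`-Bruhat order rests on the Pieri rule for Schubert polynomials in the form
that multiplication by `h_m(x_1, …, x_k)` is the operator `A m` (`realizes_hPoly`). Let `V k b` be
the sum of the covers in the `k`-Bruhat order with the label `b`, so that `A m` is the coefficient
of `t^m` in `(1 + t V k b_r) ⋯ (1 + t V k b_1)`, for the labels `b_1 < ⋯ < b_r`. This product for
`k + 1`, multiplied on the right by `1 - t M` where `M` is the multiplication by `x_{k+1}`, is the
product for `k` (`labelPoly_bruhatOp`), which is the recursion of the generating function of the
`h_m`. Here `M` is given by Monk's rule (`monk`), which is proved by induction with divided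
differences. Their effect on Schubert polynomials (`dividedDiff_schubert`) is obtained from the
description of the `𝔖_w` as the coefficients of a product of generating products in the nilCoxeter
algebra (`schubert_eq`).

Finally, `v ↦ v u⁻¹` is an isomorphism of `[u, ζ u]_k` onto `[1, ζ]_≼` (`preceqIso`), and for each
`ζ` there are `k` and `u` with `u ≤_k ζ u` (`exists_kBruhat`). So `S_{[1, ζ]_≼}` equals the skew
Schubert function that is formed with any such `k` and `u`, which is therefore well defined.
-/

namespace SkewSchubert

open scoped Classical

noncomputable section

/-! ### Chains as labeled paths -/

/-- `c` is a concatenation of weakly increasing words whose lengths are the parts of `α`. -/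
def BlockSorted {ι : Type*} [LE ι] : List ℕ → List ι → Prop
  | [], c => c = []
  | n :: α, c => n ≤ c.length ∧ (c.take n).Pairwise (· ≤ ·) ∧ BlockSorted α (c.drop n)

theorem blockSorted_map {ι : Type*} [LinearOrder ι] {φ : ι → ℤ} (hφ : StrictMono φ) :
    ∀ (α : List ℕ) (c : List ι), BlockSorted α (c.map φ) ↔ BlockSorted α c
  | [], c => by simp [BlockSorted]
  | n :: α, c => by
    simp only [BlockSorted, List.length_map]
    rw [← List.map_drop, blockSorted_map hφ α, ← List.map_take, List.pairwise_map]
    simp only [hφ.le_iff_le]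

/-- A word splits into weakly increasing blocks of sizes `α` if and only if its descents are among
the partial sums of `α`. -/
theorem blockSorted_iff (α : List ℕ) (c : List ℤ) : BlockSorted α c ↔
    c.length = α.sum ∧ LabeledPoset.descents c ⊆ LabeledPoset.partialSums α := by
  induction α generalizing c with
  | nil =>
    simp only [BlockSorted, List.sum_nil, List.length_eq_zero_iff]
    constructor
    · rintro rfl
      refine ⟨rfl, ?_⟩
      rintro j ⟨hj, -⟩
      simp at hj
    · exact fun h => h.1
  | cons n α ih =>
    simp only [BlockSorted, ih, List.length_drop, List.sum_cons]
    constructor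
    · rintro ⟨h1, h2, h3, h4⟩
      refine ⟨by omega, ?_⟩
      rintro j ⟨hj, hj0, hd⟩
      rcases lt_trichotomy j n with h | h | h
      · exfalso
        rw [List.pairwise_iff_getElem] at h2
        have := h2 (j - 1) j (by simp; omega) (by simp; omega) (by omega)
        simp only [List.getElem_take] at this
        omega
      · exact ⟨1, by simp [h]⟩
      · obtain ⟨i, hi⟩ := h4 (a := j - n) ⟨by simp; omega, by omega, by
          simp only [List.getElem_drop]
          have e1 : n + (j - n) = j := by omega
          have e2 : n + (j - n - 1) = j - 1 := by omega
          simpa only [e1, e2] using hd⟩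
        exact ⟨i + 1, by simp [← hi]; omega⟩
    · rintro ⟨h1, h2⟩
      refine ⟨by omega, ?_, by omega, ?_⟩
      · rw [← List.isChain_iff_pairwise, List.isChain_iff_getElem]
        intro i hi
        simp only [List.length_take] at hi
        simp only [List.getElem_take]
        by_contra hcon
        obtain ⟨k, hk⟩ := h2 (a := i + 1) ⟨by omega, by omega, by
          simpa using hcon⟩
        cases k with
        | zero => simp at hk
        | succ k => simp at hk; omega
      · rintro j ⟨hj, hj0, hd⟩
        simp only [List.length_drop] at hj
        simp only [List.getElem_drop] at hd
        obtain ⟨k, hk⟩ := h2 (a := n + j) ⟨by omega, by omega, by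
          have e2 : n + (j - 1) = n + j - 1 := by omega
          simpa only [e2] using hd⟩
        cases k with
        | zero => simp at hk; omega
        | succ k => exact ⟨k, by simpa using hk⟩

section Paths

variable {V ι : Type*} {step : V → ι → V → Prop}

/-- `p = (l_1, v_1), (l_2, v_2), …` is a path `x → v_1 → v_2 → ⋯` with labels `l_1, l_2, …`. -/
def IsPath (step : V → ι → V → Prop) : V → List (ι × V) → Prop
  | _, [] => True
  | x, e :: p => step x e.1 e.2 ∧ IsPath step e.2 p

/-- The last vertex of a path from `x`. -/
def endpt : V → List (ι × V) → V
  | x, [] => x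
  | _, e :: p => endpt e.2 p

@[simp] theorem endpt_nil (x : V) : endpt x ([] : List (ι × V)) = x := rfl

@[simp] theorem endpt_cons (x : V) (e : ι × V) (p : List (ι × V)) :
    endpt x (e :: p) = endpt e.2 p := rfl

theorem endpt_append (x : V) (p q : List (ι × V)) :
    endpt x (p ++ q) = endpt (endpt x p) q := by
  induction p generalizing x with
  | nil => rfl
  | cons e p ih => exact ih e.2

theorem isPath_append {x : V} {p q : List (ι × V)} :
    IsPath step x (p ++ q) ↔ IsPath step x p ∧ IsPath step (endpt x p) q := by
  induction p generalizing x with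
  | nil => simp [IsPath]
  | cons e p ih => simp [IsPath, ih, and_assoc]

theorem endpt_take_succ (x : V) (p : List (ι × V)) {i : ℕ} (hi : i < p.length) :
    endpt x (p.take (i + 1)) = p[i].2 := by
  rw [List.take_add_one, List.getElem?_eq_getElem hi, endpt_append]
  rfl

theorem isPath_iff {x : V} {p : List (ι × V)} :
    IsPath step x p ↔ ∀ i (hi : i < p.length), step (endpt x (p.take i)) p[i].1 p[i].2 := by
  induction p generalizing x with
  | nil => simp [IsPath]
  | cons e p ih =>
    simp only [IsPath, ih]
    constructor
    · rintro ⟨h1, h2⟩ i hi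
      cases i with
      | zero => simpa using h1
      | succ i => simpa using h2 i (by simpa using hi)
    · intro h
      exact ⟨h 0 (by simp), fun i hi => h (i + 1) (by simpa using hi)⟩

/-- There is a path from `x` to `y`. -/
def Reach (step : V → ι → V → Prop) (x y : V) : Prop := ∃ p, IsPath step x p ∧ endpt x p = y

theorem Reach.refl (x : V) : Reach step x x := ⟨[], trivial, rfl⟩

theorem Reach.trans {x y z : V} (h1 : Reach step x y) (h2 : Reach step y z) : Reach step x z := by
  obtain ⟨p, hp, rfl⟩ := h1
  obtain ⟨q, hq, rfl⟩ := h2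
  exact ⟨p ++ q, isPath_append.2 ⟨hp, hq⟩, endpt_append _ _ _⟩

theorem Reach.single {x y : V} {l : ι} (h : step x l y) : Reach step x y :=
  ⟨[(l, y)], ⟨h, trivial⟩, rfl⟩

theorem rank_endpt {r : V → ℕ} (hr : ∀ x l y, step x l y → r y = r x + 1) {x : V}
    {p : List (ι × V)} (hp : IsPath step x p) : r (endpt x p) = r x + p.length := by
  induction p generalizing x with
  | nil => rfl
  | cons e p ih =>
    rw [endpt_cons, ih hp.2, hr _ _ _ hp.1, List.length_cons]
    omega

/-- The labeled poset `P` is the set of the vertices on the paths from `x` to `y`, ordered by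
reachability and with the labels `φ l` of the steps; `r` is a rank function. -/
structure IsPathInterval (P : LabeledPoset.{u}) (step : V → ι → V → Prop) (φ : ι → ℤ)
    (val : P.carrier → V) (r : V → ℕ) (x y : V) : Prop where
  inj : Function.Injective val
  mem_range : ∀ v, v ∈ Set.range val ↔ Reach step x v ∧ Reach step v y
  le_iff : ∀ p q, p ≤ q ↔ Reach step (val p) (val q)
  rank_step : ∀ v l w, step v l w → r w = r v + 1
  label_eq : ∀ {p q} (h : p ⋖ q) {l}, step (val p) l (val q) → P.label h = φ l
  reach : Reach step x y

namespace IsPathInterval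

variable {P : LabeledPoset.{u}} {φ : ι → ℤ} {val : P.carrier → V} {r : V → ℕ} {x y : V}

theorem rank_lt (I : IsPathInterval P step φ val r x y) {p q : P.carrier} (h : p < q) :
    r (val p) < r (val q) := by
  obtain ⟨c, hc, hc'⟩ := (I.le_iff p q).1 h.le
  have h1 := rank_endpt I.rank_step hc
  rw [hc'] at h1
  cases c with
  | nil => exact absurd (I.inj hc') h.ne
  | cons e c => rw [List.length_cons] at h1; omega

/-- The covers are exactly the steps: if `q` covers `p`, then the first step of a path from `p` to
`q` leads to `q` already; conversely, a step raises the rank by one, which leaves nothing in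
between. -/
theorem covBy_iff (I : IsPathInterval P step φ val r x y) {p q : P.carrier} :
    p ⋖ q ↔ ∃ l, step (val p) l (val q) := by
  constructor
  · intro h
    obtain ⟨c, hc, hc'⟩ := (I.le_iff p q).1 h.le
    cases c with
    | nil => exact absurd (I.inj hc') h.lt.ne
    | cons e c =>
      have hz : Reach step e.2 (val q) := ⟨c, hc.2, hc'⟩
      obtain ⟨z, hz'⟩ := (I.mem_range e.2).2 ⟨((I.mem_range _).1 ⟨p, rfl⟩).1.trans
        (Reach.single hc.1), hz.trans ((I.mem_range _).1 ⟨q, rfl⟩).2⟩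
      have hpz : p ≤ z := (I.le_iff _ _).2 (hz' ▸ Reach.single hc.1)
      have hzq : z ≤ q := (I.le_iff _ _).2 (hz' ▸ hz)
      have hne : p ≠ z := by
        rintro rfl
        have := I.rank_step _ _ _ hc.1
        rw [← hz'] at this
        omega
      have : z = q := by
        by_contra hcon
        exact h.2 (lt_of_le_of_ne hpz hne) (lt_of_le_of_ne hzq hcon)
      exact ⟨e.1, by rw [← this, hz']; exact hc.1⟩
  · rintro ⟨l, hl⟩
    have hr := I.rank_step _ _ _ hl
    refine ⟨lt_of_le_of_ne ((I.le_iff _ _).2 (Reach.single hl)) ?_, ?_⟩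
    · rintro rfl; omega
    · intro c h1 h2
      have := I.rank_lt h1
      have := I.rank_lt h2
      omega

theorem isMin_iff (I : IsPathInterval P step φ val r x y) {p : P.carrier} :
    IsMin p ↔ val p = x := by
  obtain ⟨b, hb⟩ := (I.mem_range x).2 ⟨Reach.refl x, I.reach⟩
  have hbot : ∀ q, b ≤ q := fun q => (I.le_iff _ _).2 (hb ▸ ((I.mem_range _).1 ⟨q, rfl⟩).1)
  constructor
  · intro h
    rw [← hb, le_antisymm (h (hbot p)) (hbot p)]
  · intro h q _
    rw [I.inj (h.trans hb.symm)]
    exact hbot q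

theorem isMax_iff (I : IsPathInterval P step φ val r x y) {p : P.carrier} :
    IsMax p ↔ val p = y := by
  obtain ⟨b, hb⟩ := (I.mem_range y).2 ⟨I.reach, Reach.refl y⟩
  have htop : ∀ q, q ≤ b := fun q => (I.le_iff _ _).2 (hb ▸ ((I.mem_range _).1 ⟨q, rfl⟩).2)
  constructor
  · intro h
    rw [← hb, le_antisymm (htop p) (h (htop p))]
  · intro h q _
    rw [I.inj (h.trans hb.symm)]
    exact htop q

/-- The path of a maximal chain. -/
def toPath (I : IsPathInterval P step φ val r x y) (c : P.MaxChain) : List (ι × V) :=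
  List.ofFn fun i : Fin c.1.length => ((I.covBy_iff.1 (c.1.step i)).choose, val (c.1 i.succ))

theorem length_toPath (I : IsPathInterval P step φ val r x y) (c : P.MaxChain) :
    (I.toPath c).length = c.1.length := by simp [toPath]

theorem endpt_toPath_take (I : IsPathInterval P step φ val r x y) (c : P.MaxChain) (i : ℕ)
    (hi : i < c.1.length + 1) : endpt x ((I.toPath c).take i) = val (c.1 ⟨i, hi⟩) := by
  cases i with
  | zero => exact (I.isMin_iff.1 c.2.1).symm
  | succ i =>
    rw [endpt_take_succ _ _ (by rw [I.length_toPath]; omega)]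
    simp [toPath]

theorem isPath_toPath (I : IsPathInterval P step φ val r x y) (c : P.MaxChain) :
    IsPath step x (I.toPath c) ∧ endpt x (I.toPath c) = y := by
  constructor
  · rw [isPath_iff]
    intro i hi
    have hi' := hi
    rw [I.length_toPath] at hi'
    rw [I.endpt_toPath_take c i (by omega)]
    simpa [toPath] using (I.covBy_iff.1 (c.1.step ⟨i, hi'⟩)).choose_spec
  · have h := I.endpt_toPath_take c c.1.length (by omega)
    rw [List.take_of_length_le (I.length_toPath c).le] at h
    rw [h]
    exact I.isMax_iff.1 c.2.2

theorem word_eq (I : IsPathInterval P step φ val r x y) (c : P.MaxChain) :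
    c.word = ((I.toPath c).map Prod.fst).map φ := by
  rw [toPath, List.map_ofFn, List.map_ofFn, LabeledPoset.MaxChain.word]
  congr 1
  funext i
  exact I.label_eq _ (I.covBy_iff.1 (c.1.step i)).choose_spec

theorem toPath_injective (I : IsPathInterval P step φ val r x y) :
    Function.Injective I.toPath := by
  intro c d h
  have hl : c.1.length = d.1.length := by rw [← I.length_toPath, h, I.length_toPath]
  apply Subtype.ext
  apply RelSeries.ext hl
  funext i
  apply I.inj
  have h1 := I.endpt_toPath_take c i i.2
  have h2 := I.endpt_toPath_take d i (by rw [← hl]; exact i.2)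
  rw [h] at h1
  exact h1.symm.trans h2

/-- Every path from `x` to `y` comes from a maximal chain: all its vertices lie in the interval, and
its steps are covers. -/
theorem exists_toPath (I : IsPathInterval P step φ val r x y) (hφ : Function.Injective φ)
    {p : List (ι × V)} (hp : IsPath step x p) (hy : endpt x p = y) : ∃ c, I.toPath c = p := by
  have hmem : ∀ i : ℕ, ∃ q, val q = endpt x (p.take i) := by
    intro i
    have h1 := hp
    have h2 := hy
    rw [← List.take_append_drop i p] at h1 h2
    rw [isPath_append] at h1
    rw [endpt_append] at h2
    exact (I.mem_range _).2 ⟨⟨_, h1.1, rfl⟩, ⟨_, h1.2, h2⟩⟩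
  choose f hf using hmem
  have hst : ∀ i (hi : i < p.length), step (val (f i)) p[i].1 (val (f (i + 1))) := by
    intro i hi
    rw [hf, hf, endpt_take_succ _ _ hi]
    exact isPath_iff.1 hp i hi
  let c : P.MaxChain := ⟨⟨p.length, fun i => f i, fun i => I.covBy_iff.2 ⟨_, hst i i.2⟩⟩,
    I.isMin_iff.2 (by
      change val (f 0) = x
      rw [hf]; rfl), I.isMax_iff.2 (by
      change val (f p.length) = y
      rw [hf, List.take_length, hy])⟩
  refine ⟨c, List.ext_getElem (I.length_toPath c) ?_⟩
  intro i h1 h2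
  have hcov := (I.covBy_iff.1 (c.1.step ⟨i, h2⟩))
  have e1 : (I.toPath c)[i] = (hcov.choose, val (f (i + 1))) := by
    simp only [toPath, List.getElem_ofFn]
    rfl
  rw [e1]
  refine Prod.ext (hφ ?_) ((hf _).trans (endpt_take_succ _ _ h2))
  exact (I.label_eq (c.1.step ⟨i, h2⟩) hcov.choose_spec).symm.trans
    (I.label_eq (c.1.step ⟨i, h2⟩) (hst i h2))

/-- The chains counted by `H_α` are the paths whose word splits into blocks of sizes `α`. -/
theorem ncard_H [LinearOrder ι] (I : IsPathInterval P step φ val r x y) (hφ : StrictMono φ)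
    (α : List ℕ) : (P.H α).ncard =
      {p | IsPath step x p ∧ endpt x p = y ∧ BlockSorted α (p.map Prod.fst)}.ncard := by
  rw [← Set.ncard_image_of_injective _ I.toPath_injective]
  congr 1
  ext p
  simp only [Set.mem_image, Set.mem_ofPred_eq]
  constructor
  · rintro ⟨c, hc, rfl⟩
    refine ⟨(I.isPath_toPath c).1, (I.isPath_toPath c).2, ?_⟩
    rw [← blockSorted_map hφ, blockSorted_iff, ← I.word_eq]
    exact hc
  · rintro ⟨h1, h2, h3⟩
    obtain ⟨c, rfl⟩ := I.exists_toPath hφ.injective h1 h2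
    refine ⟨c, ?_, rfl⟩
    rw [← blockSorted_map hφ, blockSorted_iff, ← I.word_eq] at h3
    exact h3

theorem length_eq (I : IsPathInterval P step φ val r x y) (c : P.MaxChain) :
    c.1.length = r y - r x := by
  have h := rank_endpt I.rank_step (I.isPath_toPath c).1
  rw [(I.isPath_toPath c).2, I.length_toPath] at h
  omega

theorem isRanked (I : IsPathInterval P step φ val r x y) : P.IsRanked := by
  intro c
  have : Set.range (fun c : P.MaxChain => c.1.length) = {c.1.length} := by
    ext n
    simp only [Set.mem_range, Set.mem_singleton_iff]
    exact ⟨fun ⟨d, hd⟩ => by rw [← hd, I.length_eq d, I.length_eq c], fun h => ⟨c, h.symm⟩⟩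
  rw [LabeledPoset.rank, this, csSup_singleton]

end IsPathInterval

end Paths

/-! ### Operators that count paths -/

section PathOperators

variable {V ι : Type*} {step : V → ι → V → Prop}

/-- The composition of the operators `A α_1`, `A α_2`, …, applied in this order. -/
def blockOp {R : Type*} [Monoid R] (A : ℕ → R) : List ℕ → R
  | [] => 1
  | n :: α => blockOp A α * A n

theorem blockOp_perm {R : Type*} [Monoid R] {A : ℕ → R} (hA : ∀ m n, A m * A n = A n * A m)
    {α β : List ℕ} (h : α.Perm β) : blockOp A α = blockOp A β := by
  induction h with
  | nil => rfl
  | cons n _ ih => simp only [blockOp, ih]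
  | swap m n α => simp only [blockOp, mul_assoc, hA]
  | trans _ _ ih1 ih2 => exact ih1.trans ih2

/-- `A` maps the vertex `x` to the formal sum of the end points of the paths from `x` that satisfy
`C`, which are finite in number. -/
def CountsPaths (step : V → ι → V → Prop) (C : List (ι × V) → Prop)
    (A : Module.End ℤ (V →₀ ℤ)) : Prop :=
  ∀ x, ∃ s : Finset (List (ι × V)), (∀ p, p ∈ s ↔ IsPath step x p ∧ C p) ∧
    A (Finsupp.single x 1) = ∑ p ∈ s, Finsupp.single (endpt x p) 1

theorem CountsPaths.apply_eq {C : List (ι × V) → Prop} {A : Module.End ℤ (V →₀ ℤ)}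
    (hA : CountsPaths step C A) (x y : V) :
    A (Finsupp.single x 1) y = ({p | IsPath step x p ∧ endpt x p = y ∧ C p}.ncard : ℤ) := by
  obtain ⟨s, hs, hA⟩ := hA x
  have : {p | IsPath step x p ∧ endpt x p = y ∧ C p} =
      ((s.filter fun p => endpt x p = y : Finset _) : Set (List (ι × V))) := by
    ext p
    simp only [Set.mem_ofPred_eq, Finset.coe_filter, hs]
    tauto
  rw [hA, this, Set.ncard_coe_finset, Finsupp.finsetSum_apply, Finset.card_filter]
  push_cast
  exact Finset.sum_congr rfl fun p _ => by simp [Finsupp.single_apply]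

/-- The product `(1 + U_{b_r} t) ⋯ (1 + U_{b_1} t)` for the list `b_1, …, b_r`. -/
def labelPoly {R : Type*} [Ring R] (U : ι → R) : List ι → Polynomial R
  | [] => 1
  | b :: L => labelPoly U L * (1 + Polynomial.C (U b) * Polynomial.X)

theorem labelPoly_coeff_zero {R : Type*} [Ring R] (U : ι → R) (L : List ι) :
    (labelPoly U L).coeff 0 = 1 := by
  induction L with
  | nil => simp [labelPoly]
  | cons b L ih => simp [labelPoly, mul_add, ← mul_assoc, ih]

theorem labelPoly_cons_coeff_succ {R : Type*} [Ring R] (U : ι → R) (b : ι) (L : List ι) (n : ℕ) :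
    (labelPoly U (b :: L)).coeff (n + 1) =
      (labelPoly U L).coeff (n + 1) + (labelPoly U L).coeff n * U b := by
  simp [labelPoly, mul_add, ← mul_assoc]

variable [LinearOrder ι]

/-- If `A n` counts the paths of length `n` with weakly increasing labels, then `blockOp A α`
counts the paths whose word splits into blocks of sizes `α`. -/
theorem countsPaths_blockOp {A : ℕ → Module.End ℤ (V →₀ ℤ)} {B : Set ι}
    (hA : ∀ n, CountsPaths step
      (fun p => p.length = n ∧ (p.map Prod.fst).Pairwise (· ≤ ·) ∧ ∀ e ∈ p, e.1 ∈ B) (A n))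
    (α : List ℕ) : CountsPaths step
      (fun p => BlockSorted α (p.map Prod.fst) ∧ ∀ e ∈ p, e.1 ∈ B) (blockOp A α) := by
  induction α with
  | nil =>
    intro x
    refine ⟨{[]}, fun p => ?_, by simp [blockOp]⟩
    simp only [Finset.mem_singleton, BlockSorted, List.map_eq_nil_iff]
    constructor
    · rintro rfl
      simp [IsPath]
    · exact fun h => h.2.1
  | cons n α ih =>
    intro x
    choose t ht1 ht2 using ih
    obtain ⟨s, hs1, hs2⟩ := hA n x
    refine ⟨s.biUnion fun p => (t (endpt x p)).image (p ++ ·), fun p => ?_, ?_⟩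
    · simp only [Finset.mem_biUnion, Finset.mem_image, hs1, ht1, BlockSorted]
      constructor
      · rintro ⟨p, ⟨h1, h2, h3, h4⟩, q, ⟨h5, h6, h7⟩, rfl⟩
        refine ⟨isPath_append.2 ⟨h1, h5⟩, ⟨by simp; omega, ?_, ?_⟩, ?_⟩
        · rw [← List.map_take, ← h2, List.take_left]; exact h3
        · rw [← List.map_drop, ← h2, List.drop_left]; exact h6
        · intro e he
          rcases List.mem_append.1 he with h | h
          exacts [h4 e h, h7 e h]
      · rintro ⟨h1, ⟨h2, h3, h4⟩, h5⟩
        rw [← List.take_append_drop n p, isPath_append] at h1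
        refine ⟨p.take n, ⟨h1.1, by simpa using h2, by rwa [List.map_take],
          fun e he => h5 e (List.mem_of_mem_take he)⟩, p.drop n,
          ⟨h1.2, by rwa [List.map_drop], fun e he => h5 e (List.mem_of_mem_drop he)⟩,
          List.take_append_drop n p⟩
    · rw [Finset.sum_biUnion, blockOp, Module.End.mul_apply, hs2, map_sum]
      · refine Finset.sum_congr rfl fun p _ => ?_
        rw [ht2, Finset.sum_image fun _ _ _ _ h => List.append_cancel_left h]
        exact Finset.sum_congr rfl fun q _ => by rw [endpt_append]
      · intro p hp q hq hpq
        rw [Function.onFun, Finset.disjoint_left]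
        intro c hc1 hc2
        obtain ⟨c1, -, rfl⟩ := Finset.mem_image.1 hc1
        obtain ⟨c2, -, h⟩ := Finset.mem_image.1 hc2
        refine hpq (List.append_inj_left h.symm ?_)
        rw [((hs1 p).1 hp).2.1, ((hs1 q).1 hq).2.1]

/-- If `U b` counts the steps with label `b`, then the coefficients of `labelPoly U L` count the
paths whose word is a subsequence of `L`. -/
theorem countsPaths_labelPoly {U : ι → Module.End ℤ (V →₀ ℤ)} {out : ι → V → Finset V}
    (hout : ∀ b x z, z ∈ out b x ↔ step x b z)
    (hU : ∀ b x, U b (Finsupp.single x 1) = ∑ z ∈ out b x, Finsupp.single z 1)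
    (L : List ι) (hL : L.Nodup) (n : ℕ) : CountsPaths step
      (fun p => p.length = n ∧ (p.map Prod.fst).Sublist L) ((labelPoly U L).coeff n) := by
  induction L generalizing n with
  | nil =>
    intro x
    cases n with
    | zero =>
      refine ⟨{[]}, fun p => ?_, by simp [labelPoly]⟩
      simp only [Finset.mem_singleton, List.length_eq_zero_iff]
      exact ⟨by rintro rfl; simp [IsPath], fun h => h.2.1⟩
    | succ n =>
      refine ⟨∅, fun p => ?_, by simp [labelPoly, Polynomial.coeff_one]⟩
      simp only [Finset.notMem_empty, false_iff, List.sublist_nil, List.map_eq_nil_iff]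
      rintro ⟨-, h, rfl⟩
      simp at h
  | cons b L ih =>
    intro x
    have hb : b ∉ L := (List.nodup_cons.1 hL).1
    have ih := ih (List.nodup_cons.1 hL).2
    obtain ⟨s, hs1, hs2⟩ := ih n x
    cases n with
    | zero =>
      refine ⟨s, fun p => ?_, by rw [labelPoly_coeff_zero, ← hs2, labelPoly_coeff_zero]⟩
      rw [hs1]
      beta_reduce
      rw [List.length_eq_zero_iff]
      constructor <;> · rintro ⟨-, rfl, -⟩; simp [IsPath]
    | succ n =>
      choose t ht1 ht2 using ih n
      have hdisj : Disjoint s ((out b x).biUnion fun z => (t z).image ((b, z) :: ·)) := by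
        rw [Finset.disjoint_left]
        intro p hp hp'
        obtain ⟨z, -, hz⟩ := Finset.mem_biUnion.1 hp'
        obtain ⟨q, -, rfl⟩ := Finset.mem_image.1 hz
        exact hb (((hs1 _).1 hp).2.2.subset (by simp))
      refine ⟨s.disjUnion _ hdisj, fun p => ?_, ?_⟩
      · simp only [Finset.disjUnion_eq_union, Finset.mem_union, Finset.mem_biUnion, hs1, ht1,
          hout, Finset.mem_image]
        constructor
        · rintro (⟨h1, h2, h3⟩ | ⟨z, hz, q, ⟨h1, h2, h3⟩, rfl⟩)
          · exact ⟨h1, h2, h3.cons _⟩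
          · exact ⟨⟨hz, h1⟩, by simp [h2], by simpa using h3⟩
        · rintro ⟨h1, h2, h3⟩
          cases p with
          | nil => simp at h2
          | cons e q =>
            rw [List.map_cons] at h3
            cases h3 with
            | cons _ h => exact Or.inl ⟨h1, h2, h⟩
            | cons_cons _ h =>
              exact Or.inr ⟨e.2, h1.1, q, ⟨h1.2, by simpa using h2, h⟩, rfl⟩
      · rw [Finset.sum_disjUnion, labelPoly_cons_coeff_succ, LinearMap.add_apply, hs2,
          Module.End.mul_apply, hU, map_sum, Finset.sum_biUnion]
        · congr 1
          refine Finset.sum_congr rfl fun z _ => ?_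
          rw [ht2, Finset.sum_image fun _ _ _ _ h => (List.cons.inj h).2]
          rfl
        · intro z _ z' _ hzz
          rw [Function.onFun, Finset.disjoint_left]
          intro c hc1 hc2
          obtain ⟨c1, -, rfl⟩ := Finset.mem_image.1 hc1
          obtain ⟨c2, -, h⟩ := Finset.mem_image.1 hc2
          exact hzz (congrArg Prod.snd (List.cons.inj h).1).symm

/-- If no label is repeated in two consecutive steps, then the paths with weakly increasing labels
in the strictly increasing list `L` are those whose word is a subsequence of `L`. -/
theorem sublist_iff_of_isPath (hstep : ∀ x b z w, step x b z → ¬ step z b w) {L : List ι}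
    (hL : L.Pairwise (· < ·)) {x : V} {p : List (ι × V)} (hp : IsPath step x p) :
    (p.map Prod.fst).Sublist L ↔
      (p.map Prod.fst).Pairwise (· ≤ ·) ∧ ∀ e ∈ p, e.1 ∈ {b | b ∈ L} := by
  constructor
  · intro h
    refine ⟨(hL.sublist h).imp le_of_lt, fun e he => h.subset (List.mem_map_of_mem he)⟩
  · rintro ⟨h1, h2⟩
    suffices h3 : (p.map Prod.fst).Pairwise (· < ·) from List.sublist_of_subperm_of_pairwise
      (List.subperm_of_subset (h3.imp ne_of_lt) (by
        intro b hb
        obtain ⟨e, he, rfl⟩ := List.mem_map.1 hb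
        exact h2 e he)) h3 hL
    rw [← List.isChain_iff_pairwise] at h1 ⊢
    rw [List.isChain_iff_getElem] at h1 ⊢
    intro i hi
    refine lt_of_le_of_ne (h1 i hi) ?_
    simp only [List.length_map] at hi
    simp only [List.getElem_map]
    intro heq
    rw [isPath_iff] at hp
    have a1 := hp i (by omega)
    have a2 := hp (i + 1) hi
    rw [endpt_take_succ _ _ (by omega), ← heq] at a2
    exact hstep _ _ _ _ a1 a2

theorem countsPaths_coeff {U : ι → Module.End ℤ (V →₀ ℤ)} {out : ι → V → Finset V}
    (hout : ∀ b x z, z ∈ out b x ↔ step x b z)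
    (hU : ∀ b x, U b (Finsupp.single x 1) = ∑ z ∈ out b x, Finsupp.single z 1)
    (hstep : ∀ x b z w, step x b z → ¬ step z b w)
    {L : List ι} (hL : L.Pairwise (· < ·)) (n : ℕ) : CountsPaths step
      (fun p => p.length = n ∧ (p.map Prod.fst).Pairwise (· ≤ ·) ∧ ∀ e ∈ p, e.1 ∈ {b | b ∈ L})
      ((labelPoly U L).coeff n) := by
  intro x
  obtain ⟨s, hs1, hs2⟩ := countsPaths_labelPoly hout hU L (hL.imp ne_of_lt) n x
  refine ⟨s, fun p => ?_, hs2⟩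
  rw [hs1]
  constructor
  · rintro ⟨h1, h2, h3⟩
    exact ⟨h1, h2, (sublist_iff_of_isPath hstep hL h1).1 h3⟩
  · rintro ⟨h1, h2, h3⟩
    exact ⟨h1, h2, (sublist_iff_of_isPath hstep hL h1).2 h3⟩

/-- The number of the chains in `H_α` is a matrix coefficient of `blockOp A α`. -/
theorem IsPathInterval.ncard_H_eq {P : LabeledPoset.{u}} {φ : ι → ℤ} {val : P.carrier → V}
    {r : V → ℕ} {x y : V} (I : IsPathInterval P step φ val r x y) (hφ : StrictMono φ)
    {A : ℕ → Module.End ℤ (V →₀ ℤ)} {B : Set ι}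
    (hA : ∀ n, CountsPaths step
      (fun p => p.length = n ∧ (p.map Prod.fst).Pairwise (· ≤ ·) ∧ ∀ e ∈ p, e.1 ∈ B) (A n))
    (hB : ∀ p, IsPath step x p → endpt x p = y → ∀ e ∈ p, e.1 ∈ B) (α : List ℕ) :
    ((P.H α).ncard : ℤ) = blockOp A α (Finsupp.single x 1) y := by
  rw [(countsPaths_blockOp hA α).apply_eq, I.ncard_H hφ]
  congr 2
  ext p
  simp only [Set.mem_ofPred_eq]
  exact ⟨fun h => ⟨h.1, h.2.1, h.2.2, hB p h.1 h.2.1⟩, fun h => ⟨h.1, h.2.1, h.2.2.1⟩⟩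

end PathOperators

/-! ### Horizontal strips -/

section Strips

theorem le_iff_rowLen_le {μ ν : YoungDiagram} : μ ≤ ν ↔ ∀ i, μ.rowLen i ≤ ν.rowLen i := by
  constructor
  · intro h i
    by_contra hcon
    have h1 : (i, ν.rowLen i) ∈ μ := YoungDiagram.mem_iff_lt_rowLen.2 (not_le.1 hcon)
    exact lt_irrefl _ (YoungDiagram.mem_iff_lt_rowLen.1 (h h1))
  · rintro h ⟨i, j⟩ hij
    exact YoungDiagram.mem_iff_lt_rowLen.2
      ((YoungDiagram.mem_iff_lt_rowLen.1 hij).trans_le (h i))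

theorem ext_rowLen {μ ν : YoungDiagram} (h : ∀ i, μ.rowLen i = ν.rowLen i) : μ = ν :=
  le_antisymm (le_iff_rowLen_le.2 fun i => (h i).le) (le_iff_rowLen_le.2 fun i => (h i).ge)

theorem rowLen_eq_zero {μ : YoungDiagram} {i : ℕ} (h : μ.colLen 0 ≤ i) : μ.rowLen i = 0 := by
  by_contra hcon
  have h1 : (i, 0) ∈ μ := YoungDiagram.mem_iff_lt_rowLen.2 (Nat.pos_of_ne_zero hcon)
  have := YoungDiagram.mem_iff_lt_colLen.1 h1
  omega

theorem card_eq_sum_rowLen {μ : YoungDiagram} {N : ℕ} (h : μ.rowLen N = 0) :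
    μ.card = ∑ i ∈ Finset.range N, μ.rowLen i := by
  have hmem : ∀ c ∈ μ.cells, c.1 ∈ Finset.range N := by
    rintro ⟨i, j⟩ hc
    rw [Finset.mem_range]
    by_contra hcon
    have h1 := YoungDiagram.mem_iff_lt_rowLen.1 ((YoungDiagram.mem_cells _).1 hc)
    have h2 := μ.rowLen_anti N i (not_lt.1 hcon)
    omega
  rw [YoungDiagram.card, Finset.card_eq_sum_card_fiberwise hmem]
  exact Finset.sum_congr rfl fun i _ => (YoungDiagram.rowLen_eq_card μ).symm

/-- The Young diagram with the row lengths `f 0 ≥ f 1 ≥ ⋯`, where `f N = 0`. -/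
def ofRows (f : ℕ → ℕ) (hf : Antitone f) (N : ℕ) (_hN : f N = 0) : YoungDiagram where
  cells := (Finset.range N ×ˢ Finset.range (f 0)).filter fun c => c.2 < f c.1
  isLowerSet := by
    rintro ⟨i, j⟩ ⟨i', j'⟩ ⟨hi, hj⟩ h
    simp only [Finset.coe_filter, Finset.mem_product, Finset.mem_range, Set.mem_ofPred_eq] at *
    have := hf hi
    omega

theorem rowLen_ofRows {f : ℕ → ℕ} (hf : Antitone f) {N : ℕ} (hN : f N = 0) (i : ℕ) :
    (ofRows f hf N hN).rowLen i = f i := by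
  have key : ∀ j, j < (ofRows f hf N hN).rowLen i ↔ j < f i := by
    intro j
    rw [← YoungDiagram.mem_iff_lt_rowLen, ← YoungDiagram.mem_cells]
    simp only [ofRows, Finset.mem_filter, Finset.mem_product, Finset.mem_range]
    have h0 := hf (Nat.zero_le i)
    refine ⟨fun h => h.2, fun h => ⟨⟨?_, by omega⟩, h⟩⟩
    by_contra hcon
    have := hf (not_lt.1 hcon)
    omega
  exact eq_of_forall_lt_iff key

/-- `lam/ν` is a horizontal strip. -/
def IsStrip (ν lam : YoungDiagram) : Prop :=
  ∀ i, ν.rowLen i ≤ lam.rowLen i ∧ lam.rowLen (i + 1) ≤ ν.rowLen i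

theorem isStrip_iff {ν lam : YoungDiagram} :
    IsStrip ν lam ↔ ν ≤ lam ∧ ∀ i j, (i + 1, j) ∈ lam → (i, j) ∈ ν := by
  simp only [IsStrip, forall_and, le_iff_rowLen_le, YoungDiagram.mem_iff_lt_rowLen]
  refine and_congr Iff.rfl (forall_congr' fun i => ?_)
  exact ⟨fun h j hj => hj.trans_le h, fun h => le_of_forall_lt h⟩

theorem IsStrip.le {ν lam : YoungDiagram} (h : IsStrip ν lam) : ν ≤ lam := (isStrip_iff.1 h).1

theorem card_le_card {ν lam : YoungDiagram} (h : ν ≤ lam) : ν.card ≤ lam.card :=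
  Finset.card_le_card (YoungDiagram.cells_subset_iff.2 h)

theorem eq_of_le_of_card {ν lam : YoungDiagram} (h : ν ≤ lam) (hc : lam.card ≤ ν.card) :
    ν = lam :=
  YoungDiagram.ext (Finset.eq_of_subset_of_card_le (YoungDiagram.cells_subset_iff.2 h) hc)

@[simp] theorem mem_partitions {m : ℕ} {lam : YoungDiagram} :
    lam ∈ partitions m ↔ lam.card = m := by simp [partitions]

/-- The diagrams obtained from `ν` by adding a horizontal strip of size `n`. -/
def upStrips (n : ℕ) (ν : YoungDiagram) : Finset YoungDiagram :=
  (partitions (ν.card + n)).filter (IsStrip ν)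

/-- The diagrams obtained from `lam` by removing a horizontal strip of size `n`. -/
def downStrips (n : ℕ) (lam : YoungDiagram) : Finset YoungDiagram :=
  (partitions (lam.card - n)).filter fun ν => IsStrip ν lam ∧ n ≤ lam.card

theorem mem_upStrips {n : ℕ} {ν lam : YoungDiagram} :
    lam ∈ upStrips n ν ↔ IsStrip ν lam ∧ lam.card = ν.card + n := by
  simp [upStrips, and_comm]

theorem mem_downStrips {n : ℕ} {ν lam : YoungDiagram} :
    ν ∈ downStrips n lam ↔ IsStrip ν lam ∧ lam.card = ν.card + n := by
  simp only [downStrips, Finset.mem_filter, mem_partitions]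
  constructor
  · rintro ⟨h1, h2, h3⟩
    exact ⟨h2, by omega⟩
  · rintro ⟨h1, h2⟩
    exact ⟨by omega, h1, by omega⟩

/-- The operator that adds a horizontal strip of size `n` in all possible ways. -/
def upOp (n : ℕ) : Module.End ℤ (YoungDiagram →₀ ℤ) :=
  Finsupp.linearCombination ℤ fun ν => ∑ lam ∈ upStrips n ν, Finsupp.single lam 1

/-- The operator that removes a horizontal strip of size `n` in all possible ways. -/
def downOp (n : ℕ) : Module.End ℤ (YoungDiagram →₀ ℤ) :=
  Finsupp.linearCombination ℤ fun lam => ∑ ν ∈ downStrips n lam, Finsupp.single ν 1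

theorem upOp_single (n : ℕ) (ν : YoungDiagram) :
    upOp n (Finsupp.single ν 1) = ∑ lam ∈ upStrips n ν, Finsupp.single lam 1 := by
  simp [upOp]

theorem downOp_single (n : ℕ) (lam : YoungDiagram) :
    downOp n (Finsupp.single lam 1) = ∑ ν ∈ downStrips n lam, Finsupp.single ν 1 := by
  simp [downOp]

theorem upOp_single_apply (n : ℕ) (ν lam : YoungDiagram) : upOp n (Finsupp.single ν 1) lam =
    if IsStrip ν lam ∧ lam.card = ν.card + n then 1 else 0 := by
  rw [upOp_single, Finsupp.finsetSum_apply]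
  simp [Finsupp.single_apply, mem_upStrips]

theorem downOp_single_apply (n : ℕ) (ν lam : YoungDiagram) : downOp n (Finsupp.single lam 1) ν =
    if IsStrip ν lam ∧ lam.card = ν.card + n then 1 else 0 := by
  rw [downOp_single, Finsupp.finsetSum_apply]
  simp [Finsupp.single_apply, mem_downStrips]

theorem blockOp_append {R : Type*} [Monoid R] (A : ℕ → R) (α β : List ℕ) :
    blockOp A (α ++ β) = blockOp A β * blockOp A α := by
  induction α with
  | nil => simp [blockOp]
  | cons n α ih => simp [blockOp, ih, mul_assoc]

theorem end_apply_eq_sum {V : Type*} (F : Module.End ℤ (V →₀ ℤ)) (f : V →₀ ℤ) (y : V) :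
    F f y = f.sum fun x a => a * F (Finsupp.single x 1) y := by
  conv_lhs => rw [← f.sum_single]
  rw [map_finsuppSum, Finsupp.sum_apply]
  refine Finsupp.sum_congr fun x _ => ?_
  rw [← mul_one (f x), ← smul_eq_mul, ← Finsupp.smul_single, map_smul]
  simp

/-- The composition of the `upOp` is adjoint to the reversed composition of the `downOp`. -/
theorem blockOp_upOp_eq_downOp (α : List ℕ) (μ lam : YoungDiagram) :
    blockOp upOp α (Finsupp.single μ 1) lam =
      blockOp downOp α.reverse (Finsupp.single lam 1) μ := by
  induction α generalizing μ with
  | nil => simp [blockOp, Finsupp.single_apply, eq_comm]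
  | cons n α ih =>
    rw [List.reverse_cons, blockOp_append]
    simp only [blockOp, one_mul, Module.End.mul_apply]
    rw [upOp_single, map_sum, Finsupp.finsetSum_apply, Finset.sum_congr rfl fun ν _ => ih ν,
      end_apply_eq_sum (downOp n)]
    simp only [downOp_single_apply]
    generalize blockOp downOp α.reverse (Finsupp.single lam 1) = g
    rw [Finsupp.sum]
    simp only [mul_ite, mul_one, mul_zero]
    rw [← Finset.sum_filter]
    refine Finset.sum_subset_zero_on_sdiff ?_ ?_ ?_ |>.symm
    · intro ν hν
      exact mem_upStrips.2 (Finset.mem_filter.1 hν).2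
    · intro ν hν
      simp only [Finset.mem_sdiff, mem_upStrips, Finset.mem_filter, Finsupp.mem_support_iff,
        not_and] at hν
      by_contra h
      exact hν.2 h hν.1.1 hν.1.2
    · intro _ _; rfl

theorem le_of_blockOp_downOp_ne_zero {α : List ℕ} {μ lam : YoungDiagram}
    (h : blockOp downOp α (Finsupp.single lam 1) μ ≠ 0) : μ ≤ lam := by
  induction α generalizing lam with
  | nil =>
    by_contra hcon
    refine h (Finsupp.single_eq_of_ne ?_)
    rintro rfl
    exact hcon le_rfl
  | cons n α ih =>
    simp only [blockOp, Module.End.mul_apply, downOp_single, map_sum,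
      Finsupp.finsetSum_apply] at h
    obtain ⟨ν, hν, hne⟩ := Finset.exists_ne_zero_of_sum_ne_zero h
    exact (ih hne).trans (mem_downStrips.1 hν).1.le

end Strips

/-! ### Semistandard tableaux as chains of horizontal strips -/

section Tableaux

/-- `t` describes a semistandard tableau of shape `lam/μ` with entries `1, …, N`, where `m + 1`
occurs `e m` times; `t` is `0` outside of the shape. -/
structure IsTab (lam μ : YoungDiagram) (e : ℕ → ℕ) (N : ℕ) (t : ℕ × ℕ → ℕ) : Prop where
  ne_zero : ∀ c, t c ≠ 0 ↔ c ∈ lam ∧ c ∉ μ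
  row : ∀ i j j', j < j' → t (i, j) ≠ 0 → t (i, j') ≠ 0 → t (i, j) ≤ t (i, j')
  col : ∀ i i' j, i < i' → t (i, j) ≠ 0 → t (i', j) ≠ 0 → t (i, j) < t (i', j)
  le : ∀ c, t c ≤ N
  content : ∀ m < N, {c | t c = m + 1}.ncard = e m

/-- The list `e (N - 1), …, e 0`. -/
def revContent (e : ℕ → ℕ) : ℕ → List ℕ
  | 0 => []
  | N + 1 => e N :: revContent e N

theorem finite_isTab (lam μ : YoungDiagram) (e : ℕ → ℕ) (N : ℕ) :
    {t | IsTab lam μ e N t}.Finite := by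
  have h1 : Finite (lam.cells → Fin (N + 1)) := inferInstance
  refine Set.Finite.of_injOn (f := fun t (c : lam.cells) => Fin.ofNat (N + 1) (t c))
    (t := Set.univ) (fun _ _ => Set.mem_univ _) ?_ Set.finite_univ
  intro t ht t' ht' h
  funext c
  by_cases hc : c ∈ lam
  · have := congrArg Fin.val (congrFun h ⟨c, (YoungDiagram.mem_cells _).2 hc⟩)
    have h1 := ht.le c
    have h2 := ht'.le c
    simpa [Nat.mod_eq_of_lt (Nat.lt_succ_of_le h1), Nat.mod_eq_of_lt (Nat.lt_succ_of_le h2)]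
      using this
  · have h1 : t c = 0 := by
      by_contra h
      exact hc ((ht.ne_zero c).1 h).1
    have h2 : t' c = 0 := by
      by_contra h
      exact hc ((ht'.ne_zero c).1 h).1
    rw [h1, h2]

/-- The entries different from `N + 1` of a tableau form a tableau. -/
def cutTab (N : ℕ) (t : ℕ × ℕ → ℕ) (c : ℕ × ℕ) : ℕ := if t c = N + 1 then 0 else t c

/-- Fill the cells of `lam/ν` with `N + 1`. -/
def extendTab (lam ν : YoungDiagram) (N : ℕ) (t : ℕ × ℕ → ℕ) (c : ℕ × ℕ) : ℕ :=
  if c ∈ lam ∧ c ∉ ν then N + 1 else t c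

/-- The shape of the entries at most `N` of a tableau. -/
theorem exists_cutShape {lam μ : YoungDiagram} {e : ℕ → ℕ} {N : ℕ}
    {t : ℕ × ℕ → ℕ} (ht : IsTab lam μ e (N + 1) t) :
    ∃ ν : YoungDiagram, ∀ c, c ∈ ν ↔ c ∈ lam ∧ t c ≠ N + 1 := by
  refine ⟨⟨lam.cells.filter fun c => t c ≠ N + 1, ?_⟩, ?_⟩
  · rintro ⟨i', j'⟩ ⟨i, j⟩ ⟨hi, hj⟩ h
    change i ≤ i' at hi
    change j ≤ j' at hj
    simp only [Finset.coe_filter, Set.mem_ofPred_eq, YoungDiagram.mem_cells] at h ⊢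
    have hm : (i, j) ∈ lam := lam.up_left_mem hi hj h.1
    refine ⟨hm, ?_⟩
    by_cases h0 : t (i, j) = 0
    · omega
    have hnμ := ((ht.ne_zero _).1 h0).2
    have h1 : t (i, j') ≠ 0 := (ht.ne_zero _).2 ⟨lam.up_left_mem hi le_rfl h.1,
      fun h => hnμ (μ.up_left_mem le_rfl hj h)⟩
    have h2 : t (i', j') ≠ 0 := (ht.ne_zero _).2 ⟨h.1, fun h => hnμ (μ.up_left_mem hi hj h)⟩
    have h3 : t (i, j) ≤ t (i, j') := by
      rcases hj.lt_or_eq with hj | rfl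
      exacts [ht.row _ _ _ hj h0 h1, le_rfl]
    have h4 : t (i, j') ≤ t (i', j') := by
      rcases hi.lt_or_eq with hi | rfl
      exacts [(ht.col _ _ _ hi h1 h2).le, le_rfl]
    have := ht.le (i', j')
    omega
  · intro c
    rw [← YoungDiagram.mem_cells]
    simp

/-- Without its entries `N + 1`, a tableau is a tableau of a smaller shape, and the removed cells
form a horizontal strip. This is inverted by `extendTab`. -/
theorem IsTab.cut {lam μ ν : YoungDiagram} (hμ : μ ≤ lam) {e : ℕ → ℕ} {N : ℕ}
    {t : ℕ × ℕ → ℕ} (ht : IsTab lam μ e (N + 1) t) (hν : ∀ c, c ∈ ν ↔ c ∈ lam ∧ t c ≠ N + 1) :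
    IsTab ν μ e N (cutTab N t) ∧ ν ∈ downStrips (e N) lam ∧ μ ≤ ν ∧
      extendTab lam ν N (cutTab N t) = t := by
  have h0 : ∀ c, cutTab N t c ≠ 0 → t c ≠ 0 ∧ cutTab N t c = t c := by
    intro c hc
    unfold cutTab at hc ⊢
    split_ifs at hc ⊢ <;> simp_all
  refine ⟨⟨fun c => ?_, fun i j j' hj h h' => ?_, fun i j j' hj h h' => ?_, fun c => ?_,
    fun m hm => ?_⟩, mem_downStrips.2 ⟨isStrip_iff.2 ⟨fun c hc => ((hν c).1 hc).1, ?_⟩, ?_⟩, ?_, ?_⟩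
  · rw [hν]
    have := ht.ne_zero c
    unfold cutTab
    split_ifs <;> tauto
  · rw [(h0 _ h).2, (h0 _ h').2]
    exact ht.row _ _ _ hj (h0 _ h).1 (h0 _ h').1
  · rw [(h0 _ h).2, (h0 _ h').2]
    exact ht.col _ _ _ hj (h0 _ h).1 (h0 _ h').1
  · have := ht.le c
    unfold cutTab
    split_ifs <;> omega
  · rw [← ht.content m (by omega)]
    congr 1
    ext c
    simp only [Set.mem_ofPred_eq, cutTab]
    split_ifs with h
    · exact ⟨fun h' => h'.elim, fun h' => by omega⟩
    · rfl
  · intro i j hij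
    have hm : (i, j) ∈ lam := lam.up_left_mem (Nat.le_succ i) le_rfl hij
    refine (hν _).2 ⟨hm, ?_⟩
    by_cases h0 : t (i, j) = 0
    · omega
    have h1 : t (i + 1, j) ≠ 0 := (ht.ne_zero _).2 ⟨hij, fun h =>
      ((ht.ne_zero _).1 h0).2 (μ.up_left_mem (Nat.le_succ i) le_rfl h)⟩
    have := ht.col i (i + 1) j (by omega) h0 h1
    have := ht.le (i + 1, j)
    omega
  · have hset : {c | t c = N + 1} = (lam.cells.filter fun c => t c = N + 1 : Finset _) := by
      ext c
      simp only [Set.mem_ofPred_eq, Finset.coe_filter, YoungDiagram.mem_cells]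
      exact ⟨fun h => ⟨((ht.ne_zero c).1 (by omega)).1, h⟩, fun h => h.2⟩
    have hν' : ν.cells = lam.cells.filter fun c => ¬ t c = N + 1 := by
      ext c
      rw [YoungDiagram.mem_cells, hν]
      simp
    rw [← ht.content N (by omega), hset, Set.ncard_coe_finset, YoungDiagram.card,
      YoungDiagram.card, hν', add_comm, Finset.card_filter_add_card_filter_not]
  · intro c hc
    refine (hν c).2 ⟨hμ hc, ?_⟩
    have : t c = 0 := by
      by_contra h
      exact ((ht.ne_zero c).1 h).2 hc
    omega
  · funext c
    have h1 := ht.ne_zero c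
    have h2 := hν c
    unfold extendTab cutTab
    by_cases h : t c = N + 1
    · rw [if_pos, h]
      have := h1.1 (by omega)
      tauto
    · rw [if_neg (by tauto), if_neg h]

/-- If the cells of a horizontal strip are filled with `N + 1`, a tableau with entries at most `N`
becomes a tableau of the larger shape. This is inverted by `cutTab`. -/
theorem IsTab.extend {lam μ ν : YoungDiagram} {e : ℕ → ℕ} {N : ℕ}
    {t : ℕ × ℕ → ℕ} (hμ : μ ≤ ν) (ht : IsTab ν μ e N t) (hν : ν ∈ downStrips (e N) lam) :
    IsTab lam μ e (N + 1) (extendTab lam ν N t) ∧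
      (∀ c, c ∈ ν ↔ c ∈ lam ∧ extendTab lam ν N t c ≠ N + 1) ∧
      cutTab N (extendTab lam ν N t) = t := by
  obtain ⟨hs, hcard⟩ := mem_downStrips.1 hν
  have hs' := isStrip_iff.1 hs
  have hle : ∀ c, t c ≠ N + 1 := fun c => by have := ht.le c; omega
  have hz : ∀ c, c ∉ ν → t c = 0 := fun c hc => by
    by_contra h
    exact hc ((ht.ne_zero c).1 h).1
  refine ⟨⟨fun c => ?_, fun i j j' hj h h' => ?_, fun i j j' hj h h' => ?_, fun c => ?_,
    fun m hm => ?_⟩, fun c => ?_, ?_⟩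
  · have := ht.ne_zero c
    have h1 : c ∈ ν → c ∈ lam := fun h => hs.le h
    have h2 : c ∈ μ → c ∈ ν := fun h => hμ h
    unfold extendTab
    split_ifs <;> simp <;> tauto
  · unfold extendTab at *
    split_ifs at * with h1 h2 h2
    · exact le_rfl
    · exfalso
      exact h1.2 (ν.up_left_mem le_rfl hj.le ((ht.ne_zero _).1 h').1)
    · have := ht.le (i, j); omega
    · exact ht.row _ _ _ hj h h'
  · unfold extendTab at *
    split_ifs at * with h1 h2 h2
    · exfalso
      exact h1.2 (hs'.2 _ _ (lam.up_left_mem hj le_rfl h2.1))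
    · exfalso
      exact h1.2 (ν.up_left_mem hj.le le_rfl ((ht.ne_zero _).1 h').1)
    · have := ht.le (i, j'); omega
    · exact ht.col _ _ _ hj h h'
  · have := ht.le c
    unfold extendTab
    split_ifs <;> omega
  · rcases Nat.lt_succ_iff_lt_or_eq.1 hm with hm | rfl
    · rw [← ht.content m hm]
      congr 1
      ext c
      simp only [Set.mem_ofPred_eq, extendTab]
      split_ifs with h
      · rw [hz c h.2]; omega
      · rfl
    · have hset : {c | extendTab lam ν m t c = m + 1} = (lam.cells \ ν.cells : Finset _) := by
        ext c
        simp only [Set.mem_ofPred_eq, extendTab, Finset.coe_sdiff, Set.mem_sdiff,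
          Finset.mem_coe, YoungDiagram.mem_cells]
        have := hle c
        split_ifs <;> tauto
      rw [hset, Set.ncard_coe_finset, Finset.card_sdiff_of_subset
        (YoungDiagram.cells_subset_iff.2 hs.le)]
      change lam.card - ν.card = e m
      omega
  · have := hle c
    have h1 : c ∈ ν → c ∈ lam := fun h => hs.le h
    unfold extendTab
    split_ifs <;> tauto
  · funext c
    have := hle c
    unfold cutTab extendTab
    split_ifs with h1
    · exact (hz c h1.2).symm
    · omega
    · rfl

/-- The cells with the entries `N`, `N - 1`, … of a tableau are horizontal strips that are removed
from the shape in turn, and they determine the tableau. -/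
theorem ncard_isTab {lam μ : YoungDiagram} (hμ : μ ≤ lam) (e : ℕ → ℕ) (N : ℕ) :
    ({t | IsTab lam μ e N t}.ncard : ℤ) =
      blockOp downOp (revContent e N) (Finsupp.single lam 1) μ := by
  induction N generalizing lam with
  | zero =>
    simp only [revContent, blockOp, Module.End.one_apply, Finsupp.single_apply]
    split_ifs with h
    · subst h
      have : {t | IsTab lam lam e 0 t} = {fun _ => 0} := by
        ext t
        simp only [Set.mem_ofPred_eq, Set.mem_singleton_iff]
        constructor
        · intro h
          funext c
          exact Nat.le_zero.1 (h.le c)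
        · rintro rfl
          exact ⟨by simp, by simp, by simp, by simp, by simp⟩
      rw [this, Set.ncard_singleton]
      rfl
    · have : {t | IsTab lam μ e 0 t} = ∅ := by
        ext t
        simp only [Set.mem_ofPred_eq, Set.mem_empty_iff_false, iff_false]
        intro ht
        refine h (le_antisymm (fun c hc => ?_) hμ)
        by_contra hcon
        exact (ht.ne_zero c).2 ⟨hc, hcon⟩ (Nat.le_zero.1 (ht.le c))
      rw [this, Set.ncard_empty]
      rfl
  | succ N ih =>
    have hset : {t | IsTab lam μ e (N + 1) t} =
        (((downStrips (e N) lam).filter (μ ≤ ·)).biUnion fun ν =>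
          (finite_isTab ν μ e N).toFinset.image (extendTab lam ν N) : Finset _) := by
      ext t
      simp only [Set.mem_ofPred_eq, Finset.coe_biUnion, Finset.coe_image, Set.mem_iUnion,
        Finset.mem_coe, Finset.mem_filter, Set.mem_image, Set.Finite.mem_toFinset, exists_prop]
      constructor
      · intro ht
        obtain ⟨ν, hν⟩ := exists_cutShape ht
        obtain ⟨h1, h2, h3, h4⟩ := ht.cut hμ hν
        exact ⟨ν, ⟨h2, h3⟩, _, h1, h4⟩
      · rintro ⟨ν, ⟨h1, h2⟩, t, ht, rfl⟩
        exact (ht.extend h2 h1).1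
    rw [hset, Set.ncard_coe_finset, Finset.card_biUnion]
    · rw [revContent, blockOp, Module.End.mul_apply, downOp_single, map_sum,
        Finsupp.finsetSum_apply, Nat.cast_sum, Finset.sum_filter]
      refine Finset.sum_congr rfl fun ν hν => ?_
      split_ifs with h
      · rw [Finset.card_image_of_injOn, ← ih h, Set.ncard_eq_toFinset_card _ (finite_isTab _ _ _ _)]
        intro t ht t' ht' heq
        rw [← (IsTab.extend h ((Set.Finite.mem_toFinset _).1 ht) hν).2.2, heq,
          (IsTab.extend h ((Set.Finite.mem_toFinset _).1 ht') hν).2.2]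
      · by_contra hcon
        exact h (le_of_blockOp_downOp_ne_zero (Ne.symm hcon))
    · intro ν hν ν' hν' hne
      rw [Finset.mem_coe, Finset.mem_filter] at hν hν'
      rw [Function.onFun, Finset.disjoint_left]
      intro t ht ht'
      obtain ⟨s, hs, rfl⟩ := Finset.mem_image.1 ht
      obtain ⟨s', hs', heq⟩ := Finset.mem_image.1 ht'
      have h1 := (IsTab.extend hν.2 ((Set.Finite.mem_toFinset _).1 hs) hν.1).2.1
      have h2 := (IsTab.extend hν'.2 ((Set.Finite.mem_toFinset _).1 hs') hν'.1).2.1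
      rw [heq] at h2
      apply hne
      ext c
      rw [YoungDiagram.mem_cells, YoungDiagram.mem_cells, h1, h2]

end Tableaux

/-! ### The coefficients of skew Schur functions -/

section SchurCoefficients

/-- The exponents of a monomial, the variables being counted from `0`. -/
def expo (d : ℕ+ →₀ ℕ) (m : ℕ) : ℕ := d m.succPNat

/-- The coefficients of a skew Schur function count chains of horizontal strips. -/
theorem coeff_skewSchur {lam μ : YoungDiagram} (hμ : μ ≤ lam) (d : ℕ+ →₀ ℕ) {N : ℕ}
    (hN : ∀ i : ℕ+, N < i → d i = 0) : MvPowerSeries.coeff d (skewSchur lam μ) =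
      blockOp downOp (revContent (expo d) N) (Finsupp.single lam 1) μ := by
  rw [← ncard_isTab hμ]
  change (({T : SkewCell lam μ → ℕ+ |
    IsSSYT T ∧ ∀ i, {c | T c = i}.ncard = d i}.ncard : ℕ) : ℤ) = _
  refine congrArg Nat.cast ?_
  have hfin : ∀ (T : SkewCell lam μ → ℕ+) (i : ℕ+), {c | T c = i}.Finite := by
    intro T i
    have : Finite (SkewCell lam μ) := by
      refine Finite.of_injective (fun c : SkewCell lam μ =>
        (⟨c.1, (YoungDiagram.mem_cells _).2 c.2.1⟩ : lam.cells)) ?_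
      intro c c' h
      exact Subtype.ext (congrArg (fun x => x.1) h)
    exact Set.toFinite _
  -- a tableau on the cells of `lam/μ` is extended by `0` to all cells
  refine Set.ncard_congr (fun (T : SkewCell lam μ → ℕ+) _ c =>
    if h : c ∈ lam ∧ c ∉ μ then (T ⟨c, h⟩ : ℕ) else 0) ?_ ?_ ?_
  · rintro T ⟨⟨hr, hc⟩, hd⟩
    refine ⟨fun c => ?_, fun i j j' hj h h' => ?_, fun i i' j hj h h' => ?_, fun c => ?_,
      fun m hm => ?_⟩
    · split_ifs with h <;> simp [h]
    · rw [Ne, dite_eq_right_iff, not_forall] at h h'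
      obtain ⟨h, -⟩ := h
      obtain ⟨h', -⟩ := h'
      rw [dif_pos h, dif_pos h']
      exact hr ⟨_, h⟩ ⟨_, h'⟩ rfl hj
    · rw [Ne, dite_eq_right_iff, not_forall] at h h'
      obtain ⟨h, -⟩ := h
      obtain ⟨h', -⟩ := h'
      rw [dif_pos h, dif_pos h']
      exact hc ⟨_, h⟩ ⟨_, h'⟩ rfl hj
    · split_ifs with h
      · by_contra hcon
        have h1 := hN (T ⟨c, h⟩) (not_le.1 hcon)
        rw [← hd, Set.ncard_eq_zero (hfin T _)] at h1
        have h2 : (⟨c, h⟩ : SkewCell lam μ) ∈ {c' : SkewCell lam μ | T c' = T ⟨c, h⟩} := rfl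
        rw [h1] at h2
        exact h2
      · exact Nat.zero_le _
    · rw [expo, ← hd, ← Set.ncard_image_of_injective _ Subtype.val_injective]
      congr 1
      ext c
      simp only [Set.mem_ofPred_eq, Set.mem_image, Subtype.exists, exists_and_right,
        exists_eq_right]
      constructor
      · intro h
        split_ifs at h with hc
        exact ⟨hc, PNat.coe_injective (by rw [h, Nat.succPNat_coe])⟩
      · rintro ⟨hc, h⟩
        rw [dif_pos hc, h, Nat.succPNat_coe]
  · intro T T' _ _ h
    funext c
    have := congrFun h c.1
    simp only [dif_pos c.2] at this
    exact PNat.coe_injective this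
  · intro t ht
    have hpos : ∀ c : SkewCell lam μ, 0 < t c.1 :=
      fun c => Nat.pos_of_ne_zero ((ht.ne_zero c.1).2 c.2)
    refine ⟨fun c => ⟨t c.1, hpos c⟩, ⟨⟨?_, ?_⟩, fun i => ?_⟩, ?_⟩
    · rintro ⟨⟨i, j⟩, h⟩ ⟨⟨i', j'⟩, h'⟩ (rfl : i = i') hj
      exact ht.row _ _ _ hj (hpos ⟨_, h⟩).ne' (hpos ⟨_, h'⟩).ne'
    · rintro ⟨⟨i, j⟩, h⟩ ⟨⟨i', j'⟩, h'⟩ (rfl : j = j') hi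
      exact ht.col _ _ _ hi (hpos ⟨_, h⟩).ne' (hpos ⟨_, h'⟩).ne'
    · rw [← Set.ncard_image_of_injective _ Subtype.val_injective]
      have himg : (Subtype.val '' {c : SkewCell lam μ | (⟨t c.1, hpos c⟩ : ℕ+) = i}) =
          {c | t c = (i : ℕ)} := by
        ext c
        simp only [Set.mem_ofPred_eq, Set.mem_image, Subtype.exists, exists_and_right,
          exists_eq_right]
        constructor
        · rintro ⟨_, h⟩
          rw [← h]
          rfl
        · intro h
          exact ⟨(ht.ne_zero c).1 (by rw [h]; exact i.ne_zero), PNat.coe_injective h⟩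
      refine (congrArg Set.ncard himg).trans ?_
      by_cases hi : (i : ℕ) ≤ N
      · have h1 := ht.content (i.natPred) (by have := i.natPred_add_one; omega)
        rw [i.natPred_add_one, expo, PNat.succPNat_natPred] at h1
        exact h1
      · rw [hN i (not_le.1 hi), Set.ncard_eq_zero
          (lam.cells.finite_toSet.subset fun c hc => ?_)]
        · ext c
          simp only [Set.mem_ofPred_eq, Set.mem_empty_iff_false, iff_false]
          have := ht.le c
          omega
        · have hc' : t c = i := hc
          exact ((ht.ne_zero c).1 (by rw [hc']; exact i.ne_zero)).1
    · funext c
      by_cases h : c ∈ lam ∧ c ∉ μ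
      · simp [dif_pos h]
      · simp only [dif_neg h]
        by_contra hcon
        exact h ((ht.ne_zero c).1 (Ne.symm hcon))

/-- The linear map with `lam ↦ S_lam`. -/
def schurMap : (YoungDiagram →₀ ℤ) →ₗ[ℤ] Series := Finsupp.linearCombination ℤ schur

theorem schurMap_single (lam : YoungDiagram) : schurMap (Finsupp.single lam 1) = schur lam := by
  simp [schurMap]

theorem coeff_schurMap (f : YoungDiagram →₀ ℤ) (d : ℕ+ →₀ ℕ) {N : ℕ}
    (hN : ∀ i : ℕ+, N < i → d i = 0) : MvPowerSeries.coeff d (schurMap f) =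
      blockOp downOp (revContent (expo d) N) f ⊥ := by
  rw [schurMap, Finsupp.linearCombination_apply, end_apply_eq_sum, Finsupp.sum, Finsupp.sum,
    map_sum]
  refine Finset.sum_congr rfl fun lam _ => ?_
  rw [map_smul, schur, coeff_skewSchur bot_le d hN, smul_eq_mul]

end SchurCoefficients

/-! ### The Pieri rule for Schur functions -/

section Pieri

/-- The row lengths of the diagram that the local rule associates with `ρ`. -/
def localRule (x y ρ : YoungDiagram) (n : ℕ) : ℕ → ℕ
  | 0 => max (x.rowLen 0) (y.rowLen 0) + n
  | i + 1 => max (x.rowLen (i + 1)) (y.rowLen (i + 1)) +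
      (min (x.rowLen i) (y.rowLen i) - ρ.rowLen i)

theorem card_add_card_eq {x y : YoungDiagram} {N : ℕ} (hx : x.rowLen N = 0)
    (hy : y.rowLen N = 0) : x.card + y.card = ∑ i ∈ Finset.range N, max (x.rowLen i) (y.rowLen i) +
      ∑ i ∈ Finset.range N, min (x.rowLen i) (y.rowLen i) := by
  rw [card_eq_sum_rowLen hx, card_eq_sum_rowLen hy, ← Finset.sum_add_distrib,
    ← Finset.sum_add_distrib]
  exact Finset.sum_congr rfl fun i _ => (max_add_min _ _).symm

theorem exists_rowLen_eq_zero (x y ρ : YoungDiagram) :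
    ∃ N, x.rowLen N = 0 ∧ y.rowLen N = 0 ∧ ρ.rowLen N = 0 :=
  ⟨x.colLen 0 + y.colLen 0 + ρ.colLen 0, rowLen_eq_zero (by omega), rowLen_eq_zero (by omega),
    rowLen_eq_zero (by omega)⟩

/-- The local rule: the diagrams `ν` that arise from both of `x` and `y` by adding horizontal strips
are in bijection with the pairs of a diagram `ρ` that arises from both by removing horizontal strips
and a number of extra cells of the first row of `ν`. Row by row, `ν_{i+1}` and `ρ_i` range over
the interval from `max x_{i+1} y_{i+1}` to `min x_i y_i`, which is reflected. -/
theorem card_upStrips_inter {x y : YoungDiagram} {m n : ℕ} (h : x.card + n = y.card + m) :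
    ((upStrips n x).filter fun ν => ν ∈ upStrips m y).card =
      ∑ i ∈ Finset.range (min m n + 1),
        ((downStrips (m - i) x).filter fun ρ => ρ ∈ downStrips (n - i) y).card := by
  rw [← Finset.card_sigma]
  symm
  -- the diagram `ν` of a pair `(i, ρ)`
  have key : ∀ (ρ : YoungDiagram) (i : ℕ), IsStrip ρ x → IsStrip ρ y →
      x.card + i = ρ.card + m → ∃ ν : YoungDiagram, (∀ j, ν.rowLen j = localRule x y ρ i j) ∧
        IsStrip x ν ∧ IsStrip y ν ∧ ν.card = x.card + n := by
    intro ρ i h1 h2 hc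
    obtain ⟨N, hx, hy, hρ⟩ := exists_rowLen_eq_zero x y ρ
    have hanti : Antitone (localRule x y ρ i) := by
      refine antitone_nat_of_succ_le fun j => ?_
      have := h1 j
      have := h2 j
      have := x.rowLen_anti j (j + 1) (by omega)
      have := y.rowLen_anti j (j + 1) (by omega)
      cases j with
      | zero => simp only [localRule]; omega
      | succ j =>
        have := h1 (j + 1)
        have := h2 (j + 1)
        simp only [localRule]
        omega
    have hz : localRule x y ρ i (N + 1) = 0 := by
      have := x.rowLen_anti N (N + 1) (by omega)
      have := y.rowLen_anti N (N + 1) (by omega)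
      simp only [localRule]
      omega
    refine ⟨ofRows _ hanti (N + 1) hz, rowLen_ofRows hanti hz, fun j => ?_, fun j => ?_, ?_⟩
    · rw [rowLen_ofRows hanti hz, rowLen_ofRows hanti hz]
      have := h1 j
      have := h2 j
      refine ⟨?_, by simp only [localRule]; omega⟩
      cases j <;> simp only [localRule] <;> omega
    · rw [rowLen_ofRows hanti hz, rowLen_ofRows hanti hz]
      have := h1 j
      have := h2 j
      refine ⟨?_, by simp only [localRule]; omega⟩
      cases j <;> simp only [localRule] <;> omega
    · have e1 : (ofRows _ hanti (N + 1) hz).card = ∑ j ∈ Finset.range (N + 1),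
          localRule x y ρ i j := by
        rw [card_eq_sum_rowLen (N := N + 1) (by rw [rowLen_ofRows, hz])]
        exact Finset.sum_congr rfl fun j _ => rowLen_ofRows hanti hz j
      have e2 : (ofRows _ hanti (N + 1) hz).card + ρ.card = (x.card + y.card) + i := by
        rw [e1, card_eq_sum_rowLen hρ, Finset.sum_range_succ',
          card_add_card_eq hx hy]
        have e3 : ∑ j ∈ Finset.range N, localRule x y ρ i (j + 1) +
            ∑ j ∈ Finset.range N, ρ.rowLen j =
            ∑ j ∈ Finset.range N, max (x.rowLen (j + 1)) (y.rowLen (j + 1)) +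
            ∑ j ∈ Finset.range N, min (x.rowLen j) (y.rowLen j) := by
          rw [← Finset.sum_add_distrib, ← Finset.sum_add_distrib]
          refine Finset.sum_congr rfl fun j _ => ?_
          have := h1 j
          have := h2 j
          simp only [localRule]
          omega
        have e4 := Finset.sum_range_succ (fun j => max (x.rowLen j) (y.rowLen j)) N
        rw [Finset.sum_range_succ', hx, hy] at e4
        simp only [localRule] at *
        simp only [max_self] at e4
        omega
      omega
  refine Finset.card_bij (fun p hp => (key p.2 p.1 ?_ ?_ ?_).choose) ?_ ?_ ?_
  all_goals try
    simp only [Finset.mem_sigma, Finset.mem_range, Finset.mem_filter, mem_downStrips] at hp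
  · exact hp.2.1.1
  · exact hp.2.2.1
  · have := hp.2.1.2
    omega
  · intro p hp
    simp only [Finset.mem_filter, mem_upStrips]
    generalize_proofs hk
    have := hk.choose_spec
    exact ⟨⟨this.2.1, this.2.2.2⟩, this.2.2.1, by omega⟩
  · intro p hp q hq heq
    generalize_proofs hk hk' at heq
    have s1 := hk.choose_spec.1
    have s2 := hk'.choose_spec.1
    rw [heq] at s1
    simp only [Finset.mem_sigma, Finset.mem_range, Finset.mem_filter, mem_downStrips] at hp hq
    have e1 : p.1 = q.1 := by
      have := s1 0
      rw [s2 0] at this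
      simp only [localRule] at this
      omega
    have e2 : p.2 = q.2 := by
      refine ext_rowLen fun i => ?_
      have := s1 (i + 1)
      rw [s2 (i + 1)] at this
      have a1 := hp.2.1.1 i
      have a2 := hp.2.2.1 i
      have a3 := hq.2.1.1 i
      have a4 := hq.2.2.1 i
      simp only [localRule] at this
      omega
    exact Sigma.ext e1 (heq_of_eq e2)
  · intro ν hν
    simp only [Finset.mem_filter, mem_upStrips] at hν
    obtain ⟨⟨h1, hc1⟩, h2, hc2⟩ := hν
    obtain ⟨N, hx, hy, hν0⟩ := exists_rowLen_eq_zero x y ν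
    let f : ℕ → ℕ := fun i => max (x.rowLen (i + 1)) (y.rowLen (i + 1)) +
      (min (x.rowLen i) (y.rowLen i) - ν.rowLen (i + 1))
    have hanti : Antitone f := by
      refine antitone_nat_of_succ_le fun j => ?_
      have := h1 j
      have := h2 j
      have := h1 (j + 1)
      have := h2 (j + 1)
      have := h1 (j + 1 + 1)
      have := h2 (j + 1 + 1)
      simp only [f]
      omega
    have hz : f N = 0 := by
      have := x.rowLen_anti N (N + 1) (by omega)
      have := y.rowLen_anti N (N + 1) (by omega)
      simp only [f]
      omega
    have hr := rowLen_ofRows hanti hz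
    set ρ := ofRows f hanti N hz with hρ
    have hρx : IsStrip ρ x := by
      intro j
      have := h1 j
      have := h2 j
      have := h1 (j + 1)
      have := h2 (j + 1)
      rw [hr]
      simp only [f]
      omega
    have hρy : IsStrip ρ y := by
      intro j
      have := h1 j
      have := h2 j
      have := h1 (j + 1)
      have := h2 (j + 1)
      rw [hr]
      simp only [f]
      omega
    let i := ν.rowLen 0 - max (x.rowLen 0) (y.rowLen 0)
    have hcard : ρ.card + ν.card = x.card + y.card + i := by
      have hν1 : ν.rowLen (N + 1) = 0 := by
        have := ν.rowLen_anti N (N + 1) (by omega)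
        omega
      rw [card_eq_sum_rowLen (N := N) (by rw [hr, hz]), card_eq_sum_rowLen hν1,
        Finset.sum_range_succ', card_add_card_eq hx hy]
      have e3 : ∑ j ∈ Finset.range N, ρ.rowLen j + ∑ j ∈ Finset.range N, ν.rowLen (j + 1) =
          ∑ j ∈ Finset.range N, max (x.rowLen (j + 1)) (y.rowLen (j + 1)) +
          ∑ j ∈ Finset.range N, min (x.rowLen j) (y.rowLen j) := by
        rw [← Finset.sum_add_distrib, ← Finset.sum_add_distrib]
        refine Finset.sum_congr rfl fun j _ => ?_
        have := h1 j
        have := h2 j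
        rw [hr]
        simp only [f]
        omega
      have e4 := Finset.sum_range_succ (fun j => max (x.rowLen j) (y.rowLen j)) N
      rw [Finset.sum_range_succ', hx, hy] at e4
      have := h1 0
      have := h2 0
      simp only [max_self] at e4
      simp only [i]
      omega
    have := card_le_card hρx.le
    have := card_le_card hρy.le
    have hmem : (⟨i, ρ⟩ : Σ _ : ℕ, YoungDiagram) ∈ (Finset.range (min m n + 1)).sigma fun i =>
        (downStrips (m - i) x).filter fun ρ => ρ ∈ downStrips (n - i) y := by
      simp only [Finset.mem_sigma, Finset.mem_range, Finset.mem_filter, mem_downStrips]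
      exact ⟨by omega, ⟨hρx, by omega⟩, hρy, by omega⟩
    refine ⟨⟨i, ρ⟩, hmem, ?_⟩
    generalize_proofs hk
    refine ext_rowLen fun j => ?_
    rw [hk.choose_spec.1 j]
    cases j with
    | zero =>
      have := h1 0
      have := h2 0
      simp only [localRule, i]
      omega
    | succ j =>
      have := h1 j
      have := h2 j
      have := h1 (j + 1)
      have := h2 (j + 1)
      simp only [localRule, hr, f]
      omega

/-- The commutation relation of the removal and the addition of horizontal strips: its matrix
coefficients are the two sides of the local rule. -/
theorem downOp_mul_upOp (m n : ℕ) : downOp m * upOp n =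
    ∑ i ∈ Finset.range (min m n + 1), upOp (n - i) * downOp (m - i) := by
  have expand : ∀ (A B : Module.End ℤ (YoungDiagram →₀ ℤ)) (s : Finset YoungDiagram)
      (x y : YoungDiagram) (p : YoungDiagram → Prop) [DecidablePred p],
      B (Finsupp.single x 1) = ∑ z ∈ s, Finsupp.single z 1 →
      (∀ z, A (Finsupp.single z 1) y = if p z then 1 else 0) →
      (A * B) (Finsupp.single x 1) y = ((s.filter p).card : ℤ) := by
    intro A B s x y p _ hB hA
    rw [Module.End.mul_apply, hB, map_sum, Finsupp.finsetSum_apply, Finset.card_filter]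
    push_cast
    exact Finset.sum_congr rfl fun z _ => hA z
  refine Finsupp.lhom_ext' fun x => LinearMap.ext_ring (Finsupp.ext fun y => ?_)
  simp only [LinearMap.comp_apply, Finsupp.lsingle_apply, LinearMap.sum_apply,
    Finsupp.finsetSum_apply]
  rw [expand _ _ _ _ _ (fun ν => ν ∈ upStrips m y) (upOp_single n x) fun z => by
    rw [downOp_single_apply]; simp only [mem_upStrips]]
  rw [Finset.sum_congr rfl fun i _ => expand _ _ _ _ _ (fun ρ => ρ ∈ downStrips (n - i) y)
    (downOp_single (m - i) x) fun z => by rw [upOp_single_apply]; simp only [mem_downStrips]]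
  by_cases h : x.card + n = y.card + m
  · rw [card_upStrips_inter h]
    push_cast
    rfl
  · rw [Finset.filter_eq_empty_iff.2, Finset.sum_eq_zero]
    · rfl
    · intro i hi
      rw [Finset.mem_range] at hi
      rw [Finset.filter_eq_empty_iff.2]
      · rfl
      · intro z hz
        rw [mem_downStrips] at hz ⊢
        rintro ⟨-, hc⟩
        have := hz.2
        omega
    · intro z hz
      rw [mem_upStrips] at hz ⊢
      rintro ⟨-, hc⟩
      have := hz.2
      omega

end Pieri

section PieriSeries

theorem revContent_eq (e : ℕ → ℕ) (N : ℕ) :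
    revContent e N = ((List.range N).map e).reverse := by
  induction N with
  | zero => rfl
  | succ N ih => simp [revContent, ih, List.range_succ]

theorem revContent_congr {e e' : ℕ → ℕ} {N : ℕ} (h : ∀ m < N, e m = e' m) :
    revContent e N = revContent e' N := by
  rw [revContent_eq, revContent_eq]
  congr 1
  exact List.map_congr_left fun m hm => h m (List.mem_range.1 hm)

/-- A sum over the decompositions of a monomial, split according to the exponent of one variable. -/
theorem sum_antidiagonal_add_single (F : (ℕ+ →₀ ℕ) → ℤ) (d : ℕ+ →₀ ℕ) (i : ℕ+) (hd : d i = 0)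
    (a n : ℕ) :
    ∑ p ∈ (Finset.HasAntidiagonal.antidiagonal (d + Finsupp.single i a)).filter
        (fun p => p.1.degree = n), F p.2 =
      ∑ j ∈ Finset.range (min a n + 1),
        ∑ p ∈ (Finset.HasAntidiagonal.antidiagonal d).filter (fun p => p.1.degree = n - j),
          F (p.2 + Finsupp.single i (a - j)) := by
  rw [Finset.sum_sigma']
  have erase_add : ∀ (x : ℕ+ →₀ ℕ) (b : ℕ), x i = 0 → (x + Finsupp.single i b).erase i = x := by
    intro x b hx
    ext k
    by_cases hk : k = i
    · subst hk; simp [hx]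
    · simp [Finsupp.erase_ne hk]
  have add_erase : ∀ x : ℕ+ →₀ ℕ, x.erase i + Finsupp.single i (x i) = x := fun x => by
    rw [add_comm]; exact Finsupp.single_add_erase i x
  refine Finset.sum_bij' (fun p _ => ⟨p.1 i, (p.1.erase i, p.2.erase i)⟩)
    (fun q _ => (q.2.1 + Finsupp.single i q.1, q.2.2 + Finsupp.single i (a - q.1)))
    ?_ ?_ ?_ ?_ ?_
  · rintro ⟨x, y⟩ hp
    simp only [Finset.mem_filter, Finset.HasAntidiagonal.mem_antidiagonal, Finset.mem_sigma,
      Finset.mem_range] at hp ⊢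
    have h1 := DFunLike.congr_fun hp.1 i
    simp only [Finsupp.add_apply, hd, Finsupp.single_eq_same] at h1
    have h2 : x.degree = (x.erase i).degree + x i := by
      conv_lhs => rw [← add_erase x]
      rw [map_add, Finsupp.degree_single]
    refine ⟨by omega, ?_, by omega⟩
    rw [← Finsupp.erase_add, hp.1, erase_add d a hd]
  · rintro ⟨j, x, y⟩ hq
    simp only [Finset.mem_filter, Finset.HasAntidiagonal.mem_antidiagonal, Finset.mem_sigma,
      Finset.mem_range] at hq ⊢
    refine ⟨?_, by rw [map_add, Finsupp.degree_single]; omega⟩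
    rw [add_add_add_comm, hq.2.1, ← Finsupp.single_add, Nat.add_sub_cancel' (by omega)]
  · rintro ⟨x, y⟩ hp
    simp only [Finset.mem_filter, Finset.HasAntidiagonal.mem_antidiagonal] at hp
    have h1 := DFunLike.congr_fun hp.1 i
    simp only [Finsupp.add_apply, hd, Finsupp.single_eq_same] at h1
    have h2 : a - x i = y i := by omega
    simp only [h2, add_erase]
  · rintro ⟨j, x, y⟩ hq
    simp only [Finset.mem_filter, Finset.HasAntidiagonal.mem_antidiagonal, Finset.mem_sigma,
      Finset.mem_range] at hq
    have h1 := DFunLike.congr_fun hq.2.1 i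
    simp only [Finsupp.add_apply, hd, add_eq_zero] at h1
    simp only [Finsupp.add_apply, h1.1, Finsupp.single_eq_same, zero_add, erase_add _ _ h1.1,
      erase_add _ _ h1.2]
  · rintro ⟨x, y⟩ hp
    simp only [Finset.mem_filter, Finset.HasAntidiagonal.mem_antidiagonal] at hp
    have h1 := DFunLike.congr_fun hp.1 i
    simp only [Finsupp.add_apply, hd, Finsupp.single_eq_same] at h1
    have h2 : a - x i = y i := by omega
    simp only [h2, add_erase]

theorem upOp_single_bot_apply_bot (n : ℕ) (f : YoungDiagram →₀ ℤ) :
    upOp n f ⊥ = if n = 0 then f ⊥ else 0 := by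
  rw [end_apply_eq_sum]
  simp only [upOp_single_apply]
  have : ∀ ν : YoungDiagram, (IsStrip ν ⊥ ∧ (⊥ : YoungDiagram).card = ν.card + n) ↔
      ν = ⊥ ∧ n = 0 := by
    intro ν
    constructor
    · rintro ⟨h1, h2⟩
      refine ⟨le_bot_iff.1 h1.le, ?_⟩
      have : (⊥ : YoungDiagram).card = 0 := rfl
      omega
    · rintro ⟨rfl, rfl⟩
      exact ⟨isStrip_iff.2 ⟨le_rfl, fun i j h => (YoungDiagram.notMem_bot _ h).elim⟩, rfl⟩
  simp only [this]
  split_ifs with h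
  · simp only [h, and_true, mul_ite, mul_one, mul_zero]
    rw [Finsupp.sum, Finset.sum_ite_eq']
    split_ifs with h'
    · rfl
    · exact (Finsupp.notMem_support_iff.1 h').symm
  · simp [h, Finsupp.sum]

/-- The Pieri rule for the coefficients at monomials in `N` variables: on the left is the
coefficient of `h_n` times a combination of Schur functions, on the right that of its image under
`upOp n`. The removal of the strip of the last variable is moved past `upOp n` by `downOp_mul_upOp`.
-/
theorem sum_antidiagonal_downOp (N : ℕ) : ∀ (d : ℕ+ →₀ ℕ), (∀ i : ℕ+, N < i → d i = 0) →
    ∀ (n : ℕ) (f : YoungDiagram →₀ ℤ),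
    ∑ p ∈ (Finset.HasAntidiagonal.antidiagonal d).filter (fun p => p.1.degree = n),
      blockOp downOp (revContent (expo p.2) N) f ⊥ =
    blockOp downOp (revContent (expo d) N) (upOp n f) ⊥ := by
  induction N with
  | zero =>
    intro d hd n f
    have : d = 0 := Finsupp.ext fun i => hd i i.pos
    subst this
    simp only [revContent, blockOp, Module.End.one_apply, upOp_single_bot_apply_bot,
      Finset.sum_const, Finset.HasAntidiagonal.antidiagonal_zero]
    rw [Finset.filter_singleton]
    split_ifs with h1 h2 h2
    · simp
    · simp at h1; omega
    · subst h2; simp at h1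
    · simp
  | succ N ih =>
    intro d hd n f
    have hd' : ∀ i : ℕ+, N < i → (d.erase N.succPNat) i = 0 := by
      intro i hi
      by_cases h : i = N.succPNat
      · rw [h, Finsupp.erase_same]
      · rw [Finsupp.erase_ne h]
        refine hd i (lt_of_le_of_ne hi fun heq => h (PNat.coe_injective ?_))
        rw [Nat.succPNat_coe]
        exact heq.symm
    have hexpo : ∀ (x : ℕ+ →₀ ℕ) (b m : ℕ), m < N →
        expo (x + Finsupp.single N.succPNat b) m = expo x m := by
      intro x b m hm
      rw [expo, expo, Finsupp.add_apply, Finsupp.single_eq_of_ne, add_zero]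
      intro h
      have := Nat.succPNat_injective h
      omega
    have hdec : d = d.erase N.succPNat + Finsupp.single N.succPNat (d N.succPNat) := by
      rw [add_comm]; exact (Finsupp.single_add_erase _ d).symm
    have hrhs : blockOp downOp (revContent (expo d) (N + 1)) (upOp n f) =
        blockOp downOp (revContent (expo (d.erase N.succPNat)) N)
          ((downOp (d N.succPNat) * upOp n) f) := by
      rw [revContent, blockOp]
      conv_lhs => rw [hdec, revContent_congr (hexpo _ _), ← hdec]
      rfl
    rw [hrhs]
    conv_lhs => rw [hdec]
    rw [sum_antidiagonal_add_single
      (fun y => blockOp downOp (revContent (expo y) (N + 1)) f ⊥) _ _ Finsupp.erase_same,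
      downOp_mul_upOp,
      LinearMap.sum_apply, map_sum, Finsupp.finsetSum_apply]
    refine Finset.sum_congr rfl fun j _ => ?_
    rw [Module.End.mul_apply, ← ih _ hd']
    refine Finset.sum_congr rfl fun p hp => ?_
    rw [revContent, blockOp, revContent_congr (hexpo _ _), Module.End.mul_apply]
    congr 4
    rw [Finset.mem_filter, Finset.HasAntidiagonal.mem_antidiagonal] at hp
    have h1 := DFunLike.congr_fun hp.1 N.succPNat
    simp only [Finsupp.add_apply, Finsupp.erase_same, add_eq_zero] at h1
    simp [expo, h1.2]

theorem exists_bound (d : ℕ+ →₀ ℕ) : ∃ N : ℕ, ∀ i : ℕ+, N < i → d i = 0 := by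
  refine ⟨d.support.sup (fun i => (i : ℕ)), fun i hi => ?_⟩
  by_contra h
  exact absurd (Finset.le_sup (f := fun i : ℕ+ => (i : ℕ)) (Finsupp.mem_support_iff.2 h))
    (not_le.2 hi)

/-- The Pieri rule for Schur functions. -/
theorem hSym_mul_schurMap (n : ℕ) (f : YoungDiagram →₀ ℤ) :
    hSym n * schurMap f = schurMap (upOp n f) := by
  refine MvPowerSeries.ext fun d => ?_
  obtain ⟨N, hN⟩ := exists_bound d
  rw [coeff_schurMap _ d hN, ← sum_antidiagonal_downOp N d hN, MvPowerSeries.coeff_mul,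
    Finset.sum_filter]
  refine Finset.sum_congr rfl fun p hp => ?_
  rw [Finset.HasAntidiagonal.mem_antidiagonal] at hp
  have hN' : ∀ i : ℕ+, N < i → p.2 i = 0 := by
    intro i hi
    have h1 := hN i hi
    rw [← hp, Finsupp.add_apply] at h1
    omega
  rw [coeff_schurMap _ _ hN']
  have : MvPowerSeries.coeff p.1 (hSym n) = if p.1.degree = n then 1 else 0 := rfl
  rw [this]
  split_ifs <;> simp

theorem schur_bot : schur ⊥ = 1 := by
  refine MvPowerSeries.ext fun d => ?_
  obtain ⟨N, hN⟩ := exists_bound d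
  rw [schur, coeff_skewSchur le_rfl d hN, ← ncard_isTab le_rfl, MvPowerSeries.coeff_one]
  have key : ∀ t, IsTab ⊥ ⊥ (expo d) N t ↔ t = (fun _ => 0) ∧ d = 0 := by
    intro t
    constructor
    · intro ht
      have h0 : t = fun _ => 0 := by
        funext c
        by_contra h
        exact YoungDiagram.notMem_bot c ((ht.ne_zero c).1 h).1
      refine ⟨h0, Finsupp.ext fun i => ?_⟩
      by_cases hi : (i : ℕ) ≤ N
      · have h1 := ht.content i.natPred (by have := i.natPred_add_one; omega)
        rw [expo, PNat.succPNat_natPred] at h1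
        rw [← h1, h0]
        simp [i.ne_zero.symm]
      · exact hN i (not_le.1 hi)
    · rintro ⟨rfl, rfl⟩
      exact ⟨by simp, by simp, by simp, by simp, by simp [expo]⟩
  split_ifs with h
  · have : {t | IsTab ⊥ ⊥ (expo d) N t} = {fun _ => 0} := by
      ext t
      rw [Set.mem_ofPred_eq, key, Set.mem_singleton_iff, and_iff_left h]
    rw [this]; simp
  · have : {t | IsTab ⊥ ⊥ (expo d) N t} = ∅ := by
      ext t
      rw [Set.mem_ofPred_eq, key]
      simp [h]
    rw [this]; simp

theorem hList_mul_schurMap (α : List ℕ) (f : YoungDiagram →₀ ℤ) :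
    hList α * schurMap f = schurMap (blockOp upOp α f) := by
  induction α generalizing f with
  | nil => simp [hList, blockOp]
  | cons n α ih =>
    have : hList (n :: α) = hList α * hSym n := by simp [hList, mul_comm]
    rw [this, mul_assoc, hSym_mul_schurMap, ih, blockOp, Module.End.mul_apply]

end PieriSeries

/-! ### Kostka numbers and the basis of Schur functions -/

section Kostka

/-- The vector of the Kostka numbers `K_{lam, α}`. -/
def kostka (α : List ℕ) : YoungDiagram →₀ ℤ := blockOp upOp α (Finsupp.single ⊥ 1)

theorem hList_eq (α : List ℕ) : hList α = schurMap (kostka α) := by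
  rw [kostka, ← hList_mul_schurMap, schurMap_single, schur_bot, mul_one]

theorem coeff_schur (lam : YoungDiagram) (d : ℕ+ →₀ ℕ) {N : ℕ}
    (hN : ∀ i : ℕ+, N < i → d i = 0) :
    MvPowerSeries.coeff d (schur lam) = kostka ((List.range N).map (expo d)) lam := by
  rw [schur, coeff_skewSchur bot_le d hN, kostka, blockOp_upOp_eq_downOp, revContent_eq]

theorem kostka_append (α : List ℕ) (n : ℕ) : kostka (α ++ [n]) = upOp n (kostka α) := by
  simp [kostka, blockOp_append, blockOp]

theorem exists_of_upOp_ne_zero {n : ℕ} {f : YoungDiagram →₀ ℤ} {lam : YoungDiagram}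
    (h : upOp n f lam ≠ 0) : ∃ ν, f ν ≠ 0 ∧ IsStrip ν lam ∧ lam.card = ν.card + n := by
  rw [end_apply_eq_sum] at h
  obtain ⟨ν, hν, hne⟩ := Finset.exists_ne_zero_of_sum_ne_zero h
  beta_reduce at hne
  rw [upOp_single_apply] at hne
  refine ⟨ν, Finsupp.mem_support_iff.1 hν, ?_⟩
  by_contra hcon
  simp [if_neg hcon] at hne

theorem rowLen_zero_of_le {lam : YoungDiagram} {M N : ℕ} (h : lam.rowLen M = 0) (hMN : M ≤ N) :
    lam.rowLen N = 0 := by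
  have := lam.rowLen_anti M N hMN
  omega

/-- The Kostka numbers are triangular for `∑ i lam_i`. -/
theorem kostka_ne_zero {e : ℕ → ℕ} {N : ℕ} {lam : YoungDiagram}
    (h : kostka ((List.range N).map e) lam ≠ 0) :
    lam.rowLen N = 0 ∧ lam.card = ∑ i ∈ Finset.range N, e i ∧
      ∑ i ∈ Finset.range N, i * lam.rowLen i ≤ ∑ i ∈ Finset.range N, i * e i ∧
      (∑ i ∈ Finset.range N, i * lam.rowLen i = ∑ i ∈ Finset.range N, i * e i →
        ∀ i < N, lam.rowLen i = e i) := by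
  induction N generalizing lam with
  | zero =>
    have : lam = ⊥ := by
      by_contra hcon
      exact h (Finsupp.single_eq_of_ne hcon)
    subst this
    refine ⟨rowLen_eq_zero ?_, rfl, le_rfl, fun _ i hi => absurd hi (Nat.not_lt_zero i)⟩
    by_contra hcon
    exact YoungDiagram.notMem_bot (0, 0) (YoungDiagram.mem_iff_lt_colLen.2 (not_le.1 hcon))
  | succ N ih =>
    rw [List.range_succ, List.map_append, List.map_singleton, kostka_append] at h
    obtain ⟨ν, hν, hs, hc⟩ := exists_of_upOp_ne_zero h
    obtain ⟨h1, h2, h3, h4⟩ := ih hν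
    have hlam : lam.rowLen (N + 1) = 0 := by have := (hs N).2; omega
    -- `δ i` cells are added to the row `i`, and `∑ i δ i ≤ N ∑ δ i`
    obtain ⟨δ, hδ⟩ : ∃ δ : ℕ → ℕ, ∀ i, lam.rowLen i = ν.rowLen i + δ i :=
      ⟨fun i => lam.rowLen i - ν.rowLen i, fun i => (Nat.add_sub_cancel' (hs i).1).symm⟩
    have c1 : lam.card = ν.card + ∑ i ∈ Finset.range (N + 1), δ i := by
      rw [card_eq_sum_rowLen hlam, card_eq_sum_rowLen (rowLen_zero_of_le h1 (Nat.le_succ N)),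
        ← Finset.sum_add_distrib]
      exact Finset.sum_congr rfl fun i _ => hδ i
    have c2 : ∑ i ∈ Finset.range (N + 1), i * lam.rowLen i =
        ∑ i ∈ Finset.range N, i * ν.rowLen i + ∑ i ∈ Finset.range N, i * δ i + N * δ N := by
      rw [Finset.sum_range_succ, hδ N, h1, zero_add, ← Finset.sum_add_distrib]
      congr 1
      exact Finset.sum_congr rfl fun i _ => by rw [hδ]; ring
    have c3 : N * e N = ∑ i ∈ Finset.range N, N * δ i + N * δ N := by
      rw [← Finset.mul_sum, ← mul_add, ← Finset.sum_range_succ]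
      congr 1
      omega
    have c4 : ∑ i ∈ Finset.range N, i * δ i ≤ ∑ i ∈ Finset.range N, N * δ i :=
      Finset.sum_le_sum fun i hi => Nat.mul_le_mul_right _ (Finset.mem_range.1 hi).le
    refine ⟨hlam, by rw [hc, h2, Finset.sum_range_succ], ?_, ?_⟩
    · rw [c2, Finset.sum_range_succ, c3]
      omega
    · intro heq
      rw [c2, Finset.sum_range_succ, c3] at heq
      have h5 := h4 (by omega)
      have h6 : ∑ i ∈ Finset.range N, i * δ i = ∑ i ∈ Finset.range N, N * δ i := by omega
      have h7 : ∀ i < N, δ i = 0 := by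
        intro i hi
        have := (Finset.sum_eq_sum_iff_of_le fun i hi =>
          Nat.mul_le_mul_right (δ i) (Finset.mem_range.1 hi).le).1 h6 i (Finset.mem_range.2 hi)
        rcases Nat.eq_or_lt_of_le (Nat.zero_le (δ i)) with h | h
        · exact h.symm
        · have := Nat.eq_of_mul_eq_mul_right h this
          omega
      intro i hi
      rcases Nat.lt_succ_iff_lt_or_eq.1 hi with hi | rfl
      · rw [hδ, h7 i hi, h5 i hi, add_zero]
      · rw [Finset.sum_range_succ, Finset.sum_eq_zero fun j hj => h7 j (Finset.mem_range.1 hj)]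
          at c1
        rw [hδ]
        omega

/-- `K_{lam, lam} = 1`: the shape before the last strip is added has fewer rows, so that this strip
is the last row of `lam`. -/
theorem kostka_self {N : ℕ} {lam : YoungDiagram} (h : lam.rowLen N = 0) :
    kostka ((List.range N).map lam.rowLen) lam = 1 := by
  induction N generalizing lam with
  | zero =>
    have : lam = ⊥ := by
      refine le_bot_iff.1 (le_iff_rowLen_le.2 fun i => ?_)
      rw [rowLen_zero_of_le h (Nat.zero_le i)]
      exact Nat.zero_le _
    subst this
    exact Finsupp.single_eq_same
  | succ N ih =>
    let f : ℕ → ℕ := fun i => if i < N then lam.rowLen i else 0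
    have hf : Antitone f := by
      intro i j hij
      have := lam.rowLen_anti i j hij
      simp only [f]
      split_ifs <;> omega
    have hr := rowLen_ofRows hf (N := N) (by simp [f])
    set ν := ofRows f hf N (by simp [f]) with hν
    have hνN : ν.rowLen N = 0 := by rw [hr]; simp [f]
    have hmap : (List.range N).map lam.rowLen = (List.range N).map ν.rowLen :=
      List.map_congr_left fun i hi => by rw [hr]; simp [f, List.mem_range.1 hi]
    rw [List.range_succ, List.map_append, List.map_singleton, kostka_append, hmap,
      end_apply_eq_sum, Finsupp.sum]
    have hs : IsStrip ν lam ∧ lam.card = ν.card + lam.rowLen N := by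
      constructor
      · intro i
        have := lam.rowLen_anti i (i + 1) (Nat.le_succ i)
        rw [hr]
        simp only [f]
        split_ifs with hi
        · omega
        · have := rowLen_zero_of_le h (show N + 1 ≤ i + 1 by omega)
          omega
      · rw [card_eq_sum_rowLen h, card_eq_sum_rowLen hνN, Finset.sum_range_succ]
        congr 1
        exact Finset.sum_congr rfl fun i hi => by rw [hr]; simp [f, Finset.mem_range.1 hi]
    rw [Finset.sum_eq_single ν]
    · rw [ih hνN, upOp_single_apply, if_pos hs, mul_one]
    · intro ν' hν' hne
      rw [upOp_single_apply, if_neg, mul_zero]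
      rintro ⟨h1, h2⟩
      obtain ⟨g1, g2, -⟩ := kostka_ne_zero (Finsupp.mem_support_iff.1 hν')
      refine hne (eq_of_le_of_card (le_iff_rowLen_le.2 fun i => ?_) (by omega))
      rw [hr]
      simp only [f]
      split_ifs with hi
      · exact (h1 i).1
      · rw [rowLen_zero_of_le g1 (not_lt.1 hi)]
    · intro h0
      rw [Finsupp.notMem_support_iff.1 h0, zero_mul]

/-- The statistic `∑ i lam_i`, the rows being counted from `0`. -/
def rowWeight (lam : YoungDiagram) : ℕ := ∑ c ∈ lam.cells, c.1

theorem rowWeight_eq {lam : YoungDiagram} {N : ℕ} (h : lam.rowLen N = 0) :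
    rowWeight lam = ∑ i ∈ Finset.range N, i * lam.rowLen i := by
  have hmem : ∀ c ∈ lam.cells, c.1 ∈ Finset.range N := by
    rintro ⟨i, j⟩ hc
    rw [Finset.mem_range]
    by_contra hcon
    have h1 := YoungDiagram.mem_iff_lt_rowLen.1 ((YoungDiagram.mem_cells _).1 hc)
    have h2 := lam.rowLen_anti N i (not_lt.1 hcon)
    omega
  rw [rowWeight, ← Finset.sum_fiberwise_of_maps_to hmem]
  refine Finset.sum_congr rfl fun i _ => ?_
  rw [YoungDiagram.rowLen_eq_card, YoungDiagram.row, mul_comm, ← smul_eq_mul,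
    ← Finset.sum_const]
  exact Finset.sum_congr rfl fun c hc => (Finset.mem_filter.1 hc).2

theorem kostka_rowLens_ne_zero {lam μ : YoungDiagram} (h : kostka lam.rowLens μ ≠ 0) :
    μ.card = lam.card ∧ (μ = lam ∨ rowWeight μ < rowWeight lam) := by
  have hz := rowLen_eq_zero (le_refl (lam.colLen 0))
  obtain ⟨h1, h2, h3, h4⟩ := kostka_ne_zero h
  rw [← card_eq_sum_rowLen hz] at h2
  rw [← rowWeight_eq h1, ← rowWeight_eq hz] at h3 h4
  refine ⟨h2, ?_⟩
  rcases h3.lt_or_eq with h3 | h3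
  · exact Or.inr h3
  · refine Or.inl (ext_rowLen fun i => ?_)
    by_cases hi : i < lam.colLen 0
    · exact h4 h3 i hi
    · rw [rowLen_zero_of_le h1 (not_lt.1 hi), rowLen_zero_of_le hz (not_lt.1 hi)]

theorem kostka_rowLens_self (lam : YoungDiagram) : kostka lam.rowLens lam = 1 :=
  kostka_self (rowLen_eq_zero le_rfl)

theorem schur_mem_span (lam : YoungDiagram) :
    schur lam ∈ Submodule.span ℤ {f | ∃ α : List ℕ, α.sum = lam.card ∧ f = hList α} := by
  induction h : rowWeight lam using Nat.strong_induction_on generalizing lam with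
  | _ n ih =>
    subst h
    have h1 : hList lam.rowLens = schur lam +
        ∑ μ ∈ (kostka lam.rowLens).support.erase lam, kostka lam.rowLens μ • schur μ := by
      rw [hList_eq, schurMap, Finsupp.linearCombination_apply, Finsupp.sum,
        ← Finset.add_sum_erase _ _ (Finsupp.mem_support_iff.2
          (by rw [kostka_rowLens_self]; exact one_ne_zero)), kostka_rowLens_self, one_smul]
    rw [eq_sub_of_add_eq h1.symm]
    refine Submodule.sub_mem _ (Submodule.subset_span ⟨_, ?_, rfl⟩)
      (Submodule.sum_mem _ fun μ hμ => Submodule.smul_mem _ _ ?_)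
    · rw [card_eq_sum_rowLen (rowLen_eq_zero (le_refl (lam.colLen 0)))]
      rfl
    · rw [Finset.mem_erase, Finsupp.mem_support_iff] at hμ
      obtain ⟨g1, g2⟩ := kostka_rowLens_ne_zero hμ.2
      rw [← g1]
      exact ih _ (g2.resolve_left hμ.1) μ rfl

end Kostka

/-! ### The linear map `χ_P` -/

section Chi

/-- The monomial `x_1^{lam_1} x_2^{lam_2} ⋯`. -/
def rowMonomial (lam : YoungDiagram) : ℕ+ →₀ ℕ :=
  Finsupp.onFinset (Finset.Icc 1 (lam.colLen 0).succPNat) (fun i => lam.rowLen i.natPred) (by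
    intro i hi
    rw [Finset.mem_Icc]
    refine ⟨one_le, ?_⟩
    by_contra hcon
    refine hi (rowLen_eq_zero ?_)
    rw [not_le, ← PNat.coe_lt_coe, Nat.succPNat_coe] at hcon
    have := i.natPred_add_one
    omega)

theorem expo_rowMonomial (lam : YoungDiagram) : expo (rowMonomial lam) = lam.rowLen := by
  funext m
  simp [expo, rowMonomial]

theorem coeff_schur_rowMonomial (lam μ : YoungDiagram) :
    MvPowerSeries.coeff (rowMonomial lam) (schur μ) = kostka lam.rowLens μ := by
  rw [coeff_schur μ _ (N := lam.colLen 0), expo_rowMonomial]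
  · rfl
  · intro i hi
    refine rowLen_eq_zero ?_
    have := i.natPred_add_one
    omega

/-- The Schur functions are linearly independent. -/
theorem schurMap_injective : Function.Injective schurMap := by
  rw [injective_iff_map_eq_zero]
  intro f hf
  by_contra hne
  -- by triangularity, the monomial of a partition `lam` of minimal weight occurs in no other term
  obtain ⟨lam, hlam, hmin⟩ := Finset.exists_min_image f.support rowWeight
    (Finsupp.support_nonempty_iff.2 hne)
  have h := congrArg (MvPowerSeries.coeff (rowMonomial lam)) hf
  rw [schurMap, Finsupp.linearCombination_apply, Finsupp.sum, map_sum, map_zero,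
    Finset.sum_eq_single lam] at h
  · rw [map_smul, coeff_schur_rowMonomial, kostka_rowLens_self, smul_eq_mul, mul_one] at h
    exact Finsupp.mem_support_iff.1 hlam h
  · intro μ hμ hne
    rw [map_smul, coeff_schur_rowMonomial]
    by_contra hcon
    rcases (kostka_rowLens_ne_zero (right_ne_zero_of_mul hcon)).2 with h | h
    · exact hne h
    · exact absurd (hmin μ hμ) (not_le.2 h)
  · intro h; exact absurd hlam h

theorem upOp_comm (m n : ℕ) : upOp m * upOp n = upOp n * upOp m := by
  refine LinearMap.ext fun f => schurMap_injective ?_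
  rw [Module.End.mul_apply, Module.End.mul_apply, ← hSym_mul_schurMap, ← hSym_mul_schurMap,
    ← hSym_mul_schurMap, ← hSym_mul_schurMap, mul_left_comm]

theorem schur_mem (lam : YoungDiagram) : schur lam ∈ Λ := by
  have h := schur_mem_span lam
  generalize schur lam = x at h
  induction h using Submodule.span_induction with
  | mem x hx =>
    obtain ⟨α, -, rfl⟩ := hx
    exact hList_mem α
  | zero => exact zero_mem _
  | add x y _ _ hx hy => exact add_mem hx hy
  | smul a x _ hx => exact zsmul_mem hx a

/-- `Λ` is the additive group that is generated by the `h_α`. -/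
theorem Λ_induction {p : Series → Prop} (hL : ∀ α, p (hList α)) (h0 : p 0)
    (hadd : ∀ x y, p x → p y → p (x + y)) (hneg : ∀ x, p x → p (-x)) {x : Series}
    (hx : x ∈ Λ) : p x := by
  have key : x ∈ AddSubgroup.closure (Set.range hList) := by
    have hone : (1 : Series) ∈ AddSubgroup.closure (Set.range hList) :=
      AddSubgroup.subset_closure ⟨[], by simp [hList]⟩
    have hmul : ∀ α, ∀ y ∈ AddSubgroup.closure (Set.range hList),
        hList α * y ∈ AddSubgroup.closure (Set.range hList) := by
      intro α y hy
      induction hy using AddSubgroup.closure_induction with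
      | mem y hy =>
        obtain ⟨β, rfl⟩ := hy
        exact AddSubgroup.subset_closure ⟨α ++ β, by simp [hList]⟩
      | zero => rw [mul_zero]; exact zero_mem _
      | add y z _ _ hy hz => rw [mul_add]; exact add_mem hy hz
      | neg y _ hy => rw [mul_neg]; exact neg_mem hy
    induction hx using Algebra.adjoin_induction with
    | mem x hx =>
      obtain ⟨n, rfl⟩ := hx
      exact AddSubgroup.subset_closure ⟨[n], by simp [hList]⟩
    | algebraMap r =>
      have := zsmul_mem hone r
      rw [zsmul_one] at this
      exact (eq_intCast (algebraMap ℤ Series) r).symm ▸ this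
    | add x y _ _ hx hy => exact add_mem hx hy
    | mul x y h h' hx hy =>
      clear h h'
      induction hx using AddSubgroup.closure_induction with
      | mem x hx =>
        obtain ⟨α, rfl⟩ := hx
        exact hmul α y hy
      | zero => rw [zero_mul]; exact zero_mem _
      | add x z _ _ hx hz => rw [add_mul]; exact add_mem hx hz
      | neg x _ hx => rw [neg_mul]; exact neg_mem hx
  clear hx
  induction key using AddSubgroup.closure_induction with
  | mem x hx =>
    obtain ⟨α, rfl⟩ := hx
    exact hL α
  | zero => exact h0
  | add x y _ _ hx hy => exact hadd x y hx hy
  | neg x _ hx => exact hneg x hx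

theorem mem_range_schurMap {x : Series} (hx : x ∈ Λ) : ∃ f, schurMap f = x := by
  refine Λ_induction (p := fun x => ∃ f, schurMap f = x) (fun α => ⟨kostka α, (hList_eq α).symm⟩)
    ⟨0, map_zero _⟩ ?_ ?_ hx
  · rintro _ _ ⟨f, rfl⟩ ⟨g, rfl⟩
    exact ⟨f + g, map_add _ _ _⟩
  · rintro _ ⟨f, rfl⟩
    exact ⟨-f, map_neg _ _⟩

/-- Linear maps on `Λ` that agree on all `h_α` are equal. -/
theorem linearMap_ext {χ ψ : Λ →ₗ[ℤ] ℤ}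
    (h : ∀ α, χ ⟨hList α, hList_mem α⟩ = ψ ⟨hList α, hList_mem α⟩) : χ = ψ := by
  refine LinearMap.ext fun x => ?_
  obtain ⟨x, hx⟩ := x
  obtain ⟨hx', h'⟩ := Λ_induction (p := fun y => ∃ hy : y ∈ Λ, χ ⟨y, hy⟩ = ψ ⟨y, hy⟩)
    (fun α => ⟨hList_mem α, h α⟩) ⟨zero_mem _, (map_zero χ).trans (map_zero ψ).symm⟩ (by
      rintro y z ⟨hy, ey⟩ ⟨hz, ez⟩
      refine ⟨add_mem hy hz, ?_⟩
      have : (⟨y + z, add_mem hy hz⟩ : Λ) = ⟨y, hy⟩ + ⟨z, hz⟩ := rfl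
      rw [this, map_add, map_add, ey, ez]) (by
      rintro y ⟨hy, ey⟩
      refine ⟨neg_mem hy, ?_⟩
      have : (⟨-y, neg_mem hy⟩ : Λ) = -⟨y, hy⟩ := rfl
      rw [this, map_neg, map_neg, ey]) hx
  exact h'

/-- Up to the order of the parts and to zeros, `α` is the list of the row lengths of a diagram. -/
theorem exists_perm_rowLens (α : List ℕ) :
    ∃ (k : ℕ) (lam : YoungDiagram), α.Perm (List.replicate k 0 ++ lam.rowLens) := by
  let β := (α.filter (· ≠ 0)).mergeSort (· ≥ ·)
  have hp : β.Perm (α.filter (· ≠ 0)) := List.mergeSort_perm _ _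
  have hs : β.SortedGE := by
    refine List.Pairwise.sortedGE ?_
    have := List.pairwise_mergeSort (le := fun a b : ℕ => decide (a ≥ b))
      (fun a b c h1 h2 => by simp at *; omega) (fun a b => by simp; omega) (α.filter (· ≠ 0))
    exact this.imp fun h => of_decide_eq_true h
  have hpos : ∀ x ∈ β, 0 < x := by
    intro x hx
    have := (hp.mem_iff).1 hx
    simp at this
    omega
  refine ⟨(α.filter (· = 0)).length, YoungDiagram.ofRowLens β hs, ?_⟩
  rw [YoungDiagram.rowLens_ofRowLens_eq_self hpos]
  have h1 : α.filter (· = 0) = List.replicate (α.filter (· = 0)).length 0 := by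
    rw [List.eq_replicate_iff]
    exact ⟨rfl, fun b hb => by simpa using (List.mem_filter.1 hb).2⟩
  rw [← h1]
  have h2 := List.filter_append_perm (fun x : ℕ => decide (x = 0)) α
  refine h2.symm.trans (List.Perm.append_left _ ?_)
  refine List.Perm.trans ?_ hp.symm
  simp

/-- There is a linear map on `Λ` with given values on the `h_α`, if these do not depend on the
order of `α` and on zero parts. -/
theorem exists_linearMap (g : List ℕ → ℤ) (h1 : ∀ α β : List ℕ, α.Perm β → g α = g β)
    (h2 : ∀ α, g (0 :: α) = g α) :
    ∃ χ : Λ →ₗ[ℤ] ℤ, ∀ α, χ ⟨hList α, hList_mem α⟩ = g α := by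
  -- by triangularity, there are values of `χ (S_lam)` that yield the right `χ (h_lam)`
  have hc : ∃ c : YoungDiagram → ℤ, ∀ lam, c lam = g lam.rowLens -
      ∑ μ ∈ (kostka lam.rowLens).support.erase lam, kostka lam.rowLens μ * c μ := by
    let W : WellFoundedRelation YoungDiagram := measure rowWeight
    have hdec : ∀ lam, ∀ μ ∈ (kostka lam.rowLens).support.erase lam,
        rowWeight μ < rowWeight lam := by
      intro lam μ hμ
      rw [Finset.mem_erase, Finsupp.mem_support_iff] at hμ
      exact (kostka_rowLens_ne_zero hμ.2).2.resolve_left hμ.1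
    let F : ∀ lam, (∀ μ, rowWeight μ < rowWeight lam → ℤ) → ℤ := fun lam ih =>
      g lam.rowLens - ∑ μ ∈ ((kostka lam.rowLens).support.erase lam).attach,
        kostka lam.rowLens μ.1 * ih μ.1 (hdec lam μ.1 μ.2)
    refine ⟨(measure rowWeight).wf.fix F, fun lam => ?_⟩
    rw [WellFounded.fix_eq]
    simp only [F]
    rw [← Finset.sum_attach ((kostka lam.rowLens).support.erase lam)]
  obtain ⟨c, hc⟩ := hc
  have key : ∀ lam : YoungDiagram,
      Finsupp.linearCombination ℤ c (kostka lam.rowLens) = g lam.rowLens := by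
    intro lam
    rw [Finsupp.linearCombination_apply, Finsupp.sum,
      ← Finset.add_sum_erase _ _ (Finsupp.mem_support_iff.2
        (by rw [kostka_rowLens_self]; exact one_ne_zero)), kostka_rowLens_self, one_smul, hc lam]
    simp
  choose f hf using fun x : Λ => mem_range_schurMap x.2
  have hf' : ∀ x g, schurMap g = x.1 → f x = g := fun x g h =>
    schurMap_injective ((hf x).trans h.symm)
  refine ⟨(Finsupp.linearCombination ℤ c) ∘ₗ
    { toFun := f
      map_add' := fun x y => hf' _ _ (by rw [map_add, hf, hf]; rfl)
      map_smul' := fun a x => hf' _ _ (by rw [map_smul, hf]; rfl) }, fun α => ?_⟩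
  obtain ⟨k, lam, hp⟩ := exists_perm_rowLens α
  have hg : g α = g lam.rowLens := by
    rw [h1 _ _ hp]
    clear hp
    induction k with
    | zero => rfl
    | succ k ih => rw [List.replicate_succ, List.cons_append, h2, ih]
  have h0 : hSym 0 = 1 := by
    refine MvPowerSeries.ext fun d => ?_
    rw [MvPowerSeries.coeff_one]
    change (if d.degree = 0 then (1 : ℤ) else 0) = _
    simp only [Finsupp.degree_eq_zero_iff]
  have hh : hList α = hList lam.rowLens := by
    rw [hList, hList, (hp.map hSym).prod_eq]
    simp [h0]
  rw [hg, ← key]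
  change Finsupp.linearCombination ℤ c (f ⟨hList α, hList_mem α⟩) = _
  exact congrArg _ (hf' ⟨hList α, hList_mem α⟩ _ (hh.trans (hList_eq _)).symm)

namespace LabeledPoset

variable {P : LabeledPoset.{u}}

theorem H_zero_cons (α : List ℕ) : P.H (0 :: α) = P.H α := by
  have : partialSums (0 :: α) = partialSums α := by
    ext n
    constructor
    · rintro ⟨i, rfl⟩
      cases i with
      | zero => exact ⟨0, by simp⟩
      | succ i => exact ⟨i, by simp⟩
    · rintro ⟨i, rfl⟩
      exact ⟨i + 1, by simp⟩
  simp [H, this]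

theorem existsUnique_isChi (hP : P.IsSymmetric) : ∃! χ, P.IsChi χ := by
  obtain ⟨χ, hχ⟩ := exists_linearMap (fun α => ((P.H α).ncard : ℤ))
    (fun α β h => by rw [hP.2 α β h]) (fun α => by rw [H_zero_cons])
  exact ⟨χ, hχ, fun ψ hψ => linearMap_ext fun α => (hψ α).trans (hχ α).symm⟩

theorem chi_hList (hP : P.IsSymmetric) (α : List ℕ) :
    P.chi ⟨hList α, hList_mem α⟩ = ((P.H α).ncard : ℤ) := by
  have h : ∃ χ, P.IsChi χ := (existsUnique_isChi hP).exists
  rw [chi, dif_pos h]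
  exact h.choose_spec α

theorem H_eq_empty (hP : P.IsSymmetric) {α : List ℕ} (h : α.sum ≠ P.rank) : P.H α = ∅ := by
  ext c
  simp only [Set.mem_empty_iff_false, iff_false]
  rintro ⟨h1, -⟩
  rw [MaxChain.word, List.length_ofFn, hP.1 c] at h1
  exact h h1.symm

/-- The coefficients of `S_P` are the numbers of the chains in the sets `H_α`. This is dual to
`h_α = ∑ K_{lam, α} S_lam`, as `K_{lam, α}` is also a coefficient of `S_lam`. -/
theorem coeff_S (hP : P.IsSymmetric) (d : ℕ+ →₀ ℕ) {N : ℕ} (hN : ∀ i : ℕ+, N < i → d i = 0) :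
    MvPowerSeries.coeff d P.S = ((P.H ((List.range N).map (expo d))).ncard : ℤ) := by
  set α := (List.range N).map (expo d) with hα
  have h1 : MvPowerSeries.coeff d P.S =
      ∑ lam ∈ partitions P.rank, P.chi ⟨schur lam, schur_mem lam⟩ * kostka α lam := by
    rw [S, map_sum]
    refine Finset.sum_congr rfl fun lam _ => ?_
    rw [map_smul, coeff_schur lam d hN, skewCoeff, dif_pos (schur_mem lam), smul_eq_mul]
  have h2 : (⟨hList α, hList_mem α⟩ : Λ) =
      ∑ lam ∈ (kostka α).support, kostka α lam • ⟨schur lam, schur_mem lam⟩ := by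
    apply Subtype.ext
    rw [AddSubmonoidClass.coe_finsetSum]
    change hList α = _
    rw [hList_eq, schurMap, Finsupp.linearCombination_apply, Finsupp.sum]
    rfl
  have hsum : ∀ lam, kostka α lam ≠ 0 → lam.card = α.sum := by
    intro lam h
    rw [(kostka_ne_zero h).2.1, hα]
    rfl
  by_cases hr : α.sum = P.rank
  · rw [h1, ← chi_hList hP, h2, map_sum]
    symm
    rw [Finset.sum_congr rfl fun lam _ => by rw [map_smul, smul_eq_mul, mul_comm]]
    refine Finset.sum_subset (fun lam h => ?_) fun lam _ h => ?_
    · rw [mem_partitions, hsum lam (Finsupp.mem_support_iff.1 h), hr]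
    · rw [Finsupp.notMem_support_iff.1 h, mul_zero]
  · rw [h1, H_eq_empty hP hr, Set.ncard_empty]
    refine Finset.sum_eq_zero fun lam hlam => ?_
    by_contra hcon
    refine hr ?_
    rw [← hsum lam (right_ne_zero_of_mul hcon)]
    exact mem_partitions.1 hlam

end LabeledPoset

end Chi

/-! ### The length of a permutation times a transposition -/

namespace SInf

theorem ext_apply {v w : SInf} (h : ∀ i, v.1 i = w.1 i) : v = w :=
  Subtype.ext (Equiv.ext h)

theorem mul_apply (v w : SInf) (i : ℕ+) : (v * w).1 i = v.1 (w.1 i) := rfl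

theorem swap_apply (a b i : ℕ+) : (swap a b).1 i = Equiv.swap a b i := rfl

theorem apply_inv (u : SInf) (a : ℕ+) : u.1 (u.1⁻¹ a) = a := Equiv.apply_symm_apply u.1 a

theorem inv_apply (u : SInf) (a : ℕ+) : u.1⁻¹ (u.1 a) = a := Equiv.symm_apply_apply u.1 a

theorem inv_apply' (u : SInf) (a : ℕ+) : (u⁻¹).1 a = u.1⁻¹ a := rfl

theorem swap_mul_self (a b : ℕ+) : swap a b * swap a b = 1 :=
  ext_apply fun i => by
    rw [mul_apply, swap_apply, swap_apply, Equiv.swap_apply_self]; rfl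

theorem swap_inv (a b : ℕ+) : (swap a b)⁻¹ = swap a b :=
  inv_eq_of_mul_eq_one_left (swap_mul_self a b)

theorem mul_swap_eq (u : SInf) (p q : ℕ+) : u * swap p q = swap (u.1 p) (u.1 q) * u :=
  ext_apply fun i => by
    rw [mul_apply, mul_apply, swap_apply, swap_apply]
    rw [Equiv.swap_apply_apply]
    simp [Equiv.Perm.mul_apply]

theorem swap_mul_eq (u : SInf) (a b : ℕ+) : swap a b * u = u * swap (u.1⁻¹ a) (u.1⁻¹ b) := by
  rw [mul_swap_eq, apply_inv, apply_inv]

theorem inv_swap_mul (u : SInf) (a b c : ℕ+) :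
    (swap a b * u).1⁻¹ c = u.1⁻¹ (Equiv.swap a b c) := by
  rw [Equiv.Perm.inv_eq_iff_eq, mul_apply, apply_inv, swap_apply, Equiv.swap_apply_self]

section LenSwap

variable {u : SInf} {p q : ℕ+}

/-- The injection of the inversions of `u` into those of `u (p, q)`. -/
def invMap (p q : ℕ+) (x : ℕ+ × ℕ+) : ℕ+ × ℕ+ :=
  if Equiv.swap p q x.1 < Equiv.swap p q x.2 then (Equiv.swap p q x.1, Equiv.swap p q x.2) else x

/-- The pairs whose order is reversed by the transposition of `p` and `q`. -/
theorem swap_reverses (hpq : p < q) {i j : ℕ+} (hij : i < j)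
    (h : ¬ Equiv.swap p q i < Equiv.swap p q j) :
    (i = p ∧ j = q) ∨ (i = p ∧ p < j ∧ j < q) ∨ (j = q ∧ p < i ∧ i < q) := by
  simp only [Equiv.swap_apply_def] at h
  grind

/-- The inversions of `u (p, q)` other than `(p, q)` contain the images of those of `u`; by
`invMap_injOn`, the difference of the lengths is thus one more than the number of the others. -/
theorem invMap_mem (hpq : p < q) (hu : u.1 p < u.1 q) {x : ℕ+ × ℕ+} (hx : x ∈ u.inversions) :
    invMap p q x ∈ (u * swap p q).inversions \ {(p, q)} := by
  obtain ⟨i, j⟩ := x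
  obtain ⟨hij, hinv⟩ := hx
  simp only at hij hinv
  unfold invMap
  split_ifs with h
  · refine ⟨⟨h, ?_⟩, ?_⟩
    · simpa only [mul_apply, swap_apply, Equiv.swap_apply_self] using hinv
    · intro hcon
      simp only [Set.mem_singleton_iff, Prod.mk.injEq, Equiv.swap_apply_eq_iff,
        Equiv.swap_apply_left, Equiv.swap_apply_right] at hcon
      rw [hcon.1, hcon.2] at hij
      exact lt_asymm hij hpq
  · rcases swap_reverses hpq hij h with ⟨rfl, rfl⟩ | ⟨rfl, h1, h2⟩ | ⟨rfl, h1, h2⟩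
    · exact absurd hu (lt_asymm hinv)
    · refine ⟨⟨hij, ?_⟩, fun hcon => h2.ne (congrArg Prod.snd hcon)⟩
      simp only [mul_apply, swap_apply, Equiv.swap_apply_left]
      rw [Equiv.swap_apply_of_ne_of_ne h1.ne' h2.ne]
      exact hinv.trans hu
    · refine ⟨⟨hij, ?_⟩, fun hcon => h1.ne' (congrArg Prod.fst hcon)⟩
      simp only [mul_apply, swap_apply, Equiv.swap_apply_right]
      rw [Equiv.swap_apply_of_ne_of_ne h1.ne' h2.ne]
      exact hu.trans hinv

theorem invMap_injOn : Set.InjOn (invMap p q) u.inversions := by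
  rintro ⟨i, j⟩ ⟨hij, -⟩ ⟨i', j'⟩ ⟨hij', -⟩ h
  simp only at hij hij'
  unfold invMap at h
  split_ifs at h with h1 h2 h2
  · simpa using h
  · simp only [Prod.mk.injEq] at h
    rw [← h.1, ← h.2, Equiv.swap_apply_self, Equiv.swap_apply_self] at h2
    exact absurd hij h2
  · simp only [Prod.mk.injEq] at h
    rw [h.1, h.2, Equiv.swap_apply_self, Equiv.swap_apply_self] at h1
    exact absurd hij' h1
  · exact h

theorem mem_inversions_mul_swap (hpq : p < q) (hu : u.1 p < u.1 q) :
    (p, q) ∈ (u * swap p q).inversions :=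
  ⟨hpq, by simpa only [mul_apply, swap_apply, Equiv.swap_apply_left, Equiv.swap_apply_right]⟩

theorem len_mul_swap_eq (hpq : p < q) (hu : u.1 p < u.1 q) :
    (u * swap p q).len = ((u * swap p q).inversions \ {(p, q)}).ncard + 1 :=
  (Set.ncard_sdiff_singleton_add_one (mem_inversions_mul_swap hpq hu) (finite_inversions _)).symm

theorem len_lt_len_mul_swap (hpq : p < q) (hu : u.1 p < u.1 q) :
    u.len < (u * swap p q).len := by
  rw [len_mul_swap_eq hpq hu]
  exact Nat.lt_succ_of_le (Set.ncard_le_ncard_of_injOn _ (fun x => invMap_mem hpq hu) invMap_injOn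
    ((finite_inversions _).subset Set.sdiff_subset))

/-- `u (p, q)` is of length `ℓ(u) + 1` if and only if no value between `u p` and `u q` stands
between them: with such a value at the position `r`, the pair `(p, r)` is a further inversion. -/
theorem len_mul_swap_iff (hpq : p < q) (hu : u.1 p < u.1 q) :
    (u * swap p q).len = u.len + 1 ↔
      ∀ r, p < r → r < q → ¬ (u.1 p < u.1 r ∧ u.1 r < u.1 q) := by
  have hfin : ((u * swap p q).inversions \ {(p, q)}).Finite :=
    (finite_inversions _).subset Set.sdiff_subset
  have hmaps : invMap p q '' u.inversions ⊆ (u * swap p q).inversions \ {(p, q)} := by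
    rintro _ ⟨x, hx, rfl⟩
    exact invMap_mem hpq hu hx
  have hcard : (invMap p q '' u.inversions).ncard = u.len := Set.InjOn.ncard_image invMap_injOn
  rw [len_mul_swap_eq hpq hu, Nat.add_right_cancel_iff, ← hcard]
  constructor
  · intro h r h1 h2 ⟨h3, h4⟩
    have heq := Set.eq_of_subset_of_ncard_le hmaps h.le hfin
    have hmem : (p, r) ∈ (u * swap p q).inversions \ {(p, q)} := by
      refine ⟨⟨h1, ?_⟩, fun hcon => h2.ne (congrArg Prod.snd hcon)⟩
      simp only [mul_apply, swap_apply, Equiv.swap_apply_left]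
      rwa [Equiv.swap_apply_of_ne_of_ne h1.ne' h2.ne]
    rw [← heq] at hmem
    obtain ⟨⟨i, j⟩, ⟨hij, hinv⟩, hx⟩ := hmem
    simp only at hij hinv
    unfold invMap at hx
    split_ifs at hx
    · simp only [Prod.mk.injEq, Equiv.swap_apply_eq_iff, Equiv.swap_apply_left,
        Equiv.swap_apply_of_ne_of_ne h1.ne' h2.ne] at hx
      rw [hx.1, hx.2] at hij
      exact lt_asymm hij h2
    · simp only [Prod.mk.injEq] at hx
      rw [hx.1, hx.2] at hinv
      exact lt_asymm hinv h3
  · intro h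
    rw [Set.Subset.antisymm hmaps]
    rintro ⟨i, j⟩ ⟨⟨hij, hinv⟩, hne⟩
    simp only [mul_apply, swap_apply] at hij hinv
    by_cases hlt : Equiv.swap p q i < Equiv.swap p q j
    · refine ⟨(Equiv.swap p q i, Equiv.swap p q j), ⟨hlt, hinv⟩, ?_⟩
      unfold invMap
      simp only [Equiv.swap_apply_self]
      rw [if_pos hij]
    · refine ⟨(i, j), ⟨hij, ?_⟩, if_neg hlt⟩
      rcases swap_reverses hpq hij hlt with ⟨rfl, rfl⟩ | ⟨rfl, h1, h2⟩ | ⟨rfl, h1, h2⟩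
      · exact absurd rfl hne
      · rw [Equiv.swap_apply_left, Equiv.swap_apply_of_ne_of_ne h1.ne' h2.ne] at hinv
        refine lt_of_le_of_ne (not_lt.1 fun hcon => h j h1 h2 ⟨hcon, hinv⟩) fun hcon => ?_
        exact h1.ne (u.1.injective hcon.symm)
      · rw [Equiv.swap_apply_right, Equiv.swap_apply_of_ne_of_ne h1.ne' h2.ne] at hinv
        refine lt_of_le_of_ne (not_lt.1 fun hcon => h i h1 h2 ⟨hinv, hcon⟩) fun hcon => ?_
        exact h2.ne (u.1.injective hcon.symm)

end LenSwap

theorem len_lt_len_swap_mul {u : SInf} {a b : ℕ+} (hab : a < b) (h : u.1⁻¹ a < u.1⁻¹ b) :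
    u.len < (swap a b * u).len := by
  rw [swap_mul_eq]
  exact len_lt_len_mul_swap h (by rwa [apply_inv, apply_inv])

theorem len_swap_mul_iff {u : SInf} {a b : ℕ+} (hab : a < b) (h : u.1⁻¹ a < u.1⁻¹ b) :
    (swap a b * u).len = u.len + 1 ↔
      ∀ c, a < c → c < b → ¬ (u.1⁻¹ a < u.1⁻¹ c ∧ u.1⁻¹ c < u.1⁻¹ b) := by
  rw [swap_mul_eq, len_mul_swap_iff h (by rwa [apply_inv, apply_inv]), apply_inv, apply_inv]
  constructor
  · intro H c h1 h2 ⟨h3, h4⟩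
    exact H _ h3 h4 (by rw [apply_inv]; exact ⟨h1, h2⟩)
  · intro H r h1 h2 ⟨h3, h4⟩
    exact H (u.1 r) h3 h4 (by rw [inv_apply]; exact ⟨h1, h2⟩)

theorem inv_lt_of_len_lt {u : SInf} {a b : ℕ+} (hab : a < b) (h : u.len < (swap a b * u).len) :
    u.1⁻¹ a < u.1⁻¹ b := by
  by_contra hcon
  have hne : u.1⁻¹ b ≠ u.1⁻¹ a := fun h => hab.ne' ((u.1⁻¹).injective h)
  have h1 := len_lt_len_swap_mul (u := swap a b * u) hab (by
    rw [inv_swap_mul, inv_swap_mul, Equiv.swap_apply_left, Equiv.swap_apply_right]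
    exact lt_of_le_of_ne (not_lt.1 hcon) hne)
  rw [← mul_assoc, swap_mul_self, one_mul] at h1
  exact lt_asymm h h1

theorem lt_add_one (i : ℕ+) : i < i + 1 := PNat.lt_add_right i 1

theorem len_mul_s {u : SInf} {i : ℕ+} (h : u.1 i < u.1 (i + 1)) :
    (u * s i).len = u.len + 1 :=
  (len_mul_swap_iff (lt_add_one i) h).2 fun _ h1 h2 =>
    absurd (PNat.add_one_le_iff.2 h1) (not_le.2 h2)

theorem mul_s_mul_s (u : SInf) (i : ℕ+) : u * s i * s i = u := by
  rw [mul_assoc, s, swap_mul_self, mul_one]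

theorem mul_s_apply_left (u : SInf) (i : ℕ+) : (u * s i).1 i = u.1 (i + 1) := by
  rw [mul_apply, s, swap_apply, Equiv.swap_apply_left]

theorem mul_s_apply_right (u : SInf) (i : ℕ+) : (u * s i).1 (i + 1) = u.1 i := by
  rw [mul_apply, s, swap_apply, Equiv.swap_apply_right]

theorem mul_s_apply_of_ne (u : SInf) {i j : ℕ+} (h1 : j ≠ i) (h2 : j ≠ i + 1) :
    (u * s i).1 j = u.1 j := by
  rw [mul_apply, s, swap_apply, Equiv.swap_apply_of_ne_of_ne h1 h2]

theorem len_eq_len_mul_s_add_one {u : SInf} {i : ℕ+} (h : u.1 (i + 1) < u.1 i) :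
    u.len = (u * s i).len + 1 := by
  have := len_mul_s (u := u * s i) (i := i) (by rwa [mul_s_apply_left, mul_s_apply_right])
  rwa [mul_s_mul_s] at this

theorem apply_lt_or (u : SInf) (i : ℕ+) : u.1 i < u.1 (i + 1) ∨ u.1 (i + 1) < u.1 i :=
  lt_or_gt_of_ne fun h => (lt_add_one i).ne (u.1.injective h)

theorem len_s_mul {u : SInf} {i : ℕ+} (h : u.1⁻¹ i < u.1⁻¹ (i + 1)) :
    (s i * u).len = u.len + 1 :=
  (len_swap_mul_iff (lt_add_one i) h).2 fun _ h1 h2 =>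
    absurd (PNat.add_one_le_iff.2 h1) (not_le.2 h2)

theorem len_s_mul_eq_iff {u : SInf} {i : ℕ+} :
    (s i * u).len = u.len + 1 ↔ u.1⁻¹ i < u.1⁻¹ (i + 1) :=
  ⟨fun h => inv_lt_of_len_lt (lt_add_one i) (by unfold s at h; omega), len_s_mul⟩

theorem len_one : (1 : SInf).len = 0 := by
  have : (1 : SInf).inversions = ∅ := by
    ext ⟨a, b⟩
    simp only [Set.mem_empty_iff_false, iff_false]
    rintro ⟨h1, h2⟩
    exact lt_asymm h1 h2
  rw [len, this, Set.ncard_empty]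

/-- A permutation without descents is the identity. -/
theorem eq_one_of_forall_lt {u : SInf} (h : ∀ i, u.1 i < u.1 (i + 1)) : u = 1 := by
  have hm : StrictMono u.1 := by
    intro a b hab
    induction b using PNat.recOn with
    | one => exact absurd hab (not_lt.2 (one_le))
    | succ b ih =>
      rcases (PNat.lt_add_one_iff.1 hab).lt_or_eq with h' | rfl
      · exact (ih h').trans (h b)
      · exact h a
  have hm' : StrictMono (u.1⁻¹ : Equiv.Perm ℕ+) := fun a b hab =>
    hm.lt_iff_lt.1 (by rwa [apply_inv, apply_inv])
  refine ext_apply fun i => le_antisymm ?_ hm.le_apply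
  have h2 := hm.monotone (hm'.le_apply : i ≤ u.1⁻¹ i)
  rwa [apply_inv] at h2

theorem exists_descent {u : SInf} (h : u ≠ 1) : ∃ i, u.1 (i + 1) < u.1 i := by
  by_contra hcon
  push Not at hcon
  exact h (eq_one_of_forall_lt fun i => (u.apply_lt_or i).resolve_right (not_lt.2 (hcon i)))

/-- Induction along right multiplications by simple transpositions that raise the length. -/
theorem induction_len {p : SInf → Prop} (h1 : p 1)
    (hs : ∀ u i, u.1 i < u.1 (i + 1) → p u → p (u * s i)) (u : SInf) : p u := by
  induction hn : u.len using Nat.strong_induction_on generalizing u with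
  | _ n ih =>
    by_cases hu : u = 1
    · rw [hu]; exact h1
    · obtain ⟨i, hi⟩ := exists_descent hu
      have h2 := len_eq_len_mul_s_add_one hi
      have h3 := hs (u * s i) i (by rwa [mul_s_apply_left, mul_s_apply_right])
        (ih _ (by omega) _ rfl)
      rwa [mul_s_mul_s] at h3

theorem len_mul_s_le (u : SInf) (i : ℕ+) : (u * s i).len ≤ u.len + 1 := by
  rcases u.apply_lt_or i with h | h
  · exact (len_mul_s h).le
  · have := len_eq_len_mul_s_add_one h
    omega

theorem len_prod_le (a : List ℕ+) : (a.map s).prod.len ≤ a.length := by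
  induction a using List.reverseRecOn with
  | nil => simp [len_one]
  | append_singleton a i ih =>
    have := len_mul_s_le (a.map s).prod i
    simp only [List.map_append, List.prod_append, List.map_cons, List.map_nil, List.prod_cons,
      List.prod_nil, mul_one, List.length_append, List.length_cons, List.length_nil]
    omega

theorem isReducedWord_append_singleton {w : SInf} {a : List ℕ+} {i : ℕ+} :
    w.IsReducedWord (a ++ [i]) ↔ w.1 (i + 1) < w.1 i ∧ (w * s i).IsReducedWord a := by
  have hp : ((a ++ [i]).map s).prod = (a.map s).prod * s i := by simp
  constructor
  · rintro ⟨h1, h2⟩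
    rw [hp] at h1
    have h3 : (a.map s).prod = w * s i := by rw [← h1, mul_s_mul_s]
    have h4 := len_prod_le a
    rw [h3] at h4
    rw [List.length_append, List.length_singleton] at h2
    rcases w.apply_lt_or i with h | h
    · have := len_mul_s h
      omega
    · have := len_eq_len_mul_s_add_one h
      exact ⟨h, h3, by omega⟩
  · rintro ⟨h1, h2, h3⟩
    have := len_eq_len_mul_s_add_one h1
    refine ⟨by rw [hp, h2, mul_s_mul_s], ?_⟩
    rw [List.length_append, List.length_singleton, h3, this]

theorem exists_isReducedWord (w : SInf) : ∃ a, w.IsReducedWord a := by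
  induction w using induction_len with
  | h1 => exact ⟨[], rfl, len_one.symm⟩
  | hs u i h ih =>
    obtain ⟨a, ha⟩ := ih
    refine ⟨a ++ [i], isReducedWord_append_singleton.2 ⟨?_, ?_⟩⟩
    · rwa [mul_s_apply_left, mul_s_apply_right]
    · rwa [mul_s_mul_s]

end SInf

/-! ### Generating products in the nilCoxeter algebra -/

section NilCoxeter

variable {S : Type*} [Ring S]

/-- The product `(1 + x u_{n-1}) ⋯ (1 + x u_1) (1 + x u_0)`. -/
def genProd (u : ℕ → S) (x : S) : ℕ → S
  | 0 => 1
  | n + 1 => (1 + x * u n) * genProd u x n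

/-- The relations of the nilCoxeter algebra, for `u_0, …, u_{n-1}`. -/
structure NilCoxeter (u : ℕ → S) (n : ℕ) : Prop where
  sq : ∀ i < n, u i * u i = 0
  comm : ∀ i j, i + 1 < j → j < n → Commute (u i) (u j)
  braid : ∀ i, i + 1 < n → u i * u (i + 1) * u i = u (i + 1) * u i * u (i + 1)

variable {u : ℕ → S} {n : ℕ}

theorem NilCoxeter.mono (h : NilCoxeter u (n + 1)) : NilCoxeter u n where
  sq i hi := h.sq i (by omega)
  comm i j hij hj := h.comm i j hij (by omega)
  braid i hi := h.braid i (by omega)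

theorem commute_genProd {z x : S} (hx : Commute z x) (hu : ∀ i < n, Commute z (u i)) :
    Commute z (genProd u x n) := by
  induction n with
  | zero => exact Commute.one_right z
  | succ n ih =>
    exact ((Commute.one_right z).add_right (hx.mul_right (hu n (by omega)))).mul_right
      (ih fun i hi => hu i (by omega))

theorem central_mul_mul {y : S} (hy : ∀ z, Commute y z) (x a b : S) :
    x * a * (y * b) = x * y * (a * b) := by
  rw [mul_assoc, ← mul_assoc a, ← (hy a).eq, mul_assoc y, ← mul_assoc x]

theorem one_sub_mul_one_add {x : S} (hx : ∀ z, Commute x z) {a : S} (ha : a * a = 0) :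
    (1 - x * a) * (1 + x * a) = 1 := by
  have h : x * a * (x * a) = 0 := by rw [central_mul_mul hx, ha, mul_zero]
  rw [sub_mul, one_mul, mul_add, mul_one, h]
  abel

/-- The generating products for commuting parameters commute, by Fomin and Stanley. The product of
two of them is a product of shorter ones, multiplied by a factor that is symmetric in the two
parameters. -/
theorem genProd_comm {x y : S} (hx : ∀ z, Commute x z) (hy : ∀ z, Commute y z)
    (h : NilCoxeter u n) :
    genProd u x n * genProd u y n = genProd u y n * genProd u x n := by
  induction n with
  | zero => rfl
  | succ n ih =>
    cases n with
    | zero =>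
      simp only [genProd, mul_one]
      have : Commute (x * u 0) (y * u 0) :=
        ((hx _).mul_left ((hy _).symm.mul_right (Commute.refl _)))
      exact ((Commute.one_left _).add_left ((Commute.one_right _).add_right this)).eq
    | succ n =>
      have ih := ih h.mono
      -- the factors in front of `genProd u x (n + 1) * genProd u y (n + 1)`
      have step : ∀ {x y : S}, (∀ z, Commute x z) → (∀ z, Commute y z) →
          genProd u x (n + 2) * genProd u y (n + 2) =
            (1 + (x + y) * u (n + 1) + x * y * (u n * u (n + 1) - u (n + 1) * u n)) *
              (genProd u x (n + 1) * genProd u y (n + 1)) := by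
        intro x y hx hy
        have h1 : genProd u x n * (1 + y * u (n + 1)) = (1 + y * u (n + 1)) * genProd u x n := by
          refine (commute_genProd (hx _).symm fun i hi => ?_).eq.symm
          exact (Commute.one_left _).add_left ((hy _).mul_left
            (h.comm i (n + 1) (by omega) (by omega)).symm)
        have h2 : genProd u x n = (1 - x * u n) * genProd u x (n + 1) := by
          rw [genProd, ← mul_assoc, one_sub_mul_one_add hx (h.sq n (by omega)), one_mul]
        have hZ : (1 + x * u (n + 1)) * (1 + x * u n) * (1 + y * u (n + 1)) * (1 - x * u n) =
            1 + (x + y) * u (n + 1) + x * y * (u n * u (n + 1) - u (n + 1) * u n) := by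
          have e1 : x * u (n + 1) * (y * u (n + 1)) = 0 := by
            rw [central_mul_mul hy, h.sq _ (by omega), mul_zero]
          have e2 : x * u n * (x * u n) = 0 := by
            rw [central_mul_mul hx, h.sq _ (by omega), mul_zero]
          have e3 : x * u (n + 1) * (x * u n) * (y * u (n + 1)) =
              x * u n * (y * u (n + 1)) * (x * u n) := by
            rw [central_mul_mul hx, central_mul_mul hy, central_mul_mul hy, central_mul_mul hx,
              h.braid n (by omega), mul_assoc x x y, (hx y).eq,
              ← mul_assoc x y x, (hx y).eq]
          have e4 : x * u n * (y * u (n + 1)) - y * u (n + 1) * (x * u n) =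
              x * y * (u n * u (n + 1) - u (n + 1) * u n) := by
            rw [central_mul_mul hy, central_mul_mul hx, (hy x).eq, mul_sub]
          rw [← e4, add_mul x y]
          generalize x * u (n + 1) = p at *
          generalize y * u (n + 1) = q at *
          generalize x * u n = r at *
          have : (1 + p) * (1 + r) * (1 + q) * (1 - r) =
              1 + (p + q) + (r * q - q * r) + p * q * (1 - r) + (p * r * q - r * q * r)
                - p * r * q * r - r * r - p * (r * r) := by noncomm_ring
          rw [this, e1, e2, e3]
          have e5 : r * q * r * r = 0 := by rw [mul_assoc, e2, mul_zero]
          rw [e5]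
          noncomm_ring
        rw [← hZ]
        calc genProd u x (n + 2) * genProd u y (n + 2)
            = (1 + x * u (n + 1)) * (1 + x * u n) *
              (genProd u x n * (1 + y * u (n + 1))) * genProd u y (n + 1) := by
                simp only [genProd, mul_assoc]
          _ = _ := by
                rw [h1]
                nth_rewrite 1 [h2]
                simp only [mul_assoc]
      rw [step hx hy, step hy hx, ih, add_comm x y, (hx y).eq]

theorem labelPoly_append {ι : Type*} (U : ι → S) (L L' : List ι) :
    labelPoly U (L ++ L') = labelPoly U L' * labelPoly U L := by
  induction L with
  | nil => simp [labelPoly]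
  | cons b L ih => rw [List.cons_append, labelPoly, labelPoly, ih, mul_assoc]

theorem labelPoly_eq_genProd (U : ℕ → S) (n : ℕ) :
    labelPoly U (List.range n) = genProd (fun i => Polynomial.C (U i)) Polynomial.X n := by
  induction n with
  | zero => rfl
  | succ n ih =>
    rw [List.range_succ, labelPoly_append, ih, genProd, Polynomial.X_mul]
    simp [labelPoly]

theorem labelPoly_map {ι κ : Type*} (U : κ → S) (f : ι → κ) (L : List ι) :
    labelPoly U (L.map f) = labelPoly (fun i => U (f i)) L := by
  induction L with
  | nil => rfl
  | cons b L ih => rw [List.map_cons, labelPoly, labelPoly, ih]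

theorem genProd_map {T : Type*} [Ring T] (f : S →+* T) (x : S) (n : ℕ) :
    f (genProd u x n) = genProd (fun i => f (u i)) (f x) n := by
  induction n with
  | zero => simp [genProd]
  | succ n ih => simp only [genProd, map_mul, map_add, map_one, ih]

theorem NilCoxeter.map {T : Type*} [Ring T] (f : S →+* T) (h : NilCoxeter u n) :
    NilCoxeter (fun i => f (u i)) n where
  sq i hi := by rw [← map_mul, h.sq i hi, map_zero]
  comm i j hij hj := (h.comm i j hij hj).map f
  braid i hi := by simp only [← map_mul, h.braid i hi]

/-- The elements `∑ u_{b_k} ⋯ u_{b_1}`, `b_1 < ⋯ < b_k`, for different `k` commute with each other.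
-/
theorem coeff_labelPoly_comm (h : NilCoxeter u n) (k l : ℕ) :
    (labelPoly u (List.range n)).coeff k * (labelPoly u (List.range n)).coeff l =
      (labelPoly u (List.range n)).coeff l * (labelPoly u (List.range n)).coeff k := by
  set p := labelPoly u (List.range n) with hp
  -- the same polynomial in each of two central variables
  have e1 : Polynomial.C p =
      genProd (fun i => Polynomial.C (Polynomial.C (u i))) (Polynomial.C Polynomial.X) n := by
    rw [hp, labelPoly_eq_genProd, genProd_map]
  have e2 : p.map Polynomial.C =
      genProd (fun i => Polynomial.C (Polynomial.C (u i))) Polynomial.X n := by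
    rw [hp, labelPoly_eq_genProd, ← Polynomial.coe_mapRingHom, genProd_map]
    simp
  have key : Polynomial.C p * p.map Polynomial.C = p.map Polynomial.C * Polynomial.C p := by
    rw [e1, e2]
    refine genProd_comm (fun z => ?_) (fun z => Polynomial.commute_X z)
      (h.map (Polynomial.C.comp Polynomial.C))
    refine Polynomial.ext fun m => ?_
    rw [Polynomial.coeff_C_mul, Polynomial.coeff_mul_C, Polynomial.X_mul]
  have := congrArg (fun q => (q.coeff k).coeff l) key
  simp only [Polynomial.coeff_C_mul, Polynomial.coeff_mul_C, Polynomial.coeff_map] at this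
  exact this.symm

end NilCoxeter

/-! ### The generating function of the Schubert polynomials -/

section Generating

/-- The polynomial ring `ℤ[x_1, x_2, …]`. -/
abbrev Poly : Type := MvPolynomial ℕ+ ℤ

/-- The action of the nilCoxeter algebra on families of polynomials `f_w`: the component at `w`
of `U_i f` is `f_{w s_i}` if `w` has a descent at `i`, and `0` otherwise. -/
def nilAct (i : ℕ+) : Module.End Poly (SInf → Poly) where
  toFun f w := if w.1 (i + 1) < w.1 i then f (w * SInf.s i) else 0
  map_add' f g := by
    funext w
    simp only [Pi.add_apply]
    split_ifs <;> simp
  map_smul' a f := by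
    funext w
    simp only [Pi.smul_apply, RingHom.id_apply]
    split_ifs <;> simp

theorem nilAct_apply (i : ℕ+) (f : SInf → Poly) (w : SInf) :
    nilAct i f w = if w.1 (i + 1) < w.1 i then f (w * SInf.s i) else 0 := rfl

theorem succPNat_add_one (m : ℕ) : m.succPNat + 1 = (m + 1).succPNat := rfl

/-- The element `u_i` of the nilCoxeter algebra that stands at position `j` of the generating
product of `S_{n+1}`. -/
def nilRev (n j : ℕ) : Module.End Poly (SInf → Poly) := nilAct (n - 1 - j).succPNat

theorem nilAct_sq (i : ℕ+) : nilAct i * nilAct i = 0 := by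
  refine LinearMap.ext fun f => funext fun w => ?_
  rw [Module.End.mul_apply, nilAct_apply, nilAct_apply, SInf.mul_s_apply_left,
    SInf.mul_s_apply_right]
  split_ifs with h1 h2
  · exact absurd h2 (lt_asymm h1)
  · rfl
  · rfl

theorem s_comm {i j : ℕ+} (h : i + 1 < j) : SInf.s i * SInf.s j = SInf.s j * SInf.s i := by
  have h1 : i < j := (SInf.lt_add_one i).trans h
  refine SInf.ext_apply fun p => ?_
  simp only [SInf.mul_apply, SInf.s, SInf.swap_apply, Equiv.swap_apply_def]
  have h3 : i < i + 1 := SInf.lt_add_one i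
  have h4 : j < j + 1 := SInf.lt_add_one j
  grind

theorem s_braid (i : ℕ+) :
    SInf.s i * SInf.s (i + 1) * SInf.s i = SInf.s (i + 1) * SInf.s i * SInf.s (i + 1) := by
  refine SInf.ext_apply fun p => ?_
  simp only [SInf.mul_apply, SInf.s, SInf.swap_apply, Equiv.swap_apply_def]
  have h3 : i < i + 1 := SInf.lt_add_one i
  have h4 : i + 1 < i + 1 + 1 := SInf.lt_add_one (i + 1)
  grind

theorem nilAct_comm {i j : ℕ+} (h : i + 1 < j) : Commute (nilAct i) (nilAct j) := by
  refine LinearMap.ext fun f => funext fun w => ?_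
  have h1 := SInf.lt_add_one i
  have h2 := SInf.lt_add_one j
  rw [Module.End.mul_apply, Module.End.mul_apply, nilAct_apply, nilAct_apply, nilAct_apply,
    nilAct_apply, SInf.mul_s_apply_of_ne w (h1.trans h).ne' h.ne',
    SInf.mul_s_apply_of_ne w (h1.trans (h.trans h2)).ne' (h.trans h2).ne',
    SInf.mul_s_apply_of_ne w (h1.trans h).ne ((h1.trans h).trans h2).ne,
    SInf.mul_s_apply_of_ne w h.ne (h.trans h2).ne, mul_assoc, mul_assoc, s_comm h]
  split_ifs <;> rfl

theorem nilAct_braid (i : ℕ+) :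
    nilAct i * nilAct (i + 1) * nilAct i = nilAct (i + 1) * nilAct i * nilAct (i + 1) := by
  refine LinearMap.ext fun f => funext fun w => ?_
  have h1 := SInf.lt_add_one i
  have h2 := SInf.lt_add_one (i + 1)
  have e1 : ∀ v : SInf, (v * SInf.s (i + 1)).1 i = v.1 i := fun v =>
    SInf.mul_s_apply_of_ne v h1.ne (h1.trans h2).ne
  have e2 : ∀ v : SInf, (v * SInf.s i).1 (i + 1 + 1) = v.1 (i + 1 + 1) := fun v =>
    SInf.mul_s_apply_of_ne v (h1.trans h2).ne' h2.ne'
  simp only [Module.End.mul_apply, nilAct_apply, SInf.mul_s_apply_left, SInf.mul_s_apply_right,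
    e1, e2]
  have e3 : w * SInf.s i * SInf.s (i + 1) * SInf.s i =
      w * SInf.s (i + 1) * SInf.s i * SInf.s (i + 1) := by
    have := congrArg (w * ·) (s_braid i)
    simpa only [mul_assoc] using this
  rw [e3]
  by_cases a : w.1 (i + 1) < w.1 i <;> by_cases b : w.1 (i + 1 + 1) < w.1 i <;>
    by_cases c : w.1 (i + 1 + 1) < w.1 (i + 1) <;> simp [a, b, c]

theorem nilCoxeter_nilRev (n : ℕ) : NilCoxeter (nilRev n) n where
  sq i _ := nilAct_sq _
  comm i j hij hj := by
    refine (nilAct_comm ?_).symm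
    rw [succPNat_add_one, Nat.succPNat_lt_succPNat]
    omega
  braid i hi := by
    have h : (n - 1 - i).succPNat = (n - 1 - (i + 1)).succPNat + 1 := by
      rw [succPNat_add_one]
      congr 1
      omega
    rw [nilRev, nilRev, h, nilAct_braid]

/-- The product `(1 + x u_{m+1}) (1 + x u_{m+2}) ⋯ (1 + x u_n)`. -/
def rowProd (n m : ℕ) (x : Poly) : Module.End Poly (SInf → Poly) :=
  genProd (nilRev n) (algebraMap Poly _ x) (n - m)

theorem rowProd_of_le {n m : ℕ} (h : n ≤ m) (x : Poly) : rowProd n m x = 1 := by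
  rw [rowProd, Nat.sub_eq_zero_of_le h]
  rfl

theorem rowProd_eq {n m : ℕ} (h : m < n) (x : Poly) :
    rowProd n m x = (1 + algebraMap Poly _ x * nilAct m.succPNat) * rowProd n (m + 1) x := by
  have h1 : n - m = n - (m + 1) + 1 := by omega
  have h2 : n - 1 - (n - (m + 1)) = m := by omega
  rw [rowProd, rowProd, h1, genProd, nilRev, h2]

theorem rowProd_comm (n m : ℕ) (x y : Poly) :
    rowProd n m x * rowProd n m y = rowProd n m y * rowProd n m x := by
  refine genProd_comm (Algebra.commutes x) (Algebra.commutes y) ?_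
  have h := nilCoxeter_nilRev n
  exact ⟨fun i hi => h.sq i (by omega), fun i j h1 h2 => h.comm i j h1 (by omega),
    fun i hi => h.braid i (by omega)⟩

theorem nilAct_rowProd_comm {n m k : ℕ} (h : m + 1 < k) (x : Poly) :
    nilAct m.succPNat * rowProd n k x = rowProd n k x * nilAct m.succPNat := by
  refine (commute_genProd (Algebra.commutes x _).symm fun j hj => nilAct_comm ?_).eq
  rw [succPNat_add_one, Nat.succPNat_lt_succPNat]
  omega

/-- The variable `x_{m+1}`. -/
def var (m : ℕ) : Poly := MvPolynomial.X m.succPNat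

/-- The family with `1` at the identity and `0` elsewhere. -/
def unitFamily : SInf → Poly := fun w => if w = 1 then 1 else 0

/-- The family whose component at `w ∈ S_{n+1}` is the Schubert polynomial of `w`, built up from
the products for the first `m` variables. -/
def schubFamily (n : ℕ) : ℕ → SInf → Poly
  | 0 => unitFamily
  | m + 1 => rowProd n m (var m) (schubFamily n m)

/-- The interchange of the variables `x_{i+1}` and `x_{i+2}`. -/
def swapVar (i : ℕ) : Poly →ₐ[ℤ] Poly :=
  MvPolynomial.rename (Equiv.swap i.succPNat (i.succPNat + 1))

theorem swapVar_of_ne {i m : ℕ} (h1 : m ≠ i) (h2 : m ≠ i + 1) : swapVar i (var m) = var m := by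
  rw [swapVar, var, MvPolynomial.rename_X, Equiv.swap_apply_of_ne_of_ne]
  · exact fun h => h1 (Nat.succPNat_injective h)
  · exact fun h => h2 (Nat.succPNat_injective h)

theorem swapVar_left (i : ℕ) : swapVar i (var i) = var (i + 1) := by
  rw [swapVar, var, MvPolynomial.rename_X, Equiv.swap_apply_left]
  rfl

theorem swapVar_right (i : ℕ) : swapVar i (var (i + 1)) = var i := by
  rw [swapVar, var, MvPolynomial.rename_X, ← succPNat_add_one, Equiv.swap_apply_right]
  rfl

theorem map_nilAct (σ : Poly →ₐ[ℤ] Poly) (i : ℕ+) (f : SInf → Poly) :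
    (fun w => σ (nilAct i f w)) = nilAct i (fun w => σ (f w)) := by
  funext w
  rw [nilAct_apply, nilAct_apply]
  split_ifs
  · rfl
  · exact map_zero σ

theorem map_rowProd (σ : Poly →ₐ[ℤ] Poly) (n m : ℕ) (x : Poly) (f : SInf → Poly) :
    (fun w => σ (rowProd n m x f w)) = rowProd n m (σ x) (fun w => σ (f w)) := by
  unfold rowProd
  generalize n - m = k
  induction k with
  | zero => rfl
  | succ k ih =>
    simp only [genProd, Module.End.mul_apply]
    rw [← ih]
    funext w
    have := congrFun (map_nilAct σ (n - 1 - k).succPNat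
      (genProd (nilRev n) (algebraMap Poly _ x) k f)) w
    simp only [LinearMap.add_apply, Module.End.one_apply, Module.End.mul_apply, Pi.add_apply,
      Module.algebraMap_end_apply, Pi.smul_apply, smul_eq_mul, map_add, map_mul, nilRev]
    rw [this]

/-- The difference of the family and its image under the interchange of `x = x_{i+1}` and
`y = x_{i+2}`. These variables occur in two rows `R_{i+1}(y) R_i(x)`, where
`R_i(z) = (1 + z u) R_{i+1}(z)` with `u = nilAct (i + 1)`. As `u ^ 2 = 0` and the `R_i` commute, the
difference is `(x - y) u R_{i+1}(y) R_i(x)`, and `u` commutes with the rows of the subsequent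
variables. -/
theorem schubFamily_sub {n i : ℕ} (hi : i < n) (k : ℕ) :
    schubFamily n (i + 2 + k) - (fun w => swapVar i (schubFamily n (i + 2 + k) w)) =
      (var i - var (i + 1)) • nilAct i.succPNat (schubFamily n (i + 2 + k)) := by
  induction k with
  | zero =>
    have hfix : ∀ m, m ≤ i → (fun w => swapVar i (schubFamily n m w)) = schubFamily n m := by
      intro m hm
      induction m with
      | zero =>
        funext w
        simp only [schubFamily, unitFamily]
        split_ifs <;> simp
      | succ m ih =>
        rw [schubFamily, map_rowProd, ih (by omega), swapVar_of_ne (by omega) (by omega)]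
    rw [add_zero, schubFamily, map_rowProd, schubFamily, map_rowProd, hfix i le_rfl,
      swapVar_left, swapVar_right]
    generalize var i = x
    generalize var (i + 1) = y
    have h1 : ∀ z, rowProd n (i + 1) z =
        (1 - algebraMap Poly _ z * nilAct i.succPNat) * rowProd n i z := by
      intro z
      rw [rowProd_eq hi, ← mul_assoc, one_sub_mul_one_add (Algebra.commutes z) (nilAct_sq _),
        one_mul]
    have h2 : nilAct i.succPNat * rowProd n i y = nilAct i.succPNat * rowProd n (i + 1) y := by
      rw [rowProd_eq hi, ← mul_assoc, mul_add, mul_one, ← mul_assoc, ← Algebra.commutes, mul_assoc,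
        nilAct_sq, mul_zero, add_zero]
    have h3 : rowProd n (i + 1) y * rowProd n i x - rowProd n (i + 1) x * rowProd n i y =
        (x - y) • (nilAct i.succPNat * rowProd n (i + 1) y * rowProd n i x) := by
      rw [← h2, h1 y, h1 x, mul_assoc, mul_assoc, mul_assoc, rowProd_comm n i y x, ← sub_mul,
        ← smul_mul_assoc]
      congr 1
      refine LinearMap.ext fun f => funext fun w => ?_
      change f w - y * nilAct i.succPNat f w - (f w - x * nilAct i.succPNat f w) =
        (x - y) * nilAct i.succPNat f w
      ring
    have := LinearMap.congr_fun h3 (schubFamily n i)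
    exact this
  | succ k ih =>
    rw [← add_assoc, schubFamily, map_rowProd, swapVar_of_ne (by omega) (by omega), ← map_sub, ih,
      map_smul, ← Module.End.mul_apply, ← Module.End.mul_apply, nilAct_rowProd_comm (by omega)]

/-- `w ∈ S_n`. -/
def InS (n : ℕ) (w : SInf) : Prop := ∀ i : ℕ+, n < (i : ℕ) → w.1 i = i

theorem InS.mono {m n : ℕ} (h : m ≤ n) {w : SInf} (hw : InS m w) : InS n w :=
  fun i hi => hw i (by omega)

theorem inS_size (w : SInf) : InS w.size w := Nat.find_spec w.exists_bound

theorem InS.apply_le {n : ℕ} {w : SInf} (hw : InS n w) {i : ℕ+} (hi : (i : ℕ) ≤ n) :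
    ((w.1 i : ℕ+) : ℕ) ≤ n := by
  by_contra hcon
  have := w.1.injective (hw _ (not_le.1 hcon))
  rw [this] at hcon
  exact hcon hi

theorem InS.mul {n : ℕ} {v w : SInf} (hv : InS n v) (hw : InS n w) : InS n (v * w) :=
  fun i hi => by rw [SInf.mul_apply, hw i hi, hv i hi]

theorem InS.inv {n : ℕ} {w : SInf} (hw : InS n w) : InS n w⁻¹ := fun i hi => by
  rw [SInf.inv_apply', Equiv.Perm.inv_eq_iff_eq, hw i hi]

theorem inS_s {n : ℕ} {i : ℕ+} (hi : (i : ℕ) < n) : InS n (SInf.s i) := fun j hj => by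
  refine Equiv.swap_apply_of_ne_of_ne ?_ ?_ <;> rintro rfl
  · omega
  · rw [PNat.add_coe, PNat.one_coe] at hj
    omega

theorem InS.lt_of_descent {n : ℕ} {w : SInf} (hw : InS n w) {i : ℕ+} (h : w.1 (i + 1) < w.1 i) :
    (i : ℕ) < n := by
  by_contra hcon
  have h1 : w.1 (i + 1) = i + 1 := hw _ (by rw [PNat.add_coe, PNat.one_coe]; omega)
  rw [h1] at h
  have h2 : (i : ℕ) + 1 < (w.1 i : ℕ+) := by exact_mod_cast h
  have h3 := w.1.injective (hw (w.1 i) (by omega))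
  rw [h3] at h2
  omega

/-- Two families have the same components at `S_n`. -/
def EqOnS (n : ℕ) (f g : SInf → Poly) : Prop := ∀ w, InS n w → f w = g w

theorem EqOnS.nilAct {n : ℕ} {f g : SInf → Poly} (h : EqOnS n f g) (i : ℕ+) :
    EqOnS n (nilAct i f) (nilAct i g) := by
  intro w hw
  rw [nilAct_apply, nilAct_apply]
  split_ifs with hd
  · exact h _ (hw.mul (inS_s (hw.lt_of_descent hd)))
  · rfl

theorem one_add_nilAct_apply (x : Poly) (i : ℕ+) (f : SInf → Poly) (w : SInf) :
    ((1 + algebraMap Poly (Module.End Poly (SInf → Poly)) x * nilAct i) f) w =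
      f w + x * nilAct i f w := rfl

theorem EqOnS.rowProd {n₀ n : ℕ} (hn : n₀ ≤ n) (x : Poly) (k : ℕ) :
    ∀ m, m + k = n → ∀ {f g : SInf → Poly}, EqOnS (n₀ + 1) f g →
      EqOnS (n₀ + 1) (rowProd n m x f) (rowProd n₀ m x g) := by
  induction k with
  | zero =>
    intro m hm f g h
    rw [rowProd_of_le (n := n) (by omega), rowProd_of_le (n := n₀) (by omega)]
    exact h
  | succ k ih =>
    intro m hm f g h
    have ih := ih (m + 1) (by omega) h
    rw [rowProd_eq (by omega)]
    rcases lt_or_ge m n₀ with hm' | hm'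
    · rw [rowProd_eq hm']
      intro w hw
      rw [Module.End.mul_apply, Module.End.mul_apply, one_add_nilAct_apply, one_add_nilAct_apply,
        ih w hw, ih.nilAct _ w hw]
    · rw [rowProd_of_le hm']
      rw [rowProd_of_le (n := n₀) (by omega)] at ih
      intro w hw
      rw [Module.End.mul_apply, one_add_nilAct_apply, ih w hw, nilAct_apply, if_neg, mul_zero,
        add_zero]
      intro hd
      have := hw.lt_of_descent hd
      rw [Nat.succPNat_coe] at this
      omega

/-- The components at `S_{n+1}` do not depend on the number of variables. -/
theorem schubFamily_stable {n₀ n : ℕ} (hn : n₀ ≤ n) (m : ℕ) :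
    EqOnS (n₀ + 1) (schubFamily n m) (schubFamily n₀ m) := by
  induction m with
  | zero => exact fun _ _ => rfl
  | succ m ih =>
    rcases le_or_gt m n with h | h
    · exact EqOnS.rowProd hn (var m) (n - m) m (by omega) ih
    · rw [schubFamily, schubFamily, rowProd_of_le h.le, rowProd_of_le (by omega)]
      exact ih

theorem schubFamily_of_le {n m : ℕ} (h : n ≤ m) : schubFamily n m = schubFamily n n := by
  induction m, h using Nat.le_induction with
  | base => rfl
  | succ m hm ih => rw [schubFamily, rowProd_of_le hm, ih]; rfl

theorem dividedDiff_spec (i : ℕ+) (f : Poly) :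
    (MvPolynomial.X i - MvPolynomial.X (i + 1)) * dividedDiff i f =
      f - MvPolynomial.rename (Equiv.swap i (i + 1)) f :=
  (X_sub_X_dvd i f).choose_spec.symm

theorem X_sub_X_ne_zero (i : ℕ+) : (MvPolynomial.X i - MvPolynomial.X (i + 1) : Poly) ≠ 0 :=
  sub_ne_zero.2 fun h => (SInf.lt_add_one i).ne (MvPolynomial.X_injective h)

theorem dividedDiff_eq {i : ℕ+} {f g : Poly}
    (h : (MvPolynomial.X i - MvPolynomial.X (i + 1)) * g =
      f - MvPolynomial.rename (Equiv.swap i (i + 1)) f) : dividedDiff i f = g :=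
  mul_left_cancel₀ (X_sub_X_ne_zero i) ((dividedDiff_spec i f).trans h.symm)

theorem dividedDiff_schubFamily {n : ℕ} {i : ℕ+} (hi : (i : ℕ) ≤ n) (w : SInf) :
    dividedDiff i (schubFamily n n w) =
      if w.1 (i + 1) < w.1 i then schubFamily n n (w * SInf.s i) else 0 := by
  obtain ⟨m, rfl⟩ : ∃ m : ℕ, i = m.succPNat := ⟨i.natPred, (PNat.succPNat_natPred i).symm⟩
  rw [Nat.succPNat_coe] at hi
  refine dividedDiff_eq ?_
  have h := congrFun (schubFamily_sub (n := n) (i := m) (by omega) (n - 1 - m)) w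
  rw [schubFamily_of_le (by omega)] at h
  exact h.symm

/-- `f` vanishes at all `v ≠ w` with `ℓ(v) ≥ ℓ(w)`, and `f_w = c`. -/
def IsTop (w : SInf) (c : Poly) (f : SInf → Poly) : Prop :=
  ∀ v : SInf, w.len ≤ v.len → f v = if v = w then c else 0

theorem IsTop.step {w : SInf} {c : Poly} {f : SInf → Poly} (h : IsTop w c f) (x : Poly) {i : ℕ+}
    (hi : w.1 i < w.1 (i + 1)) :
    IsTop (w * SInf.s i) (x * c)
      ((1 + algebraMap Poly (Module.End Poly (SInf → Poly)) x * nilAct i) f) := by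
  intro v hv
  rw [SInf.len_mul_s hi] at hv
  have hne : v ≠ w := by
    rintro rfl
    omega
  rw [one_add_nilAct_apply, h v (by omega), if_neg hne, zero_add, nilAct_apply]
  split_ifs with h1 h2 h2
  · rw [h2, SInf.mul_s_mul_s, h w le_rfl, if_pos rfl]
  · have := SInf.len_eq_len_mul_s_add_one h1
    rw [h _ (by omega), if_neg, mul_zero]
    intro h3
    rw [← h3, SInf.mul_s_mul_s] at h2
    exact h2 rfl
  · rw [h2, SInf.mul_s_apply_left, SInf.mul_s_apply_right] at h1
    exact absurd hi h1
  · rw [mul_zero]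

theorem longestFun_of_le {n : ℕ} {i : ℕ+} (h : (i : ℕ) ≤ n) :
    ((SInf.longestFun n i : ℕ+) : ℕ) = n + 1 - i := by
  simp [SInf.longestFun, h]

theorem longestFun_of_lt {n : ℕ} {i : ℕ+} (h : n < (i : ℕ)) : SInf.longestFun n i = i := by
  simp [SInf.longestFun, not_le.2 h]

/-- The values, counted from `0`, of the permutations that lead to the longest element of
`S_{n+1}`: the values `n, n - 1, …` stand at the first `m` positions, and the value `n - m` is at
the position `j` on its way to the position `m`. -/
def towardsLongest (n m j p : ℕ) : ℕ :=
  if p < m then n - p else if p < j then p - m else if p = j then n - m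
  else if p ≤ n then p - 1 - m else p

/-- The factors of a row move the value `n - m` from the position `n` to the position `m`, by one
position each. Each of them raises the length, so that the term that takes all of them is the top
one. -/
theorem isTop_genProd {n m : ℕ} (hm : m ≤ n) {w : SInf} {c : Poly} {f : SInf → Poly}
    (h : IsTop w c f) (hw : ∀ p : ℕ, w.1 p.succPNat = (towardsLongest n m n p).succPNat)
    (x : Poly) (k : ℕ) (hk : k ≤ n - m) :
    ∃ w' : SInf, (∀ p : ℕ, w'.1 p.succPNat = (towardsLongest n m (n - k) p).succPNat) ∧
      IsTop w' (x ^ k * c) (genProd (nilRev n) (algebraMap Poly _ x) k f) := by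
  induction k with
  | zero => exact ⟨w, hw, by simpa [genProd] using h⟩
  | succ k ih =>
    obtain ⟨w', h1, h2⟩ := ih (by omega)
    have hlt : w'.1 (n - 1 - k).succPNat < w'.1 ((n - 1 - k).succPNat + 1) := by
      rw [succPNat_add_one, h1, h1, Nat.succPNat_lt_succPNat]
      unfold towardsLongest
      split_ifs <;> omega
    refine ⟨w' * SInf.s (n - 1 - k).succPNat, fun p => ?_, ?_⟩
    · rcases eq_or_ne p (n - 1 - k) with rfl | hp
      · rw [SInf.mul_s_apply_left, succPNat_add_one, h1]
        congr 1
        unfold towardsLongest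
        split_ifs <;> omega
      · rcases eq_or_ne p (n - 1 - k + 1) with rfl | hp'
        · rw [← succPNat_add_one, SInf.mul_s_apply_right, h1]
          congr 1
          unfold towardsLongest
          split_ifs <;> omega
        · rw [SInf.mul_s_apply_of_ne _ (fun h => hp (Nat.succPNat_injective h))
            (fun h => hp' (Nat.succPNat_injective h)), h1]
          congr 1
          unfold towardsLongest
          split_ifs <;> omega
    · rw [genProd, Module.End.mul_apply, pow_succ', mul_assoc]
      exact h2.step x hlt

/-- Only the product of the top terms of all the rows reaches the longest element. -/
theorem schubFamily_longest (n : ℕ) :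
    schubFamily n n (SInf.longest (n + 1)) = staircase (n + 1) := by
  have key : ∀ m ≤ n, ∃ w : SInf,
      (∀ p : ℕ, w.1 p.succPNat = (towardsLongest n m n p).succPNat) ∧
      IsTop w (∏ i ∈ Finset.range m, var i ^ (n - i)) (schubFamily n m) := by
    intro m hm
    induction m with
    | zero =>
      refine ⟨1, fun p => ?_, fun v _ => by simp [schubFamily, unitFamily]⟩
      change p.succPNat = _
      congr 1
      unfold towardsLongest
      split_ifs <;> omega
    | succ m ih =>
      obtain ⟨w, h1, h2⟩ := ih (by omega)
      obtain ⟨w', h3, h4⟩ := isTop_genProd (by omega) h2 h1 (var m) (n - m) le_rfl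
      refine ⟨w', fun p => ?_, ?_⟩
      · rw [h3]
        congr 1
        unfold towardsLongest
        split_ifs <;> omega
      · rw [Finset.prod_range_succ, mul_comm]
        exact h4
  obtain ⟨w, h1, h2⟩ := key n le_rfl
  have hw : SInf.longest (n + 1) = w := by
    refine SInf.ext_apply fun i => ?_
    obtain ⟨p, rfl⟩ : ∃ p : ℕ, i = p.succPNat := ⟨i.natPred, (PNat.succPNat_natPred i).symm⟩
    rw [h1]
    change SInf.longestFun (n + 1) p.succPNat = _
    apply PNat.coe_injective
    have e := Nat.succPNat_coe p
    unfold towardsLongest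
    by_cases h : (p.succPNat : ℕ) ≤ n + 1
    · rw [longestFun_of_le h, Nat.succPNat_coe, Nat.succPNat_coe]
      split_ifs <;> omega
    · rw [longestFun_of_lt (by omega), Nat.succPNat_coe]
      split_ifs <;> omega
  rw [hw, h2 w le_rfl, if_pos rfl, staircase, Finset.prod_range_succ]
  simp [var]

end Generating

/-! ### Divided differences of Schubert polynomials -/

section DividedDiff

theorem isReducedWord_cons {w : SInf} {i : ℕ+} {a : List ℕ+} :
    w.IsReducedWord (i :: a) ↔ w.len = (SInf.s i * w).len + 1 ∧ (SInf.s i * w).IsReducedWord a := by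
  have hss : ∀ v : SInf, SInf.s i * (SInf.s i * v) = v := fun v => by
    rw [← mul_assoc, SInf.s, SInf.swap_mul_self, one_mul]
  constructor
  · rintro ⟨h1, h2⟩
    rw [List.map_cons, List.prod_cons] at h1
    have h3 : (a.map SInf.s).prod = SInf.s i * w := by rw [← h1, hss]
    have h4 := SInf.len_prod_le a
    rw [h3] at h4
    rw [List.length_cons] at h2
    have h5 : w.len ≤ (SInf.s i * w).len + 1 := by
      rcases lt_or_ge (w.1⁻¹ i) (w.1⁻¹ (i + 1)) with h | h
      · have := SInf.len_s_mul h
        omega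
      · have h' : (SInf.s i * w).1⁻¹ i < (SInf.s i * w).1⁻¹ (i + 1) := by
          rw [SInf.s, SInf.inv_swap_mul, SInf.inv_swap_mul, Equiv.swap_apply_left,
            Equiv.swap_apply_right]
          exact lt_of_le_of_ne h fun h => (SInf.lt_add_one i).ne' ((w.1⁻¹).injective h)
        have := SInf.len_s_mul h'
        rw [hss] at this
        omega
    exact ⟨by omega, h3, by omega⟩
  · rintro ⟨h1, h2, h3⟩
    refine ⟨by rw [List.map_cons, List.prod_cons, h2, hss], ?_⟩
    rw [List.length_cons, h3, h1]

theorem inS_longest (n : ℕ) : InS n (SInf.longest n) := fun _ hi => longestFun_of_lt hi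

theorem longest_mul_self (n : ℕ) : SInf.longest n * SInf.longest n = 1 :=
  SInf.ext_apply fun i => SInf.longestFun_involutive n i

theorem longest_lt {n : ℕ} {i j : ℕ+} (hij : i < j) (hj : (j : ℕ) ≤ n) :
    (SInf.longest n).1 j < (SInf.longest n).1 i := by
  change SInf.longestFun n j < SInf.longestFun n i
  have hij' : (i : ℕ) < j := hij
  rw [← PNat.coe_lt_coe, longestFun_of_le hj, longestFun_of_le (by omega)]
  omega

theorem schubFamily_longest_of_le {n N : ℕ} (h : N ≤ n + 1) :
    schubFamily n n (SInf.longest N) = staircase N := by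
  cases N with
  | zero =>
    have h0 : SInf.longest 0 = SInf.longest (0 + 1) := by
      refine SInf.ext_apply fun i => ?_
      change SInf.longestFun 0 i = SInf.longestFun 1 i
      have hi := i.pos
      apply PNat.coe_injective
      rw [longestFun_of_lt hi]
      by_cases h1 : (i : ℕ) ≤ 1
      · rw [longestFun_of_le h1]
        omega
      · rw [longestFun_of_lt (by omega)]
    rw [h0, schubFamily_stable (Nat.zero_le n) n _ (inS_longest 1),
      schubFamily_of_le (Nat.zero_le n), schubFamily_longest]
    simp [staircase]
  | succ N =>
    have h' : N ≤ n := by omega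
    rw [schubFamily_stable h' n _ (inS_longest (N + 1)), schubFamily_of_le h',
      schubFamily_longest]

/-- The divided differences of a reduced word of `v` lead from the staircase monomial, which belongs
to the longest element `ω₀`, to the member of the family at `ω₀ v⁻¹`. -/
theorem foldr_dividedDiff {n N : ℕ} (h : N ≤ n + 1) (a : List ℕ+) :
    ∀ {v : SInf}, InS N v → v.IsReducedWord a →
      a.foldr dividedDiff (staircase N) = schubFamily n n (SInf.longest N * v⁻¹) := by
  induction a with
  | nil =>
    rintro v - ⟨rfl, -⟩
    rw [List.map_nil, List.prod_nil, inv_one, mul_one, schubFamily_longest_of_le h]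
    rfl
  | cons i a ih =>
    intro v hv ha
    obtain ⟨h1, h2⟩ := isReducedWord_cons.1 ha
    set v' := SInf.s i * v with hv'
    have hvv : v = SInf.s i * v' := by
      rw [hv', ← mul_assoc, SInf.s, SInf.swap_mul_self, one_mul]
    have hS : InS N v' := Weak.fixes_of_cover ⟨i, hvv, h1⟩ hv
    have hlt : v'.1⁻¹ i < v'.1⁻¹ (i + 1) := SInf.len_s_mul_eq_iff.1 (by rw [← hvv, h1])
    have hi : (i : ℕ) < N := by
      by_contra hcon
      have e1 := hS.inv (i + 1) (by rw [PNat.add_coe, PNat.one_coe]; omega)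
      have e2 : InS N (SInf.s i) := by
        have := hv.mul hS.inv
        rwa [hvv, mul_inv_cancel_right] at this
      have e3 := e2 (i + 1) (by rw [PNat.add_coe, PNat.one_coe]; omega)
      rw [SInf.s, SInf.swap_apply, Equiv.swap_apply_right] at e3
      exact (SInf.lt_add_one i).ne e3
    rw [List.foldr_cons, ih hS h2, dividedDiff_schubFamily (by omega), if_pos]
    · have e : v⁻¹ = v'⁻¹ * SInf.s i := by
        rw [hv', mul_inv_rev, SInf.s, SInf.swap_inv, mul_assoc, SInf.swap_mul_self, mul_one]
      rw [e, mul_assoc]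
    · rw [SInf.mul_apply, SInf.mul_apply]
      refine longest_lt hlt (hS.inv.apply_le ?_)
      rw [PNat.add_coe, PNat.one_coe]
      omega

/-- The Schubert polynomials are the coefficients of the Fomin–Stanley generating product. -/
theorem schubert_eq {n : ℕ} {w : SInf} (h : w.size ≤ n + 1) :
    schubert w = schubFamily n n w := by
  have hw : ∃ a, (w⁻¹ * SInf.longest w.size).IsReducedWord a := SInf.exists_isReducedWord _
  rw [schubert, dividedDiffPerm, dif_pos hw, foldr_dividedDiff h _
    ((inS_size w).inv.mul (inS_longest _)) hw.choose_spec, mul_inv_rev, inv_inv, ← mul_assoc,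
    inv_eq_of_mul_eq_one_left (longest_mul_self w.size), longest_mul_self, one_mul]

theorem size_le {w : SInf} {n : ℕ} (h : InS n w) : w.size ≤ n := Nat.find_min' _ h

/-- The divided differences of Schubert polynomials. -/
theorem dividedDiff_schubert (i : ℕ+) (w : SInf) :
    dividedDiff i (schubert w) = if w.1 (i + 1) < w.1 i then schubert (w * SInf.s i) else 0 := by
  set n := w.size + i with hn
  have h1 : InS (n + 1) w := (inS_size w).mono (by omega)
  have h2 : InS (n + 1) (w * SInf.s i) := h1.mul (inS_s (by omega))
  rw [schubert_eq (size_le h1), schubert_eq (size_le h2), dividedDiff_schubFamily (by omega)]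

theorem constantCoeff_schubert (w : SInf) :
    MvPolynomial.constantCoeff (schubert w) = if w = 1 then 1 else 0 := by
  set n := w.size
  rw [schubert_eq (n := n) (by omega)]
  -- if all variables are set to `0`, the rows become `1`
  let σ : Poly →ₐ[ℤ] Poly := MvPolynomial.aeval (fun _ => 0)
  have hσ : ∀ m, (fun w => σ (schubFamily n m w)) = unitFamily := by
    intro m
    induction m with
    | zero =>
      funext w
      simp only [schubFamily, unitFamily]
      split_ifs <;> simp
    | succ m ih =>
      have h0 : σ (var m) = 0 := by simp [σ, var]
      have h1 : ∀ k, genProd (nilRev n) (0 : Module.End Poly (SInf → Poly)) k = 1 := by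
        intro k
        induction k with
        | zero => rfl
        | succ k ih => rw [genProd, ih, zero_mul, add_zero, mul_one]
      rw [schubFamily, map_rowProd, ih, h0, rowProd, map_zero, h1]
      rfl
  have hc : ∀ f : Poly, σ f = MvPolynomial.C (MvPolynomial.constantCoeff f) := by
    intro f
    exact MvPolynomial.aeval_zero' f
  have := congrFun (hσ n) w
  simp only [hc, unitFamily] at this
  apply MvPolynomial.C_injective ℕ+ ℤ
  rw [this]
  split_ifs <;> simp

end DividedDiff

/-! ### Expansions in Schubert polynomials -/

section Expansion

/-- The linear map from formal sums of permutations to polynomials with `w ↦ 𝔖_w`. -/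
def schubMap : (SInf →₀ ℤ) →ₗ[ℤ] Poly := Finsupp.linearCombination ℤ schubert

theorem schubMap_single (w : SInf) : schubMap (Finsupp.single w 1) = schubert w := by
  rw [schubMap, Finsupp.linearCombination_single, one_smul]

/-- The operator on formal sums of permutations with the given values at the permutations. -/
def opOf (g : SInf → SInf →₀ ℤ) : Module.End ℤ (SInf →₀ ℤ) := Finsupp.linearCombination ℤ g

theorem opOf_single (g : SInf → SInf →₀ ℤ) (w : SInf) : opOf g (Finsupp.single w 1) = g w := by
  rw [opOf, Finsupp.linearCombination_single, one_smul]

theorem end_ext {N : Type*} [AddCommGroup N] {f g : (SInf →₀ ℤ) →ₗ[ℤ] N}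
    (h : ∀ u, f (Finsupp.single u 1) = g (Finsupp.single u 1)) : f = g :=
  Finsupp.lhom_ext' fun u => LinearMap.ext_ring (h u)

/-- The divided difference `∂_i`, as a linear map. -/
def dividedDiffLin (i : ℕ+) : Poly →ₗ[ℤ] Poly where
  toFun := dividedDiff i
  map_add' f g := dividedDiff_eq (by
    rw [mul_add, dividedDiff_spec, dividedDiff_spec, map_add]; ring)
  map_smul' a f := dividedDiff_eq (by
    rw [RingHom.id_apply, mul_smul_comm, dividedDiff_spec, map_zsmul, smul_sub])

theorem dividedDiff_mul_X (i k : ℕ+) (f : Poly) :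
    dividedDiff i (MvPolynomial.X k * f) =
      MvPolynomial.X (Equiv.swap i (i + 1) k) * dividedDiff i f +
      (if k = i then f else 0) - (if k = i + 1 then f else 0) := by
  refine dividedDiff_eq ?_
  rw [mul_sub, mul_add, mul_left_comm, dividedDiff_spec, map_mul, MvPolynomial.rename_X]
  have h := SInf.lt_add_one i
  by_cases h1 : k = i
  · subst h1
    rw [Equiv.swap_apply_left, if_pos rfl, if_neg h.ne]
    ring
  · by_cases h2 : k = i + 1
    · subst h2
      rw [Equiv.swap_apply_right, if_pos rfl, if_neg h1]
      ring
    · rw [Equiv.swap_apply_of_ne_of_ne h1 h2, if_neg h1, if_neg h2]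
      ring

/-- The operator on formal sums of permutations that corresponds to `∂_i`. -/
def descOp (i : ℕ+) : Module.End ℤ (SInf →₀ ℤ) :=
  opOf fun u => if u.1 (i + 1) < u.1 i then Finsupp.single (u * SInf.s i) 1 else 0

theorem dividedDiff_schubMap (i : ℕ+) (f : SInf →₀ ℤ) :
    dividedDiff i (schubMap f) = schubMap (descOp i f) := by
  have : dividedDiffLin i ∘ₗ schubMap = schubMap ∘ₗ descOp i := by
    refine end_ext fun u => ?_
    rw [LinearMap.comp_apply, LinearMap.comp_apply, schubMap_single, descOp, opOf_single]
    change dividedDiff i _ = _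
    rw [dividedDiff_schubert]
    split_ifs
    · rw [schubMap_single]
    · rw [map_zero]
  exact LinearMap.congr_fun this f

theorem descOp_apply {i : ℕ+} {u : SInf} (h : u.1 i < u.1 (i + 1)) (f : SInf →₀ ℤ) :
    descOp i f u = f (u * SInf.s i) := by
  have : Finsupp.lapply u ∘ₗ descOp i =
      (Finsupp.lapply (u * SInf.s i) : (SInf →₀ ℤ) →ₗ[ℤ] ℤ) := by
    refine end_ext fun v => ?_
    rw [LinearMap.comp_apply, descOp, opOf_single, Finsupp.lapply_apply, Finsupp.lapply_apply]
    by_cases hv : v = u * SInf.s i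
    · subst hv
      rw [if_pos (by rwa [SInf.mul_s_apply_left, SInf.mul_s_apply_right]), SInf.mul_s_mul_s]
      simp
    · rw [Finsupp.single_eq_of_ne' hv]
      split_ifs
      · refine Finsupp.single_eq_of_ne' fun h => hv ?_
        rw [← h, SInf.mul_s_mul_s]
      · rfl
  exact LinearMap.congr_fun this f

theorem constantCoeff_schubMap (f : SInf →₀ ℤ) :
    MvPolynomial.constantCoeff (schubMap f) = f 1 := by
  have : (MvPolynomial.constantCoeff (R := ℤ) (σ := ℕ+)).toAddMonoidHom.toIntLinearMap ∘ₗ schubMap =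
      (Finsupp.lapply 1 : (SInf →₀ ℤ) →ₗ[ℤ] ℤ) := by
    refine end_ext fun v => ?_
    rw [LinearMap.comp_apply, schubMap_single, Finsupp.lapply_apply, Finsupp.single_apply]
    exact constantCoeff_schubert v
  exact LinearMap.congr_fun this f

/-- The Schubert polynomials are linearly independent: the coefficient of `𝔖_u` is the constant
term after the divided differences along `u`. -/
theorem schubMap_injective : Function.Injective schubMap := by
  rw [injective_iff_map_eq_zero]
  have key : ∀ u : SInf, ∀ f, schubMap f = 0 → f u = 0 := by
    intro u
    induction u using SInf.induction_len with
    | h1 =>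
      intro f hf
      rw [← constantCoeff_schubMap, hf, map_zero]
    | hs u i h ih =>
      intro f hf
      rw [← descOp_apply h]
      apply ih
      rw [← dividedDiff_schubMap, hf]
      exact map_zero (dividedDiffLin i)
  exact fun f hf => Finsupp.ext fun u => key u f hf

theorem schubertCoeff_schubMap (f : SInf →₀ ℤ) (w : SInf) :
    schubertCoeff (schubMap f) w = f w := by
  have h : ∃ c : SInf →₀ ℤ, schubMap f = c.sum (fun v a => a • schubert v) :=
    ⟨f, by rw [schubMap, Finsupp.linearCombination_apply]⟩
  rw [schubertCoeff, dif_pos h]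
  congr 1
  apply schubMap_injective
  exact (Finsupp.linearCombination_apply ℤ _).trans h.choose_spec.symm

/-- A polynomial without constant term that is killed by all divided differences is zero, as it is
symmetric in infinitely many variables. -/
theorem eq_zero_of_dividedDiff {f : Poly} (h0 : MvPolynomial.constantCoeff f = 0)
    (h : ∀ i, dividedDiff i f = 0) : f = 0 := by
  have hs : ∀ i : ℕ+, MvPolynomial.rename (Equiv.swap i (i + 1)) f = f := by
    intro i
    have := dividedDiff_spec i f
    rw [h i, mul_zero] at this
    exact (sub_eq_zero.1 this.symm).symm
  by_contra hne
  have hvars : f.vars.Nonempty := by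
    by_contra hcon
    rw [Finset.not_nonempty_iff_eq_empty, MvPolynomial.vars_eq_empty_iff_eq_C] at hcon
    refine hne ?_
    rw [hcon, ← MvPolynomial.constantCoeff_eq, h0, MvPolynomial.C_0]
  have h1 := f.vars.max'_mem hvars
  set m := f.vars.max' hvars with hm
  rw [← hs m] at h1
  obtain ⟨j, hj, hjm⟩ := MvPolynomial.mem_vars_rename _ _ h1
  rw [Equiv.swap_apply_eq_iff, Equiv.swap_apply_left] at hjm
  rw [hjm] at hj
  exact absurd (Finset.le_max' _ _ hj) (not_le.2 (SInf.lt_add_one m))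

end Expansion

/-! ### Monk's rule -/

section Monk

/-- `(a, b) u` covers `u` in the Bruhat order (for `a < b`). -/
def Covers (a b : ℕ+) (u : SInf) : Prop :=
  u.1⁻¹ a < u.1⁻¹ b ∧ (SInf.swap a b * u).len = u.len + 1

theorem covers_of_len {a b : ℕ+} (hab : a < b) {u : SInf}
    (h : (SInf.swap a b * u).len = u.len + 1) : Covers a b u :=
  ⟨SInf.inv_lt_of_len_lt hab (by omega), h⟩

theorem Covers.not_between {a b c : ℕ+} {u : SInf} (h : Covers a b u) (h1 : a < c) (h2 : c < b)
    (h3 : u.1⁻¹ a < u.1⁻¹ c) (h4 : u.1⁻¹ c < u.1⁻¹ b) : False :=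
  (SInf.len_swap_mul_iff (h1.trans h2) h.1).1 h.2 c h1 h2 ⟨h3, h4⟩

/-- The indicator of `Covers`. -/
def cov (a b : ℕ+) (u : SInf) : ℤ := if Covers a b u then 1 else 0

/-- The sign of the term of `(a, b) u` in Monk's rule for `x_p 𝔖_u`. -/
def monkSign (p a b : ℕ+) (u : SInf) : ℤ :=
  (if u.1⁻¹ a = p then 1 else 0) - (if u.1⁻¹ b = p then 1 else 0)

/-- The terms of Monk's rule for `x_p 𝔖_u` with the transpositions `(a, b)`, `a < b`. -/
def monkOp (p b : ℕ+) : Module.End ℤ (SInf →₀ ℤ) :=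
  opOf fun u => ∑ a ∈ Finset.Iio b,
    (monkSign p a b u * cov a b u) • Finsupp.single (SInf.swap a b * u) 1

/-- The integers `1, …, B`. -/
def labels (B : ℕ) : List ℕ+ := (List.range B).map Nat.succPNat

theorem pairwise_labels (B : ℕ) : (labels B).Pairwise (· < ·) :=
  List.pairwise_map.2 (List.pairwise_lt_range.imp fun h => Nat.succPNat_lt_succPNat.2 h)

theorem mem_labels {B : ℕ} {b : ℕ+} : b ∈ labels B ↔ (b : ℕ) ≤ B := by
  rw [labels, List.mem_map]
  constructor
  · rintro ⟨m, hm, rfl⟩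
    rw [Nat.succPNat_coe]
    have := List.mem_range.1 hm
    omega
  · intro h
    have := b.pos
    refine ⟨b.natPred, List.mem_range.2 ?_, PNat.succPNat_natPred b⟩
    have := b.natPred_add_one
    omega

/-- The operator of Monk's rule for `x_p`, with the transpositions `(a, b)`, `a < b ≤ B`. -/
def monkSum (p : ℕ+) (B : ℕ) : Module.End ℤ (SInf →₀ ℤ) := ((labels B).map (monkOp p)).sum

theorem monkSum_single (p : ℕ+) (B : ℕ) (u : SInf) : monkSum p B (Finsupp.single u 1) =
    ∑ m ∈ Finset.range B, ∑ a ∈ Finset.Iio m.succPNat,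
      (monkSign p a m.succPNat u * cov a m.succPNat u) •
        Finsupp.single (SInf.swap a m.succPNat * u) 1 := by
  have : monkSum p B = ∑ m ∈ Finset.range B, monkOp p m.succPNat := by
    rw [monkSum, labels, List.map_map, ← List.sum_toFinset _ List.nodup_range,
      List.toFinset_range]
    rfl
  rw [this, LinearMap.sum_apply]
  exact Finset.sum_congr rfl fun m _ => opOf_single _ u

theorem sum_pairs_eq {x y : ℕ+} (hxy : x < y) {B : ℕ} {c : SInf →₀ ℤ} (h : c = 0 ∨ (y : ℕ) ≤ B) :
    ∑ m ∈ Finset.range B, ∑ a ∈ Finset.Iio m.succPNat,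
      (if a = x ∧ m.succPNat = y then c else 0) = c := by
  rcases h with rfl | h
  · simp
  · have hy := y.natPred_add_one
    rw [Finset.sum_eq_single y.natPred, Finset.sum_eq_single x, if_pos]
    · exact ⟨rfl, PNat.succPNat_natPred y⟩
    · intro a _ ha
      exact if_neg fun h => ha h.1
    · intro hx
      rw [PNat.succPNat_natPred, Finset.mem_Iio] at hx
      exact absurd hxy hx
    · intro m _ hm
      refine Finset.sum_eq_zero fun a _ => if_neg fun h => hm ?_
      rw [← h.2, Nat.natPred_succPNat]
    · intro hx
      rw [Finset.mem_range] at hx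
      omega

/-- The sign with which `𝔖_u` appears in `∂_i (x_p 𝔖_u)`. -/
def simpleSign (i p : ℕ+) : ℤ := (if i = p then 1 else 0) - (if i + 1 = p then 1 else 0)

theorem descOp_single (i : ℕ+) (u : SInf) : descOp i (Finsupp.single u 1) =
    if u.1 (i + 1) < u.1 i then Finsupp.single (u * SInf.s i) 1 else 0 := opOf_single _ u

/-- The image under `∂_i` of a term of Monk's rule, if `u` has no descent at `i`: no cover of `u`
other than `u s_i` has one, as the value in between would prevent the cover. -/
theorem descOp_monk_of_lt {i p a b : ℕ+} {u : SInf} (hu : u.1 i < u.1 (i + 1)) (hab : a < b) :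
    descOp i ((monkSign p a b u * cov a b u) • Finsupp.single (SInf.swap a b * u) 1) =
      if a = u.1 i ∧ b = u.1 (i + 1) then simpleSign i p • Finsupp.single u 1 else 0 := by
  have hi := SInf.lt_add_one i
  rw [map_smul, descOp_single, SInf.mul_apply, SInf.mul_apply, SInf.swap_apply, SInf.swap_apply]
  split_ifs with h1 h2 h2
  · obtain ⟨rfl, rfl⟩ := h2
    have hc : Covers (u.1 i) (u.1 (i + 1)) u := by
      refine covers_of_len hu ?_
      rw [← SInf.mul_swap_eq]
      exact SInf.len_mul_s hu
    rw [← SInf.mul_swap_eq, ← SInf.s, SInf.mul_s_mul_s, cov, if_pos hc, mul_one, monkSign,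
      SInf.inv_apply, SInf.inv_apply, simpleSign]
  · have : ¬ Covers a b u := by
      intro hc
      rcases SInf.swap_reverses hab hu (lt_asymm h1) with ⟨e1, e2⟩ | ⟨e1, e2, e3⟩ | ⟨e1, e2, e3⟩
      · exact h2 ⟨e1.symm, e2.symm⟩
      · have hp : u.1⁻¹ a = i := by rw [← e1, SInf.inv_apply]
        refine hc.not_between e2 e3 ?_ ?_
        · rwa [hp, SInf.inv_apply]
        · have := hc.1
          rw [hp] at this
          rw [SInf.inv_apply]
          refine lt_of_le_of_ne (PNat.add_one_le_iff.2 this) fun h => e3.ne ?_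
          rw [h, SInf.apply_inv]
      · have hp : u.1⁻¹ b = i + 1 := by rw [← e1, SInf.inv_apply]
        refine hc.not_between e2 e3 ?_ ?_
        · have := hc.1
          rw [hp] at this
          rw [SInf.inv_apply]
          refine lt_of_le_of_ne (PNat.lt_add_one_iff.1 this) fun h => e2.ne ?_
          rw [← h, SInf.apply_inv]
        · rwa [hp, SInf.inv_apply]
    rw [cov, if_neg this, mul_zero, zero_smul]
  · obtain ⟨rfl, rfl⟩ := h2
    rw [Equiv.swap_apply_left, Equiv.swap_apply_right] at h1
    exact absurd hu h1
  · rw [smul_zero]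

theorem inv_mul_s (u : SInf) (i a : ℕ+) :
    (u * SInf.s i).1⁻¹ a = Equiv.swap i (i + 1) (u.1⁻¹ a) := by
  rw [Equiv.Perm.inv_eq_iff_eq, SInf.mul_apply, SInf.s, SInf.swap_apply, Equiv.swap_apply_self,
    SInf.apply_inv]

/-- The image under `∂_i` of a term of Monk's rule, if `u` has a descent at `i`: the covers
`(a, b) u` with a descent at `i` correspond to the covers `(a, b) u s_i` of `u s_i`, except for the cover
`u` of `u s_i`. -/
theorem descOp_monk_of_gt {i p a b : ℕ+} {u : SInf} (hu : u.1 (i + 1) < u.1 i) (hab : a < b) :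
    descOp i ((monkSign p a b u * cov a b u) • Finsupp.single (SInf.swap a b * u) 1) =
      (monkSign (Equiv.swap i (i + 1) p) a b (u * SInf.s i) * cov a b (u * SInf.s i)) •
          Finsupp.single (SInf.swap a b * (u * SInf.s i)) 1 +
        if a = u.1 (i + 1) ∧ b = u.1 i then simpleSign i p • Finsupp.single u 1 else 0 := by
  have hi := SInf.lt_add_one i
  have hlen := SInf.len_eq_len_mul_s_add_one hu
  have hsign : monkSign (Equiv.swap i (i + 1) p) a b (u * SInf.s i) = monkSign p a b u := by
    simp only [monkSign, inv_mul_s, EmbeddingLike.apply_eq_iff_eq]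
  rw [hsign]
  by_cases h : a = u.1 (i + 1) ∧ b = u.1 i
  · rw [if_pos h]
    obtain ⟨rfl, rfl⟩ := h
    have h1 : ¬ Covers (u.1 (i + 1)) (u.1 i) u := fun hc => by
      have := hc.1
      rw [SInf.inv_apply, SInf.inv_apply] at this
      exact lt_asymm hi this
    have e : SInf.swap (u.1 (i + 1)) (u.1 i) * (u * SInf.s i) = u := by
      have := SInf.mul_swap_eq (u * SInf.s i) i (i + 1)
      rw [SInf.mul_s_apply_left, SInf.mul_s_apply_right] at this
      rw [← this]
      exact SInf.mul_s_mul_s u i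
    have h2 : Covers (u.1 (i + 1)) (u.1 i) (u * SInf.s i) := by
      refine covers_of_len hu ?_
      rw [e, hlen]
    rw [cov, if_neg h1, mul_zero, zero_smul, map_zero, cov, if_pos h2, e, mul_one, ← add_smul,
      monkSign, SInf.inv_apply, SInf.inv_apply, simpleSign, sub_add_sub_cancel', sub_self,
      zero_smul]
  · rw [if_neg h, add_zero, map_smul, descOp_single]
    have key : (Covers a b u ∧ (SInf.swap a b * u).1 (i + 1) < (SInf.swap a b * u).1 i) ↔
        Covers a b (u * SInf.s i) := by
      constructor
      · rintro ⟨hc, hd⟩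
        have := SInf.len_eq_len_mul_s_add_one hd
        refine covers_of_len hab ?_
        rw [← mul_assoc]
        have := hc.2
        omega
      · intro hc
        have hd : (SInf.swap a b * u).1 (i + 1) < (SInf.swap a b * u).1 i := by
          by_contra hd
          have ei : (u * SInf.s i).1⁻¹ (u.1 (i + 1)) = i := by
            rw [inv_mul_s, SInf.inv_apply, Equiv.swap_apply_right]
          have ei' : (u * SInf.s i).1⁻¹ (u.1 i) = i + 1 := by
            rw [inv_mul_s, SInf.inv_apply, Equiv.swap_apply_left]
          rcases SInf.swap_reverses hab hu hd with ⟨e1, e2⟩ | ⟨e1, e2, e3⟩ | ⟨e1, e2, e3⟩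
          · exact h ⟨e1.symm, e2.symm⟩
          · rw [e1] at ei
            refine hc.not_between e2 e3 ?_ ?_
            · rwa [ei, ei']
            · have := hc.1
              rw [ei] at this
              rw [ei']
              refine lt_of_le_of_ne (PNat.add_one_le_iff.2 this) fun h => e3.ne ?_
              exact ((u * SInf.s i).1⁻¹).injective (ei'.trans h)
          · rw [e1] at ei'
            refine hc.not_between e2 e3 ?_ ?_
            · have := hc.1
              rw [ei'] at this
              rw [ei]
              refine lt_of_le_of_ne (PNat.lt_add_one_iff.1 this) fun h => e2.ne ?_
              exact ((u * SInf.s i).1⁻¹).injective (h.trans ei.symm)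
            · rwa [ei, ei']
        have h1 := SInf.len_eq_len_mul_s_add_one hd
        have h2 := hc.2
        rw [← mul_assoc] at h2
        exact ⟨covers_of_len hab (by omega), hd⟩
    rw [← mul_assoc]
    by_cases hc : Covers a b (u * SInf.s i)
    · obtain ⟨h1, h2⟩ := key.2 hc
      rw [if_pos h2, cov, if_pos h1, cov, if_pos hc]
    · rw [cov, cov, if_neg hc, mul_zero, zero_smul]
      split_ifs with h1 h2
      · exact absurd (key.1 ⟨h1, h2⟩) hc
      · rw [smul_zero]
      · rw [mul_zero, zero_smul]
      · rw [smul_zero]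

/-- The Leibniz rule for `∂_i (x_p 𝔖_u)`, on the side of Monk's rule. -/
theorem descOp_monkSum {i p : ℕ+} {u : SInf} {B : ℕ}
    (hB : simpleSign i p = 0 ∨ ((u.1 i : ℕ+) : ℕ) ≤ B ∧ ((u.1 (i + 1) : ℕ+) : ℕ) ≤ B) :
    descOp i (monkSum p B (Finsupp.single u 1)) =
      monkSum (Equiv.swap i (i + 1) p) B (descOp i (Finsupp.single u 1)) +
        simpleSign i p • Finsupp.single u 1 := by
  have hB' : ∀ y, (y = u.1 i ∨ y = u.1 (i + 1)) →
      (simpleSign i p • Finsupp.single u 1 : SInf →₀ ℤ) = 0 ∨ (y : ℕ) ≤ B := by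
    rintro y hy
    rcases hB with h | ⟨h1, h2⟩
    · left; rw [h, zero_smul]
    · right; rcases hy with rfl | rfl <;> assumption
  rw [monkSum_single, map_sum, descOp_single]
  simp only [map_sum]
  rcases u.apply_lt_or i with hu | hu
  · rw [if_neg (lt_asymm hu), map_zero, zero_add]
    conv_rhs => rw [← sum_pairs_eq hu (hB' _ (Or.inr rfl))]
    exact Finset.sum_congr rfl fun m _ => Finset.sum_congr rfl fun a ha =>
      descOp_monk_of_lt hu (Finset.mem_Iio.1 ha)
  · rw [if_pos hu, monkSum_single]
    conv_rhs => rw [← sum_pairs_eq hu (hB' _ (Or.inl rfl))]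
    rw [← Finset.sum_add_distrib]
    refine Finset.sum_congr rfl fun m _ => ?_
    rw [← Finset.sum_add_distrib]
    exact Finset.sum_congr rfl fun a ha => descOp_monk_of_gt hu (Finset.mem_Iio.1 ha)

/-- Monk's rule for `x_p 𝔖_u`. Both sides have no constant term, and by the Leibniz rule and
induction on the length of `u`, they have the same divided differences. -/
theorem monk {n : ℕ} {u : SInf} (hu : InS n u) {p : ℕ+} (hp : (p : ℕ) ≤ n) {B : ℕ} (hB : n < B) :
    schubMap (monkSum p B (Finsupp.single u 1)) = MvPolynomial.X p * schubert u := by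
  induction hl : u.len using Nat.strong_induction_on generalizing u p with
  | _ l ih =>
    rw [← sub_eq_zero]
    apply eq_zero_of_dividedDiff
    · rw [map_sub, map_mul, MvPolynomial.constantCoeff_X, zero_mul, sub_zero,
        constantCoeff_schubMap, monkSum_single, Finsupp.finsetSum_apply]
      refine Finset.sum_eq_zero fun m _ => ?_
      rw [Finsupp.finsetSum_apply]
      refine Finset.sum_eq_zero fun a _ => ?_
      rw [Finsupp.smul_apply, cov]
      split_ifs with hc
      · rw [Finsupp.single_eq_of_ne', smul_zero]
        intro h1
        have := hc.2
        rw [h1, SInf.len_one] at this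
        omega
      · rw [mul_zero, zero_smul]
    · intro i
      have hsub : ∀ f g : Poly, dividedDiff i (f - g) = dividedDiff i f - dividedDiff i g :=
        fun f g => map_sub (dividedDiffLin i) f g
      have hrange : simpleSign i p = 0 ∨ (i : ℕ) + 1 ≤ B := by
        by_cases h : (i : ℕ) + 1 ≤ B
        · exact Or.inr h
        · left
          rw [simpleSign, if_neg, if_neg, sub_zero] <;> rintro rfl
          · rw [PNat.add_coe, PNat.one_coe] at hp
            omega
          · omega
      rw [hsub, dividedDiff_mul_X, dividedDiff_schubMap, descOp_monkSum, dividedDiff_schubert,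
        descOp_single, map_add, map_zsmul, schubMap_single]
      · have e : (if p = i then schubert u else 0) - (if p = i + 1 then schubert u else 0) =
            simpleSign i p • schubert u := by
          rw [simpleSign, sub_smul, ite_smul, ite_smul, one_smul, zero_smul]
          simp only [eq_comm]
        have e' : ∀ A c d Q : Poly, A + (c - d) - (Q + c - d) = A - Q := by intros; ring
        rw [← e, e']
        split_ifs with hd
        · have hin := hu.lt_of_descent hd
          have hlen := SInf.len_eq_len_mul_s_add_one hd
          have h1 : ((Equiv.swap i (i + 1) p : ℕ+) : ℕ) ≤ n := (inS_s hin).apply_le hp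
          rw [ih _ (by omega) (hu.mul (inS_s hin)) h1 rfl, sub_self]
        · rw [map_zero, map_zero, mul_zero, sub_self]
      · refine hrange.imp id fun h => ?_
        have hu' := hu.mono hB.le
        exact ⟨hu'.apply_le (by omega), hu'.apply_le (by rw [PNat.add_coe, PNat.one_coe]; omega)⟩

end Monk

/-! ### The Pieri rule for Schubert polynomials -/

section Pieri

/-- The indicator of the condition that the position of `a` is at most `k`, and that of `b` is
greater. -/
def straddle (k : ℕ) (a b : ℕ+) (u : SInf) : ℤ :=
  if ((u.1⁻¹ a : ℕ+) : ℕ) ≤ k ∧ k < ((u.1⁻¹ b : ℕ+) : ℕ) then 1 else 0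

/-- The sum of the covers of the `k`-Bruhat order with the label `b`. -/
def bruhatOp (k : ℕ) (b : ℕ+) : Module.End ℤ (SInf →₀ ℤ) :=
  opOf fun u => ∑ a ∈ Finset.Iio b,
    (straddle k a b u * cov a b u) • Finsupp.single (SInf.swap a b * u) 1

theorem bruhatOp_zero (b : ℕ+) : bruhatOp 0 b = 0 := by
  refine end_ext fun u => ?_
  rw [bruhatOp, opOf_single]
  refine Finset.sum_eq_zero fun a _ => ?_
  have := (u.1⁻¹ a).pos
  rw [straddle, if_neg (by omega), zero_mul, zero_smul]

theorem eq_succPNat_iff {k : ℕ} {a : ℕ+} : a = k.succPNat ↔ (a : ℕ) = k + 1 := by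
  rw [← PNat.coe_inj, Nat.succPNat_coe]

theorem bruhatOp_succ (k : ℕ) (b : ℕ+) :
    bruhatOp (k + 1) b = bruhatOp k b + monkOp k.succPNat b := by
  refine end_ext fun u => ?_
  rw [LinearMap.add_apply, bruhatOp, bruhatOp, monkOp, opOf_single, opOf_single, opOf_single,
    ← Finset.sum_add_distrib]
  refine Finset.sum_congr rfl fun a _ => ?_
  rw [← add_smul, ← add_mul, cov]
  by_cases hc : Covers a b u
  · congr 2
    have h : ((u.1⁻¹ a : ℕ+) : ℕ) < (u.1⁻¹ b : ℕ+) := hc.1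
    simp only [straddle, monkSign, eq_succPNat_iff]
    split_ifs <;> first | rfl | omega
  · rw [if_neg hc, mul_zero, mul_zero]

/-- After a step of Monk's rule for `x_{k+1}` with the label `b`, the value `b` stands at one of the
first `k + 1` positions. -/
theorem bruhatOp_mul_monkOp_self (k : ℕ) (b : ℕ+) :
    bruhatOp (k + 1) b * monkOp k.succPNat b = 0 := by
  refine end_ext fun u => ?_
  rw [Module.End.mul_apply, monkOp, opOf_single, map_sum, LinearMap.zero_apply]
  refine Finset.sum_eq_zero fun a' ha' => ?_
  rw [map_smul, bruhatOp, opOf_single, Finset.smul_sum]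
  refine Finset.sum_eq_zero fun a ha => ?_
  rw [smul_smul]
  by_cases hc : Covers a' b u
  · have h : ((u.1⁻¹ a' : ℕ+) : ℕ) < (u.1⁻¹ b : ℕ+) := hc.1
    by_cases hs : monkSign k.succPNat a' b u = 0
    · rw [hs, zero_mul, zero_mul, zero_smul]
    · rw [straddle, if_neg, zero_mul, mul_zero, zero_smul]
      rw [SInf.inv_swap_mul, SInf.inv_swap_mul, Equiv.swap_apply_right]
      rintro ⟨-, h2⟩
      apply hs
      simp only [monkSign, eq_succPNat_iff]
      rw [if_neg (by omega), if_neg (by omega), sub_zero]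
  · rw [cov, if_neg hc, mul_zero, zero_mul, zero_smul]

theorem swap_mul_swap_mul (a b a' b' : ℕ+) (u : SInf) (h1 : b' ≠ a) (h2 : b' ≠ b) :
    SInf.swap (Equiv.swap a b a') b' * (SInf.swap a b * u) =
      SInf.swap a b * (SInf.swap a' b' * u) := by
  rw [← mul_assoc, ← mul_assoc, SInf.mul_swap_eq (SInf.swap a b) a' b', SInf.swap_apply,
    SInf.swap_apply, Equiv.swap_apply_of_ne_of_ne h1 h2]

/-- The conditions in the two products of `bruhatOp_mul_monkOp` agree: both say that the
result is of length `ℓ(u) + 2`, apart from the positions of the values. -/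
theorem bruhat_monk_term (k : ℕ) {a b a' b' : ℕ+} (hab : a < b) (hbb : b < b') (ha' : a' < b')
    (u : SInf) :
    monkSign k.succPNat a' b' u * cov a' b' u *
        (straddle (k + 1) a b (SInf.swap a' b' * u) * cov a b (SInf.swap a' b' * u)) =
      straddle k a b u * cov a b u *
        (monkSign k.succPNat (Equiv.swap a b a') b' (SInf.swap a b * u) *
          cov (Equiv.swap a b a') b' (SInf.swap a b * u)) := by
  have hb1 : b' ≠ a := (hab.trans hbb).ne'
  have hb2 : b' ≠ b := hbb.ne'
  have hsa : Equiv.swap a b a' < b' := by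
    rw [Equiv.swap_apply_def]
    split_ifs
    · exact hbb
    · exact hab.trans hbb
    · exact ha'
  have hsign : monkSign k.succPNat (Equiv.swap a b a') b' (SInf.swap a b * u) =
      monkSign k.succPNat a' b' u := by
    simp only [monkSign, SInf.inv_swap_mul, Equiv.swap_apply_self,
      Equiv.swap_apply_of_ne_of_ne hb1 hb2]
  rw [hsign]
  by_cases hs : monkSign k.succPNat a' b' u = 0
  · rw [hs]; ring
  suffices h : cov a' b' u *
        (straddle (k + 1) a b (SInf.swap a' b' * u) * cov a b (SInf.swap a' b' * u)) =
      straddle k a b u * cov a b u * cov (Equiv.swap a b a') b' (SInf.swap a b * u) by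
    rw [mul_assoc, h]; ring
  have hk : ((u.1⁻¹ a' : ℕ+) : ℕ) = k + 1 ∨ ((u.1⁻¹ b' : ℕ+) : ℕ) = k + 1 := by
    by_contra hcon
    rw [not_or] at hcon
    apply hs
    simp only [monkSign, eq_succPNat_iff]
    rw [if_neg hcon.1, if_neg hcon.2, sub_zero]
  have key : (Covers a' b' u ∧ (((SInf.swap a' b' * u).1⁻¹ a : ℕ+) : ℕ) ≤ k + 1 ∧
        k + 1 < (((SInf.swap a' b' * u).1⁻¹ b : ℕ+) : ℕ) ∧ Covers a b (SInf.swap a' b' * u)) ↔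
      (((u.1⁻¹ a : ℕ+) : ℕ) ≤ k ∧ k < ((u.1⁻¹ b : ℕ+) : ℕ) ∧ Covers a b u ∧
        Covers (Equiv.swap a b a') b' (SInf.swap a b * u)) := by
    have hne : ∀ {c d : ℕ+}, c ≠ d → ((u.1⁻¹ c : ℕ+) : ℕ) ≠ (u.1⁻¹ d : ℕ+) := fun h h' =>
      h ((u.1⁻¹).injective (PNat.coe_injective h'))
    have hpos : ((u.1⁻¹ a' : ℕ+) : ℕ) < (u.1⁻¹ b' : ℕ+) →
        ((((SInf.swap a' b' * u).1⁻¹ a : ℕ+) : ℕ) ≤ k + 1 ∧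
          k + 1 < (((SInf.swap a' b' * u).1⁻¹ b : ℕ+) : ℕ) ↔
        ((u.1⁻¹ a : ℕ+) : ℕ) ≤ k ∧ k < ((u.1⁻¹ b : ℕ+) : ℕ)) := by
      intro h
      have n1 := hne hb1
      have n2 := hne hb2
      rw [SInf.inv_swap_mul, SInf.inv_swap_mul]
      rcases eq_or_ne a' a with rfl | h1
      · rw [Equiv.swap_apply_left, Equiv.swap_apply_of_ne_of_ne hab.ne' hb2.symm]
        omega
      · rcases eq_or_ne a' b with rfl | h2
        · rw [Equiv.swap_apply_left, Equiv.swap_apply_of_ne_of_ne h1.symm hb1.symm]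
          have n3 := hne h1
          omega
        · rw [Equiv.swap_apply_of_ne_of_ne h1.symm hb1.symm,
            Equiv.swap_apply_of_ne_of_ne h2.symm hb2.symm]
          have n3 := hne h1
          have n4 := hne h2
          omega
    have hend := swap_mul_swap_mul a b a' b' u hb1 hb2
    have hlen : ∀ {c d : ℕ+} {v : SInf}, c < d → v.1⁻¹ c < v.1⁻¹ d →
        v.len < (SInf.swap c d * v).len := fun h h' => SInf.len_lt_len_swap_mul h h'
    constructor
    · rintro ⟨h1, h2, h3, h4⟩
      obtain ⟨h5, h6⟩ := (hpos h1.1).1 ⟨h2, h3⟩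
      have h7 : u.1⁻¹ a < u.1⁻¹ b := PNat.coe_lt_coe _ _ |>.1 (by omega)
      have h8 : (SInf.swap a b * u).1⁻¹ (Equiv.swap a b a') < (SInf.swap a b * u).1⁻¹ b' := by
        rw [SInf.inv_swap_mul, SInf.inv_swap_mul, Equiv.swap_apply_self,
          Equiv.swap_apply_of_ne_of_ne hb1 hb2]
        exact h1.1
      have l1 := hlen hab h7
      have l2 := hlen hsa h8
      have l3 := h1.2
      have l4 := h4.2
      rw [hend] at l2
      exact ⟨h5, h6, ⟨h7, by omega⟩, ⟨h8, by rw [hend]; omega⟩⟩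
    · rintro ⟨h1, h2, h3, h4⟩
      have h5 : u.1⁻¹ a' < u.1⁻¹ b' := by
        have := h4.1
        rwa [SInf.inv_swap_mul, SInf.inv_swap_mul, Equiv.swap_apply_self,
          Equiv.swap_apply_of_ne_of_ne hb1 hb2] at this
      obtain ⟨h6, h7⟩ := (hpos h5).2 ⟨h1, h2⟩
      have h8 : (SInf.swap a' b' * u).1⁻¹ a < (SInf.swap a' b' * u).1⁻¹ b :=
        PNat.coe_lt_coe _ _ |>.1 (by omega)
      have l1 := hlen ha' h5
      have l2 := hlen hab h8
      have l3 := h3.2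
      have l4 := h4.2
      rw [hend] at l4
      exact ⟨⟨h5, by omega⟩, h6, h7, ⟨h8, by omega⟩⟩
  simp only [cov, straddle, ite_zero_mul_ite_zero, mul_one]
  exact if_congr (by rw [and_assoc, key, and_assoc, and_assoc]) rfl rfl

/-- The label operators for `k` and `k + 1` are intertwined by the terms of Monk's rule with larger
labels. The transposition `(a', b')` corresponds to its conjugate by `(a, b)`. -/
theorem bruhatOp_mul_monkOp (k : ℕ) {b b' : ℕ+} (hbb : b < b') :
    bruhatOp (k + 1) b * monkOp k.succPNat b' = monkOp k.succPNat b' * bruhatOp k b := by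
  refine end_ext fun u => ?_
  rw [Module.End.mul_apply, Module.End.mul_apply, monkOp, opOf_single, map_sum]
  have h1 : bruhatOp k b (Finsupp.single u 1) = ∑ a ∈ Finset.Iio b,
      (straddle k a b u * cov a b u) • Finsupp.single (SInf.swap a b * u) 1 := opOf_single _ u
  rw [h1, map_sum]
  simp only [map_smul, bruhatOp, opOf_single, Finset.smul_sum, smul_smul]
  rw [Finset.sum_comm]
  refine Finset.sum_congr rfl fun a ha => ?_
  have hab := Finset.mem_Iio.1 ha
  have hs : ∀ c ∈ Finset.Iio b', Equiv.swap a b c ∈ Finset.Iio b' := by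
    intro c hc
    rw [Finset.mem_Iio] at hc ⊢
    rw [Equiv.swap_apply_def]
    split_ifs
    · exact hbb
    · exact hab.trans hbb
    · exact hc
  refine Finset.sum_nbij' (Equiv.swap a b) (Equiv.swap a b) hs hs
    (fun c _ => Equiv.swap_apply_self a b c) (fun c _ => Equiv.swap_apply_self a b c) ?_
  intro a' ha'
  rw [bruhat_monk_term k hab hbb (Finset.mem_Iio.1 ha') u,
    swap_mul_swap_mul a b a' b' u (hab.trans hbb).ne' hbb.ne']

/-- The generating function of the label operators for `k + 1` is turned into that for `k` by the
factor `1 - t M`, where `M` is the operator of Monk's rule for `x_{k+1}`. So the generating function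
of the `h_m(x_1, …, x_k)` behaves under the factor `1 - t x_{k+1}`. -/
theorem labelPoly_bruhatOp (k : ℕ) {L : List ℕ+} (hL : L.Pairwise (· < ·)) :
    labelPoly (bruhatOp (k + 1)) L *
        (1 - Polynomial.C ((L.map (monkOp k.succPNat)).sum) * Polynomial.X) =
      labelPoly (bruhatOp k) L := by
  induction L with
  | nil => simp [labelPoly]
  | cons b L ih =>
    rw [List.pairwise_cons] at hL
    have h1 : bruhatOp (k + 1) b * (L.map (monkOp k.succPNat)).sum =
        (L.map (monkOp k.succPNat)).sum * bruhatOp k b := by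
      rw [← List.sum_map_mul_left, ← List.sum_map_mul_right]
      exact congrArg List.sum
        (List.map_congr_left fun b' hb' => bruhatOp_mul_monkOp k (hL.1 b' hb'))
    rw [labelPoly, labelPoly, ← ih hL.2, List.map_cons, List.sum_cons, mul_assoc, mul_assoc]
    congr 1
    have h2 := bruhatOp_mul_monkOp_self k b
    have h3 := bruhatOp_succ k b
    generalize (L.map (monkOp k.succPNat)).sum = S at *
    generalize bruhatOp (k + 1) b = A at *
    generalize bruhatOp k b = V at *
    generalize monkOp k.succPNat b = M at *
    have e : ∀ p q : Module.End ℤ (SInf →₀ ℤ), Polynomial.C p * Polynomial.X *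
        (Polynomial.C q * Polynomial.X) = Polynomial.C (p * q) * Polynomial.X ^ 2 := by
      intro p q
      rw [mul_assoc, ← mul_assoc Polynomial.X, Polynomial.X_mul, mul_assoc (Polynomial.C q),
        ← mul_assoc, ← Polynomial.C_mul, sq]
    rw [mul_sub, mul_one, add_mul, one_mul, e, mul_add, h2, zero_add, h1, sub_mul, one_mul, mul_add,
      mul_one, e, h3]
    simp only [Polynomial.C_add, add_mul]
    abel

/-- The recursion of the Pieri operators, which is also that of the `h_m(x_1, …, x_k)`. -/
theorem coeff_labelPoly_bruhatOp_succ (k m B : ℕ) :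
    (labelPoly (bruhatOp (k + 1)) (labels B)).coeff (m + 1) =
      (labelPoly (bruhatOp k) (labels B)).coeff (m + 1) +
        (labelPoly (bruhatOp (k + 1)) (labels B)).coeff m * monkSum k.succPNat B := by
  rw [← labelPoly_bruhatOp k (pairwise_labels B), mul_sub, mul_one, ← mul_assoc,
    Polynomial.coeff_sub, Polynomial.coeff_mul_X, Polynomial.coeff_mul_C]
  exact (sub_add_cancel _ _).symm

/-- Operators `F B` that realize the multiplication by `q` for all large `B`. -/
def Realizes (F : ℕ → Module.End ℤ (SInf →₀ ℤ)) (q : Poly) : Prop :=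
  ∀ f, ∀ᶠ B in Filter.atTop, schubMap (F B f) = q * schubMap f

theorem Realizes.mul {F G : ℕ → Module.End ℤ (SInf →₀ ℤ)} {p q : Poly} (hF : Realizes F p)
    (hG : Realizes G q) : Realizes (fun B => F B * G B) (p * q) := by
  intro f
  obtain ⟨B₀, hB₀⟩ := Filter.eventually_atTop.1 (hG f)
  filter_upwards [hF (G B₀ f), hG f] with B h1 h2
  have : G B f = G B₀ f := schubMap_injective (h2.trans (hB₀ B₀ le_rfl).symm)
  rw [Module.End.mul_apply, this, h1, hB₀ B₀ le_rfl, mul_assoc]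

theorem Realizes.add {F G : ℕ → Module.End ℤ (SInf →₀ ℤ)} {p q : Poly} (hF : Realizes F p)
    (hG : Realizes G q) : Realizes (fun B => F B + G B) (p + q) := by
  intro f
  filter_upwards [hF f, hG f] with B h1 h2
  rw [LinearMap.add_apply, map_add, h1, h2, add_mul]

theorem realizes_one : Realizes (fun _ => 1) 1 := fun f => by simp

theorem realizes_monkSum (p : ℕ+) : Realizes (monkSum p) (MvPolynomial.X p) := by
  intro f
  induction f using Finsupp.induction_linear with
  | zero => simp
  | add f g hf hg =>
    filter_upwards [hf, hg] with B h1 h2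
    rw [map_add, map_add, h1, h2, map_add, mul_add]
  | single u a =>
    filter_upwards [Filter.eventually_gt_atTop (max u.size p)] with B hB
    have h := monk ((inS_size u).mono (le_max_left _ (p : ℕ))) (le_max_right _ _) hB
    rw [← mul_one a, ← smul_eq_mul, ← Finsupp.smul_single, map_smul, map_smul, h, map_smul,
      schubMap_single, mul_smul_comm]

/-- The complete homogeneous symmetric polynomial `h_m(x_1, …, x_k)`. -/
def hPoly : ℕ → ℕ → Poly
  | _, 0 => 1
  | 0, _ + 1 => 0
  | k + 1, m + 1 => hPoly k (m + 1) + hPoly (k + 1) m * MvPolynomial.X k.succPNat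

/-- The Pieri rule for Schubert polynomials. -/
theorem realizes_hPoly (k m : ℕ) :
    Realizes (fun B => (labelPoly (bruhatOp k) (labels B)).coeff m) (hPoly k m) := by
  induction k generalizing m with
  | zero =>
    cases m with
    | zero => simpa only [labelPoly_coeff_zero, hPoly] using realizes_one
    | succ m =>
      have : ∀ B, labelPoly (bruhatOp 0) (labels B) = 1 := by
        intro B
        induction labels B with
        | nil => rfl
        | cons b L ih => simp [labelPoly, ih, bruhatOp_zero]
      intro f
      simp [this, Polynomial.coeff_one, hPoly]
  | succ k ih =>
    induction m with
    | zero => simpa only [labelPoly_coeff_zero, hPoly] using realizes_one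
    | succ m ih' =>
      simp only [coeff_labelPoly_bruhatOp_succ, hPoly]
      exact (ih (m + 1)).add (ih'.mul (realizes_monkSum _))

theorem realizes_blockOp (k : ℕ) (α : List ℕ) :
    Realizes (fun B => blockOp (fun m => (labelPoly (bruhatOp k) (labels B)).coeff m) α)
      (α.map (hPoly k)).prod := by
  induction α with
  | nil => exact realizes_one
  | cons m α ih =>
    rw [List.map_cons, List.prod_cons, mul_comm]
    exact ih.mul (realizes_hPoly k m)

/-- The coefficients of the products of Schubert polynomials and `h_α(x_1, …, x_k)`. -/
theorem schubertCoeff_hPoly (k : ℕ) (u : SInf) (α : List ℕ) (w : SInf) :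
    ∀ᶠ B in Filter.atTop, schubertCoeff (schubert u * (α.map (hPoly k)).prod) w =
      blockOp (fun m => (labelPoly (bruhatOp k) (labels B)).coeff m) α (Finsupp.single u 1) w := by
  filter_upwards [realizes_blockOp k α (Finsupp.single u 1)] with B h
  rw [schubMap_single] at h
  rw [mul_comm, ← h, schubertCoeff_schubMap]

end Pieri

/-! ### Intervals of the `k`-Bruhat order -/

section KBruhatIntervals

/-- `z` covers `x` in the `k`-Bruhat order, with the label `b`. -/
def BruhatStep (k : ℕ+) (x : SInf) (b : ℕ+) (z : SInf) : Prop :=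
  ∃ a < b, z = SInf.swap a b * x ∧ Covers a b x ∧ x.1⁻¹ a ≤ k ∧ k < x.1⁻¹ b

variable {k : ℕ+} {u w x z : SInf} {b : ℕ+}

theorem BruhatStep.kBruhat (h : BruhatStep k x b z) : KBruhat k x z := by
  obtain ⟨a, hab, rfl, hc, ha, hb⟩ := h
  have hval : ∀ i, (SInf.swap a b * x).1 i = Equiv.swap a b (x.1 i) := fun i => rfl
  have hpos : ∀ {i c}, x.1 i = c → i = x.1⁻¹ c := by
    rintro i _ rfl
    rw [SInf.inv_apply]
  refine ⟨fun i j hi hj => ⟨?_, ?_⟩, fun i j hij hx hz => ?_⟩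
  · rw [hval, Equiv.swap_apply_def]
    split_ifs with h1 h2
    · exact h1 ▸ hab.le
    · rw [hpos h2] at hi
      exact absurd hb (not_lt.2 hi)
    · exact le_rfl
  · rw [hval, Equiv.swap_apply_def]
    split_ifs with h1 h2
    · rw [hpos h1] at hj
      exact absurd hj (not_lt.2 ha)
    · exact h2 ▸ hab.le
    · exact le_rfl
  · rw [hval, hval] at hz
    rcases SInf.swap_reverses hab hx (lt_asymm hz) with ⟨e1, e2⟩ | ⟨e1, e2, e3⟩ | ⟨e1, e2, e3⟩
    · rw [hpos e1, hpos e2]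
      exact ⟨ha, hb⟩
    · rw [hpos e1] at hij ⊢
      refine ⟨ha, ?_⟩
      by_contra hcon
      refine hc.not_between e2 e3 ?_ ?_ <;> rw [SInf.inv_apply]
      · exact hij
      · exact (not_lt.1 hcon).trans_lt hb
    · rw [hpos e1] at hij ⊢
      refine ⟨?_, hb⟩
      by_contra hcon
      refine hc.not_between e2 e3 ?_ ?_ <;> rw [SInf.inv_apply]
      · exact ha.trans_lt (not_le.1 hcon)
      · exact hij

/-- A nontrivial permutation raises some value, and there is a greatest such value. -/
theorem exists_max_raised {ζ : SInf} (hζ : ζ ≠ 1) :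
    ∃ a, a < ζ.1 a ∧ ∀ c, a < c → ζ.1 c ≤ c := by
  have hne : ∃ a, a < ζ.1 a := by
    by_contra hcon
    push Not at hcon
    apply hζ
    refine SInf.ext_apply fun i => ?_
    change ζ.1 i = i
    induction i using PNat.strongInductionOn with
    | _ i ih =>
      rcases (hcon i).lt_or_eq with h | h
      · exact absurd (ζ.1.injective (ih _ h)) h.ne
      · exact h
  obtain ⟨n, hn⟩ := ζ.exists_bound
  have hle : ∀ a, a < ζ.1 a → (a : ℕ) ≤ n := by
    intro a ha
    by_contra hcon
    rw [hn a (by omega)] at ha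
    exact lt_irrefl _ ha
  have hfin : {a | a < ζ.1 a}.Finite := (Set.finite_Iic n.succPNat).subset fun a ha => by
    rw [Set.mem_Iic, ← PNat.coe_le_coe, Nat.succPNat_coe]
    exact (hle a ha).trans (Nat.le_succ n)
  obtain ⟨a, ha, hmax⟩ := hfin.exists_maximal hne
  refine ⟨a, ha, fun c hc => not_lt.1 fun h => ?_⟩
  exact absurd (hmax h hc.le) (not_le.2 hc)

theorem exists_lowered {ζ : SInf} {a : ℕ+} (ha : a < ζ.1 a) : ∃ b, a < b ∧ ζ.1 b ≤ a := by
  by_contra hcon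
  push Not at hcon
  -- otherwise `ζ⁻¹` maps `{1, …, a}` into itself without attaining `a`
  have hmaps : ∀ c ∈ Finset.Iic a, ζ.1⁻¹ c ∈ (Finset.Iic a).erase a := by
    intro c hc
    rw [Finset.mem_Iic] at hc
    rw [Finset.mem_erase, Finset.mem_Iic]
    constructor
    · intro h
      rw [Equiv.Perm.inv_eq_iff_eq] at h
      rw [h] at hc
      exact absurd ha (not_lt.2 hc)
    · by_contra h
      have := hcon _ (not_le.1 h)
      rw [SInf.apply_inv] at this
      exact absurd this (not_lt.2 hc)
  have h1 := Finset.card_le_card_of_injOn _ hmaps ((ζ.1⁻¹).injective.injOn)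
  have h2 := Finset.card_erase_lt_of_mem (Finset.mem_Iic.2 (le_refl a))
  omega

/-- An element of the `k`-Bruhat order that is smaller than `w` has a cover that is at most `w`. -/
theorem KBruhat.exists_step (h : KBruhat k u w) (hne : u ≠ w) :
    ∃ b z, BruhatStep k u b z ∧ KBruhat k z w := by
  set ζ := w * u⁻¹ with hζ
  have hζu : ∀ i, ζ.1 (u.1 i) = w.1 i := fun i => by
    rw [hζ, SInf.mul_apply, SInf.inv_apply', SInf.inv_apply]
  have hζ' : ∀ c, ζ.1 c = w.1 (u.1⁻¹ c) := fun c => rfl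
  -- `A` is the greatest value that `ζ` raises, and `B` the least value above `A` with `ζ B ≤ A`;
  -- the values in between are fixed, and the step is the transposition of `A` and `B`
  obtain ⟨A, hA, hmax⟩ := exists_max_raised (ζ := ζ) fun h1 => hne (by
    rw [hζ, mul_inv_eq_one] at h1; exact h1.symm)
  have hex : ∃ n : ℕ, ∃ b : ℕ+, (b : ℕ) = n ∧ A < b ∧ ζ.1 b ≤ A := by
    obtain ⟨b, hb⟩ := exists_lowered hA
    exact ⟨b, b, rfl, hb⟩
  obtain ⟨B, hBn, hAB, hB⟩ := Nat.find_spec hex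
  have hmin : ∀ c, A < c → c < B → A < ζ.1 c := by
    intro c h1 h2
    by_contra hcon
    refine Nat.find_min hex (m := c) ?_ ⟨c, rfl, h1, not_lt.1 hcon⟩
    rw [← hBn]
    exact h2
  have hfix : ∀ c, A < c → c < B → ζ.1 c = c := by
    intro c
    induction c using PNat.strongInductionOn with
    | _ c ih =>
      intro h1 h2
      rcases (hmax c h1).lt_or_eq with h3 | h3
      · have h4 := ih _ h3 (hmin c h1 h2) (h3.trans h2)
        exact absurd (ζ.1.injective h4) h3.ne
      · exact h3
  have hAB' : B ≤ ζ.1 A := by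
    by_contra hcon
    have := hfix _ hA (not_le.1 hcon)
    exact hA.ne' (ζ.1.injective this)
  have hpA : u.1⁻¹ A ≤ k := by
    by_contra hcon
    have := h.le_right (not_le.1 hcon)
    rw [← hζ', SInf.apply_inv] at this
    exact absurd hA (not_lt.2 this)
  have hpB : k < u.1⁻¹ B := by
    by_contra hcon
    have := h.le_left (not_lt.1 hcon)
    rw [← hζ', SInf.apply_inv] at this
    exact absurd (hB.trans_lt hAB) (not_lt.2 this)
  have hc : Covers A B u := by
    have hlt := hpA.trans_lt hpB
    refine ⟨hlt, (SInf.len_swap_mul_iff hAB hlt).2 ?_⟩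
    rintro c h1 h2 ⟨h3, h4⟩
    rcases le_or_gt (u.1⁻¹ c) k with h5 | h5
    · by_cases h6 : ζ.1 c < ζ.1 A
      · have := (h.2 _ _ h3 (by rwa [SInf.apply_inv, SInf.apply_inv]) h6).2
        exact absurd h5 (not_le.2 this)
      · rw [hfix c h1 h2] at h6
        exact h6 (h2.trans_le hAB')
    · have h6 : ζ.1 B < ζ.1 c := hB.trans_lt (hmin c h1 h2)
      have := (h.2 _ _ h4 (by rwa [SInf.apply_inv, SInf.apply_inv]) h6).1
      exact absurd h5 (not_lt.2 this)
  refine ⟨B, SInf.swap A B * u, ⟨A, hAB, rfl, hc, hpA, hpB⟩, ?_⟩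
  have hval : ∀ i, (SInf.swap A B * u).1 i = Equiv.swap A B (u.1 i) := fun i => rfl
  refine ⟨fun i j hi hj => ⟨?_, ?_⟩, fun i j hij hz hw => ?_⟩
  · rw [hval, Equiv.swap_apply_def]
    split_ifs with h1 h2
    · rw [← hζu, h1]; exact hAB'
    · rw [← h2, SInf.inv_apply] at hpB
      exact absurd hi (not_le.2 hpB)
    · exact h.le_left hi
  · rw [hval, Equiv.swap_apply_def]
    split_ifs with h1 h2
    · rw [← h1, SInf.inv_apply] at hpA
      exact absurd hj (not_lt.2 hpA)
    · rw [← hζu, h2]; exact hB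
    · exact h.le_right hj
  · by_cases hu : u.1 i < u.1 j
    · exact h.2 i j hij hu hw
    · exfalso
      have hu' : u.1 j < u.1 i := lt_of_le_of_ne (not_lt.1 hu) fun h => hij.ne' (u.1.injective h)
      rw [hval, hval] at hz
      rcases SInf.swap_reverses hAB hu' (lt_asymm hz) with
        ⟨e1, e2⟩ | ⟨e1, e2, e3⟩ | ⟨e1, e2, e3⟩
      · rw [← e1, SInf.inv_apply] at hpA
        rw [← e2, SInf.inv_apply] at hpB
        exact lt_asymm hij (hpA.trans_lt hpB)
      · have h1 := hfix _ e2 e3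
        rw [hζu] at h1
        rw [← e1, hζu] at hAB'
        rw [h1] at hw
        exact lt_asymm hw (e3.trans_le hAB')
      · have h1 := hfix _ e2 e3
        rw [hζu] at h1
        rw [← e1, hζu] at hB
        rw [h1] at hw
        exact lt_asymm hw (hB.trans_lt e2)

theorem reach_bruhatStep_iff : Reach (BruhatStep k) u w ↔ KBruhat k u w := by
  constructor
  · rintro ⟨p, hp, rfl⟩
    induction p generalizing u with
    | nil => exact KBruhat.refl k u
    | cons e p ih => exact hp.1.kBruhat.trans (ih hp.2)
  · intro h
    induction hn : {v | KBruhat k u v ∧ KBruhat k v w}.ncard using Nat.strong_induction_on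
      generalizing u with
    | _ n ih =>
      by_cases hne : u = w
      · rw [hne]; exact Reach.refl w
      · obtain ⟨b, z, hz, hzw⟩ := h.exists_step hne
        refine (Reach.single hz).trans (ih _ ?_ hzw rfl)
        rw [← hn]
        have hfin : {v | KBruhat k u v ∧ KBruhat k v w}.Finite :=
          (kBruhatInterval k u w).finite
        refine Set.ncard_lt_ncard ⟨fun v hv => ⟨hz.kBruhat.trans hv.1, hv.2⟩, fun hcon => ?_⟩ hfin
        have h1 : KBruhat k z u := (hcon ⟨KBruhat.refl k u, h⟩).1
        have h2 := hz.kBruhat.antisymm h1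
        obtain ⟨a, hab, rfl, hc, -⟩ := hz
        have := hc.2
        rw [← h2] at this
        omega

theorem swap_right_unique {a b a' b' : ℕ+} (hab : a < b) (hab' : a' < b')
    (h : SInf.swap a b = SInf.swap a' b') : b = b' := by
  have h1 : ∀ i, Equiv.swap a b i = Equiv.swap a' b' i := fun i => by
    rw [← SInf.swap_apply, h, SInf.swap_apply]
  have h2 := h1 b
  have h3 := h1 a
  rw [Equiv.swap_apply_right, Equiv.swap_apply_def] at h2
  rw [Equiv.swap_apply_left, Equiv.swap_apply_def] at h3
  grind

theorem transpositionLabel_eq {a b : ℕ+} (hab : a < b) (h : w * u⁻¹ = SInf.swap a b) :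
    transpositionLabel u w = ((b : ℕ) : ℤ) := by
  obtain ⟨a', b', hab', h', hl⟩ := Classical.epsilon_spec
    (p := fun l : ℤ => ∃ a b : ℕ+, a < b ∧ w * u⁻¹ = SInf.swap a b ∧ l = ((b : ℕ) : ℤ))
    ⟨_, a, b, hab, h, rfl⟩
  rw [transpositionLabel, hl, swap_right_unique hab' hab (h'.symm.trans h)]

theorem BruhatStep.label_eq (h : BruhatStep k x b z) :
    transpositionLabel x z = ((b : ℕ) : ℤ) := by
  obtain ⟨a, hab, rfl, -⟩ := h
  exact transpositionLabel_eq hab (mul_inv_cancel_right _ _)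

theorem strictMono_label : StrictMono fun b : ℕ+ => ((b : ℕ) : ℤ) := fun _ _ hab =>
  Int.ofNat_lt.2 hab

theorem isPathInterval_kBruhat (h : KBruhat k u w) :
    IsPathInterval (kBruhatInterval k u w) (BruhatStep k) (fun b => ((b : ℕ) : ℤ))
      Subtype.val SInf.len u w where
  inj := Subtype.val_injective
  mem_range v := by
    rw [reach_bruhatStep_iff, reach_bruhatStep_iff]
    exact ⟨fun ⟨p, hp⟩ => hp ▸ p.2, fun hv => ⟨⟨v, hv⟩, rfl⟩⟩
  le_iff p q := reach_bruhatStep_iff.symm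
  rank_step v b z hz := by
    obtain ⟨a, -, rfl, hc, -⟩ := hz
    exact hc.2
  label_eq _ _ hl := hl.label_eq
  reach := reach_bruhatStep_iff.2 h

theorem not_bruhatStep_bruhatStep {v : SInf} (h : BruhatStep k x b z) : ¬ BruhatStep k z b v := by
  obtain ⟨a, hab, rfl, -, ha, -⟩ := h
  rintro ⟨a', -, -, -, -, hb⟩
  rw [SInf.inv_swap_mul, Equiv.swap_apply_right] at hb
  exact absurd ha (not_le.2 hb)

/-- The covers of `x` in the `k`-Bruhat order with the label `b`. -/
def bruhatOut (k b : ℕ+) (x : SInf) : Finset SInf :=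
  ((Finset.Iio b).filter fun a => Covers a b x ∧ x.1⁻¹ a ≤ k ∧ k < x.1⁻¹ b).image
    fun a => SInf.swap a b * x

theorem mem_bruhatOut : z ∈ bruhatOut k b x ↔ BruhatStep k x b z := by
  simp only [bruhatOut, Finset.mem_image, Finset.mem_filter, Finset.mem_Iio, BruhatStep]
  constructor
  · rintro ⟨a, ⟨h1, h2⟩, rfl⟩
    exact ⟨a, h1, rfl, h2⟩
  · rintro ⟨a, h1, rfl, h2⟩
    exact ⟨a, ⟨h1, h2⟩, rfl⟩

theorem bruhatOp_single_one (k b : ℕ+) (x : SInf) :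
    bruhatOp k b (Finsupp.single x 1) = ∑ z ∈ bruhatOut k b x, Finsupp.single z 1 := by
  rw [bruhatOp, opOf_single, bruhatOut, Finset.sum_image, Finset.sum_filter]
  · refine Finset.sum_congr rfl fun a _ => ?_
    simp only [straddle, cov, PNat.coe_le_coe, PNat.coe_lt_coe, ite_zero_mul_ite_zero, mul_one,
      ite_smul, one_smul, zero_smul]
    exact if_congr and_comm rfl rfl
  · intro a ha a' ha' h
    have h1 := congrArg (fun v : SInf => v.1 b) (mul_right_cancel h)
    rwa [SInf.swap_apply, SInf.swap_apply, Equiv.swap_apply_right, Equiv.swap_apply_right] at h1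

theorem label_le_of_isPath {n : ℕ} {p : List (ℕ+ × SInf)} (hp : IsPath (BruhatStep k) u p)
    (hu : InS n u) (hw : InS n (endpt u p)) : ∀ e ∈ p, (e.1 : ℕ) ≤ n := by
  induction p generalizing u with
  | nil => simp
  | cons e p ih =>
    have h1 : KBruhat k e.2 (endpt u (e :: p)) := reach_bruhatStep_iff.1 ⟨p, hp.2, rfl⟩
    have h2 : InS n e.2 := fun i hi => by
      rw [hp.1.kBruhat.apply_eq h1 ((hw i hi).trans (hu i hi).symm), hu i hi]
    intro e' he'
    rcases List.mem_cons.1 he' with rfl | he'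
    · obtain ⟨a, hab, hz, -⟩ := hp.1
      have h3 : InS n (SInf.swap a e'.1) := by
        have := h2.mul hu.inv
        rwa [hz, mul_inv_cancel_right] at this
      by_contra hcon
      have := h3 e'.1 (by omega)
      rw [SInf.swap_apply, Equiv.swap_apply_right] at this
      exact hab.ne this
    · exact ih hp.2 h2 hw e' he'

/-- The number of chains in `H_α([u, w]_k)` is the coefficient of `𝔖_w` in
`𝔖_u h_α(x_1, …, x_k)`. -/
theorem ncard_H_kBruhat (h : KBruhat k u w) (α : List ℕ) :
    (((kBruhatInterval k u w).H α).ncard : ℤ) =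
      schubertCoeff (schubert u * (α.map (hPoly k)).prod) w := by
  obtain ⟨B, hB, hB'⟩ := ((schubertCoeff_hPoly k u α w).and
    (Filter.eventually_ge_atTop (max u.size w.size))).exists
  have hu : InS B u := (inS_size u).mono ((le_max_left _ _).trans hB')
  have hw : InS B w := (inS_size w).mono ((le_max_right _ _).trans hB')
  rw [hB]
  refine (isPathInterval_kBruhat h).ncard_H_eq strictMono_label
    (countsPaths_coeff (fun b x z => mem_bruhatOut) (bruhatOp_single_one k)
      (fun _ _ _ _ => not_bruhatStep_bruhatStep) (pairwise_labels B)) ?_ α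
  intro p hp hpw e he
  exact mem_labels.2 (label_le_of_isPath hp hu (hpw ▸ hw) e he)

theorem isSymmetric_kBruhatInterval (h : KBruhat k u w) :
    (kBruhatInterval k u w).IsSymmetric := by
  refine ⟨(isPathInterval_kBruhat h).isRanked, fun α β hαβ => ?_⟩
  have := ncard_H_kBruhat h α
  rw [(hαβ.map (hPoly k)).prod_eq, ← ncard_H_kBruhat h β] at this
  exact_mod_cast this

end KBruhatIntervals

/-! ### The skew Schubert function of an interval of the `k`-Bruhat order -/

section SkewSchubertFunction

/-- The exponent `d` involves only the variables `x_1, …, x_k`. -/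
def Within (k : ℕ) (d : ℕ+ →₀ ℕ) : Prop := ∀ i ∈ d.support, (i : ℕ) ≤ k

theorem within_add {k : ℕ} {d e : ℕ+ →₀ ℕ} : Within k (d + e) ↔ Within k d ∧ Within k e := by
  simp only [Within, Finsupp.mem_support_iff, Finsupp.add_apply]
  constructor
  · exact fun h => ⟨fun i hi => h i (by omega), fun i hi => h i (by omega)⟩
  · rintro ⟨h1, h2⟩ i hi
    by_cases h : d i = 0
    · exact h2 i (by omega)
    · exact h1 i h

/-- The polynomial `p` is `f(x_1, …, x_k, 0, 0, …)`. -/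
def Restricts (k : ℕ) (f : Series) (p : Poly) : Prop :=
  ∀ d, p.coeff d = if Within k d then MvPowerSeries.coeff d f else 0

variable {k : ℕ} {f g : Series} {p q : Poly}

theorem Restricts.unique (hp : Restricts k f p) (hq : Restricts k f q) : p = q :=
  MvPolynomial.ext _ _ fun d => (hp d).trans (hq d).symm

theorem restricts_zero : Restricts k 0 0 := fun d => by simp

theorem restricts_one : Restricts k 1 1 := by
  intro d
  rw [MvPolynomial.coeff_one, MvPowerSeries.coeff_one]
  by_cases h : d = 0
  · subst h
    rw [if_pos rfl, if_pos]
    intro i hi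
    simp at hi
  · rw [if_neg (Ne.symm h), if_neg h, ite_self]

theorem Restricts.add (hf : Restricts k f p) (hg : Restricts k g q) :
    Restricts k (f + g) (p + q) := by
  intro d
  rw [MvPolynomial.coeff_add, hf d, hg d, map_add]
  split_ifs <;> simp

theorem Restricts.neg (hf : Restricts k f p) : Restricts k (-f) (-p) := by
  intro d
  rw [MvPolynomial.coeff_neg, hf d, map_neg]
  split_ifs <;> simp

theorem Restricts.mul (hf : Restricts k f p) (hg : Restricts k g q) :
    Restricts k (f * g) (p * q) := by
  intro d
  rw [MvPolynomial.coeff_mul, MvPowerSeries.coeff_mul]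
  split_ifs with h
  · refine Finset.sum_congr rfl fun x hx => ?_
    rw [← Finset.HasAntidiagonal.mem_antidiagonal.1 hx, within_add] at h
    rw [hf, hg, if_pos h.1, if_pos h.2]
  · refine Finset.sum_eq_zero fun x hx => ?_
    rw [← Finset.HasAntidiagonal.mem_antidiagonal.1 hx, within_add, not_and_or] at h
    rw [hf, hg]
    rcases h with h | h
    · rw [if_neg h, zero_mul]
    · rw [if_neg h, mul_zero]

theorem restricts_hSym (k m : ℕ) : Restricts k (hSym m) (hPoly k m) := by
  have hc : ∀ (m : ℕ) (d : ℕ+ →₀ ℕ), MvPowerSeries.coeff d (hSym m) =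
      if d.degree = m then 1 else 0 := fun m d => rfl
  have h0 : ∀ k, Restricts k (hSym 0) 1 := by
    intro k
    have : hSym 0 = 1 := by
      refine MvPowerSeries.ext fun d => ?_
      rw [MvPowerSeries.coeff_one, hc]
      simp only [Finsupp.degree_eq_zero_iff]
    rw [this]
    exact restricts_one
  induction k generalizing m with
  | zero =>
    cases m with
    | zero => simpa only [hPoly] using h0 0
    | succ m =>
      intro d
      rw [hPoly, MvPolynomial.coeff_zero, hc]
      split_ifs with h1 h2
      · have : d = 0 := by
          rw [← Finsupp.support_eq_empty, Finset.eq_empty_iff_forall_notMem]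
          intro i hi
          have := h1 i hi
          have := i.pos
          omega
        rw [this, map_zero] at h2
        omega
      · rfl
      · rfl
  | succ k ih =>
    induction m with
    | zero => simpa only [hPoly] using h0 (k + 1)
    | succ m ih' =>
      intro d
      have hkk : ∀ i : ℕ+, (i : ℕ) ≤ k + 1 → i ≠ k.succPNat → (i : ℕ) ≤ k := by
        intro i h1 h2
        by_contra h
        exact h2 (eq_succPNat_iff.2 (by omega))
      rw [hPoly, MvPolynomial.coeff_add, MvPolynomial.coeff_mul_X', ih (m + 1) d, hc]
      by_cases hd : k.succPNat ∈ d.support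
      · have h1 : ¬ Within k d := fun h => by
          have := h _ hd
          rw [Nat.succPNat_coe] at this
          omega
        rw [if_neg h1, zero_add, if_pos hd, ih', hc]
        set e := d - Finsupp.single k.succPNat 1 with he
        have hde : d = e + Finsupp.single k.succPNat 1 := by
          rw [he, tsub_add_cancel_of_le]
          rw [Finsupp.single_le_iff]
          exact Nat.one_le_iff_ne_zero.2 (Finsupp.mem_support_iff.1 hd)
        have hs : Within (k + 1) (Finsupp.single k.succPNat 1) := by
          intro i hi
          rw [Finsupp.support_single _ one_ne_zero, Finset.mem_singleton] at hi
          rw [hi, Nat.succPNat_coe]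
        rw [hde, map_add, Finsupp.degree_single]
        exact if_congr (by rw [within_add]; exact ⟨fun h => ⟨h, hs⟩, fun h => h.1⟩)
          (if_congr Nat.add_right_cancel_iff.symm rfl rfl) rfl
      · rw [if_neg hd, add_zero]
        refine if_congr ⟨fun h i hi => (h i hi).trans (Nat.le_succ k), fun h i hi => ?_⟩ rfl rfl
        exact hkk i (h i hi) fun h' => hd (h' ▸ hi)

theorem restricts_hList (k : ℕ) (α : List ℕ) :
    Restricts k (hList α) (α.map (hPoly k)).prod := by
  induction α with
  | nil => exact restricts_one
  | cons m α ih =>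
    rw [hList, List.map_cons, List.prod_cons, List.map_cons, List.prod_cons]
    exact (restricts_hSym k m).mul ih

theorem restricts_schur (lam : YoungDiagram) (k : ℕ+) :
    Restricts k (schur lam) (schurPoly lam k) := by
  have hcell : Finite (SkewCell lam ⊥) :=
    ((lam.cells.finite_toSet).subset (fun c hc => hc.1) :
      {c | c ∈ lam ∧ c ∉ (⊥ : YoungDiagram)}.Finite)
  have := Fintype.ofFinite (SkewCell lam ⊥)
  have hfin : {T : SkewCell lam ⊥ → ℕ+ | IsSSYT T ∧ ∀ c, T c ≤ k}.Finite :=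
    (Set.Finite.pi' fun _ => Set.finite_Iic k).subset fun T hT => hT.2
  intro d
  have hprod : ∀ T : SkewCell lam ⊥ → ℕ+, ∏ᶠ c, (MvPolynomial.X (T c) : Poly) =
      MvPolynomial.monomial (∑ c, Finsupp.single (T c) 1) 1 := by
    intro T
    rw [finprod_eq_prod_of_fintype, MvPolynomial.monomial_sum_one]
    rfl
  have hcont : ∀ T : SkewCell lam ⊥ → ℕ+,
      ∑ c, Finsupp.single (T c) 1 = d ↔ ∀ i, {c | T c = i}.ncard = d i := by
    intro T
    rw [Finsupp.ext_iff]
    refine forall_congr' fun i => ?_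
    rw [Finsupp.finsetSum_apply, Set.ncard_eq_toFinset_card', Set.toFinset_ofPred,
      Finset.card_filter]
    simp only [Finsupp.single_apply]
  rw [schurPoly, finsum_mem_eq_finite_toFinset_sum _ hfin, MvPolynomial.coeff_sum]
  simp only [hprod, MvPolynomial.coeff_monomial, hcont]
  rw [← Finset.sum_filter, Finset.sum_const, nsmul_eq_mul, mul_one]
  split_ifs with h
  · change _ = ((_ : ℕ) : ℤ)
    congr 1
    rw [← Set.ncard_coe_finset]
    congr 1
    ext T
    simp only [Finset.coe_filter, Set.Finite.mem_toFinset, Set.mem_ofPred_eq]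
    constructor
    · exact fun hT => ⟨hT.1.1, hT.2⟩
    · refine fun hT => ⟨⟨hT.1, fun c => ?_⟩, hT.2⟩
      refine h (T c) (Finsupp.mem_support_iff.2 ?_)
      rw [← hT.2]
      exact (Set.ncard_ne_zero_of_mem (a := c) rfl)
  · rw [Finset.filter_false_of_mem, Finset.card_empty, Nat.cast_zero]
    rintro T hT hT'
    apply h
    intro i hi
    rw [Finsupp.mem_support_iff, ← hT'] at hi
    obtain ⟨c, rfl⟩ := Set.nonempty_of_ncard_ne_zero hi
    exact ((hfin.mem_toFinset).1 hT).2 c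

variable {κ : ℕ+} {u w : SInf}

/-- More generally, the value of `χ_P` at `f ∈ Λ` is the coefficient of `𝔖_w` in
`𝔖_u f(x_1, …, x_k)`: for `f = h_α` this is `ncard_H_kBruhat`, and both sides are additive. -/
theorem chi_schur_kBruhat (h : KBruhat κ u w) (lam : YoungDiagram) :
    (kBruhatInterval κ u w).chi ⟨schur lam, schur_mem lam⟩ = schubertSchurCoeff κ u w lam := by
  set P := kBruhatInterval κ u w with hP
  have hsym : P.IsSymmetric := isSymmetric_kBruhatInterval h
  obtain ⟨hf, p, hp, g, hg, hχ⟩ := Λ_induction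
    (p := fun f => ∃ hf : f ∈ Λ, ∃ p, Restricts κ f p ∧ ∃ g, schubMap g = schubert u * p ∧
      P.chi ⟨f, hf⟩ = g w) (fun α => by
        refine ⟨hList_mem α, _, restricts_hList κ α, ?_⟩
        obtain ⟨B, hB⟩ := (realizes_blockOp κ α (Finsupp.single u 1)).exists
        rw [schubMap_single, mul_comm] at hB
        refine ⟨_, hB, ?_⟩
        rw [LabeledPoset.chi_hList hsym, ncard_H_kBruhat h, ← hB, schubertCoeff_schubMap])
    ⟨zero_mem _, 0, restricts_zero, 0, by rw [map_zero, mul_zero], map_zero P.chi⟩ (by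
      rintro f f' ⟨hf, p, hp, g, hg, hχ⟩ ⟨hf', p', hp', g', hg', hχ'⟩
      refine ⟨add_mem hf hf', _, hp.add hp', g + g', by rw [map_add, hg, hg', mul_add], ?_⟩
      have : (⟨f + f', add_mem hf hf'⟩ : Λ) = ⟨f, hf⟩ + ⟨f', hf'⟩ := rfl
      rw [this, map_add, hχ, hχ', Finsupp.add_apply]) (by
      rintro f ⟨hf, p, hp, g, hg, hχ⟩
      refine ⟨neg_mem hf, _, hp.neg, -g, by rw [map_neg, hg, mul_neg], ?_⟩
      have : (⟨-f, neg_mem hf⟩ : Λ) = -⟨f, hf⟩ := rfl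
      rw [this, map_neg, hχ, Finsupp.neg_apply]) (schur_mem lam)
  rw [hχ, schubertSchurCoeff, ← hp.unique (restricts_schur lam κ), ← hg, schubertCoeff_schubMap]

/-- `S_lam` is a combination of the `h_α` with `∑ α_i = |lam|`. -/
theorem LabeledPoset.chi_schur_eq_zero {P : LabeledPoset.{u}} (hP : P.IsSymmetric)
    {lam : YoungDiagram} (h : lam.card ≠ P.rank) : P.chi ⟨schur lam, schur_mem lam⟩ = 0 := by
  have key : ∀ x ∈ Submodule.span ℤ {f | ∃ α : List ℕ, α.sum = lam.card ∧ f = hList α},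
      ∃ hx : x ∈ Λ, P.chi ⟨x, hx⟩ = 0 := by
    intro x hx
    induction hx using Submodule.span_induction with
    | mem x hx =>
      obtain ⟨α, hα, rfl⟩ := hx
      refine ⟨hList_mem α, ?_⟩
      rw [chi_hList hP, H_eq_empty hP (by rwa [hα]), Set.ncard_empty, Nat.cast_zero]
    | zero => exact ⟨zero_mem _, map_zero P.chi⟩
    | add x y _ _ hx hy =>
      obtain ⟨hx, ex⟩ := hx
      obtain ⟨hy, ey⟩ := hy
      refine ⟨add_mem hx hy, ?_⟩
      have : (⟨x + y, add_mem hx hy⟩ : Λ) = ⟨x, hx⟩ + ⟨y, hy⟩ := rfl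
      rw [this, map_add, ex, ey, add_zero]
    | smul a x _ hx =>
      obtain ⟨hx, ex⟩ := hx
      refine ⟨zsmul_mem hx a, ?_⟩
      have : (⟨a • x, zsmul_mem hx a⟩ : Λ) = a • ⟨x, hx⟩ := rfl
      rw [this, map_zsmul, ex, smul_zero]
  exact (key _ (schur_mem_span lam)).2

theorem LabeledPoset.skewCoeff_eq (P : LabeledPoset.{u}) (lam : YoungDiagram) :
    P.skewCoeff lam = P.chi ⟨schur lam, schur_mem lam⟩ := dif_pos (schur_mem lam)

theorem S_kBruhatInterval (h : KBruhat κ u w) :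
    (kBruhatInterval κ u w).S = skewSchubertOf κ u w := by
  have hsym := isSymmetric_kBruhatInterval h
  rw [skewSchubertOf,
    finsum_eq_sum_of_support_subset (s := partitions (kBruhatInterval κ u w).rank)]
  · rw [LabeledPoset.S]
    refine Finset.sum_congr rfl fun lam _ => ?_
    rw [LabeledPoset.skewCoeff_eq, chi_schur_kBruhat h]
  · intro lam hlam
    rw [Finset.mem_coe, mem_partitions]
    by_contra hcon
    refine hlam ?_
    change schubertSchurCoeff κ u w lam • schur lam = 0
    rw [← chi_schur_kBruhat h, LabeledPoset.chi_schur_eq_zero hsym hcon, zero_smul]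

end SkewSchubertFunction

/-! ### Isomorphisms of labeled posets -/

section Isomorphisms

namespace LabeledPoset

variable {P : LabeledPoset.{u}} {Q : LabeledPoset.{v}}

/-- The image of a maximal chain under an isomorphism of posets. -/
def mapChain (f : P.carrier ≃o Q.carrier) (c : P.MaxChain) : Q.MaxChain :=
  ⟨⟨c.1.length, fun i => f (c.1 i), fun i => (apply_covBy_apply_iff f).2 (c.1.step i)⟩,
    (OrderIso.isMin_apply f).2 c.2.1, (OrderIso.isMax_apply f).2 c.2.2⟩

theorem mapChain_symm_mapChain (f : P.carrier ≃o Q.carrier) (c : P.MaxChain) :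
    mapChain f.symm (mapChain f c) = c := by
  apply Subtype.ext
  refine RelSeries.ext (x := (mapChain f.symm (mapChain f c)).1) (y := c.1) rfl ?_
  funext i
  exact f.symm_apply_apply _

/-- An isomorphism of posets induces a bijection of the maximal chains. -/
def chainEquiv (f : P.carrier ≃o Q.carrier) : P.MaxChain ≃ Q.MaxChain where
  toFun := mapChain f
  invFun := mapChain f.symm
  left_inv := mapChain_symm_mapChain f
  right_inv := mapChain_symm_mapChain f.symm

theorem descents_mapChain (I : Iso P Q) (c : P.MaxChain) :
    descents (mapChain I.toOrderIso c).word = descents c.word := by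
  ext j
  have hl : ∀ (i : ℕ) (h : i < c.word.length) (h' : i < (mapChain I.toOrderIso c).word.length)
      (j : ℕ) (hj : j < c.word.length) (hj' : j < (mapChain I.toOrderIso c).word.length),
      (mapChain I.toOrderIso c).word[i] < (mapChain I.toOrderIso c).word[j] ↔
        c.word[i] < c.word[j] := by
    intro i h h' j hj hj'
    rw [← not_le, ← not_le]
    simp only [MaxChain.word, List.getElem_ofFn]
    exact not_congr (I.label_le_label_iff _ _ _ _)
  have hlen : (mapChain I.toOrderIso c).word.length = c.word.length := by
    simp only [MaxChain.word, List.length_ofFn]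
    rfl
  constructor
  · rintro ⟨h1, h2, h3⟩
    rw [hlen] at h1
    exact ⟨h1, h2, (hl _ _ _ _ (by omega) _).1 h3⟩
  · rintro ⟨h1, h2, h3⟩
    exact ⟨by rwa [hlen], h2, (hl _ _ _ _ (by omega) (by omega)).2 h3⟩

theorem ncard_H_of_iso (I : Iso P Q) (α : List ℕ) : (P.H α).ncard = (Q.H α).ncard := by
  have hmem : ∀ c, mapChain I.toOrderIso c ∈ Q.H α ↔ c ∈ P.H α := by
    intro c
    have hlen : (mapChain I.toOrderIso c).word.length = c.word.length := by
      simp only [MaxChain.word, List.length_ofFn]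
      rfl
    simp only [H, Set.mem_ofPred_eq, descents_mapChain, hlen]
  rw [← Set.ncard_image_of_injective _ (chainEquiv I.toOrderIso).injective]
  congr 1
  ext d
  constructor
  · rintro ⟨c, hc, rfl⟩
    exact (hmem c).2 hc
  · intro hd
    refine ⟨(chainEquiv I.toOrderIso).symm d, ?_, Equiv.apply_symm_apply _ d⟩
    rw [← hmem]
    change chainEquiv I.toOrderIso ((chainEquiv I.toOrderIso).symm d) ∈ _
    rwa [Equiv.apply_symm_apply]

theorem isSymmetric_of_iso (I : Iso P Q) (hQ : Q.IsSymmetric) : P.IsSymmetric := by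
  have hrank : P.rank = Q.rank := by
    rw [rank, rank]
    congr 1
    ext n
    constructor
    · rintro ⟨c, rfl⟩
      exact ⟨mapChain I.toOrderIso c, rfl⟩
    · rintro ⟨c, rfl⟩
      exact ⟨mapChain I.toOrderIso.symm c, rfl⟩
  refine ⟨fun c => ?_, fun α β h => ?_⟩
  · rw [hrank]
    exact hQ.1 (mapChain I.toOrderIso c)
  · rw [ncard_H_of_iso I, ncard_H_of_iso I, hQ.2 α β h]

theorem S_eq_of_ncard_H (hP : P.IsSymmetric) (hQ : Q.IsSymmetric)
    (h : ∀ α, (P.H α).ncard = (Q.H α).ncard) : P.S = Q.S := by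
  refine MvPowerSeries.ext fun d => ?_
  obtain ⟨N, hN⟩ := exists_bound d
  rw [coeff_S hP d hN, coeff_S hQ d hN, h]

end LabeledPoset

end Isomorphisms

/-! ### The order `≼` and the skew Schubert functions -/

section PreceqIntervals

variable {k : ℕ+} {u ζ : SInf}

/-- `[1, ζ]_≼` is isomorphic to `[u, ζ u]_k`. -/
def preceqIso (h : KBruhat k u (ζ * u)) :
    LabeledPoset.Iso (preceqInterval ζ) (kBruhatInterval k u (ζ * u)) where
  toOrderIso :=
    { toFun := fun η => ⟨η.1 * u, η.2.2.between h⟩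
      invFun := fun v => ⟨v.1 * u⁻¹,
        ⟨u, k, by rw [one_mul]; exact KBruhat.refl k u, by
          rw [one_mul, inv_mul_cancel_right]; exact v.2.1⟩,
        ⟨u, k, by rw [inv_mul_cancel_right]; exact v.2.1, by
          rw [inv_mul_cancel_right]; exact v.2.2⟩⟩
      left_inv := fun η => Subtype.ext (mul_inv_cancel_right _ _)
      right_inv := fun v => Subtype.ext (inv_mul_cancel_right _ _)
      map_rel_iff' := by
        intro η η'
        exact ⟨fun hη => ⟨u, k, (η.2.2.between h).1, hη⟩,
          fun hη => (hη.between (η'.2.2.between h).1).2⟩ }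
  label_le_label_iff := by
    intro x y x' y' e e' f f'
    have key : ∀ η η' : SInf, transpositionLabel (η * u) (η' * u) = transpositionLabel η η' := by
      intro η η'
      unfold transpositionLabel
      rw [mul_inv_rev, mul_assoc, mul_inv_cancel_left]
    have key' : ∀ {x y : (preceqInterval ζ).carrier} (e : x ⋖ y) {x' y' : _} (f : x' ⋖ y'),
        x'.1 = x.1 * u → y'.1 = y.1 * u →
        (kBruhatInterval k u (ζ * u)).label f = (preceqInterval ζ).label e := by
      intro x y e x' y' f h1 h2
      change transpositionLabel x'.1 y'.1 = transpositionLabel x.1 y.1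
      rw [h1, h2, key]
    rw [key' e f rfl rfl, key' e' f' rfl rfl]

/-- There is a permutation that maps `{1, …, k}` onto a given set with `k` elements. -/
theorem exists_image_eq (E : Finset ℕ+) :
    ∃ w : SInf, ∀ i, w.1 i ∈ E ↔ (i : ℕ) ≤ E.card := by
  suffices key : ∀ n, ∀ A : Finset ℕ+, A.card = E.card → (A \ E).card = n →
      ∃ w : SInf, ∀ i, w.1 i ∈ E ↔ i ∈ A by
    obtain ⟨w, hw⟩ := key _ ((Finset.range E.card).image Nat.succPNat)
      (by rw [Finset.card_image_of_injective _ Nat.succPNat_injective, Finset.card_range]) rfl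
    refine ⟨w, fun i => ?_⟩
    rw [hw, Finset.mem_image]
    constructor
    · rintro ⟨m, hm, rfl⟩
      rw [Nat.succPNat_coe]
      exact Finset.mem_range.1 hm
    · intro hi
      have := i.natPred_add_one
      exact ⟨i.natPred, Finset.mem_range.2 (by omega), PNat.succPNat_natPred i⟩
  intro n
  induction n with
  | zero =>
    intro A h1 h2
    have h3 : A = E := Finset.eq_of_subset_of_card_le
      (Finset.sdiff_eq_empty_iff_subset.1 (Finset.card_eq_zero.1 h2)) h1.ge
    exact ⟨1, fun i => by rw [h3]; rfl⟩
  | succ n ih =>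
    intro A h1 h2
    -- exchange an element `a` of `A \ E` for an element `e` of `E \ A`
    obtain ⟨a, ha⟩ := Finset.card_pos.1 (by omega : 0 < (A \ E).card)
    obtain ⟨e, he⟩ := Finset.card_pos.1
      (by rw [← Finset.card_sdiff_comm h1]; omega : 0 < (E \ A).card)
    rw [Finset.mem_sdiff] at ha he
    obtain ⟨w, hw⟩ := ih (insert e (A.erase a))
      (by
        rw [Finset.card_insert_of_notMem fun h => he.2 (Finset.mem_of_mem_erase h),
          Finset.card_erase_add_one ha.1, h1])
      (by
        rw [Finset.insert_sdiff_of_mem _ he.1, Finset.erase_sdiff_comm, Finset.card_erase_of_mem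
          (Finset.mem_sdiff.2 ha), h2, Nat.add_sub_cancel])
    refine ⟨w * SInf.swap a e, fun i => ?_⟩
    have hae : a ≠ e := fun h => he.2 (h ▸ ha.1)
    rw [SInf.mul_apply, hw, SInf.swap_apply, Finset.mem_insert, Finset.mem_erase,
      Equiv.swap_apply_def]
    split_ifs with h3 h4
    · simp [h3, ha.1]
    · simp [h4, he.2, hae]
    · simp [h3, h4]

/-- With `k` the number of the values in a large enough interval that `ζ` does not lower, `ζ u` is
chosen to map `{1, …, k}` onto their images, and to be increasing on `{1, …, k}` and on the other
positions. -/
theorem exists_kBruhat (ζ : SInf) : ∃ (k : ℕ+) (u : SInf), KBruhat k u (ζ * u) := by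
  obtain ⟨n, hn⟩ := ζ.exists_bound
  set R : Finset ℕ+ := (Finset.Iic n.succPNat).filter fun x => x ≤ ζ.1 x with hR
  have hRmem : ∀ x, x ∈ R ↔ x ≤ n.succPNat ∧ x ≤ ζ.1 x := by simp [hR]
  set E := R.image ζ.1 with hE
  have hEmem : ∀ x, ζ.1 x ∈ E ↔ x ∈ R := fun x => by
    simp [hE]
  have hpos : 0 < E.card :=
    Finset.card_pos.2 ⟨ζ.1 1, (hEmem 1).2 ((hRmem 1).2 ⟨one_le, one_le⟩)⟩
  set k : ℕ+ := ⟨E.card, hpos⟩ with hk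
  -- `w` is of minimal length among the permutations that map `{1, …, k}` onto `E`
  have hex : ∃ l, ∃ w : SInf, (∀ i, w.1 i ∈ E ↔ i ≤ k) ∧ w.len = l := by
    obtain ⟨w, hw⟩ := exists_image_eq E
    exact ⟨_, w, hw, rfl⟩
  obtain ⟨w, hw, hlen⟩ := Nat.find_spec hex
  have hasc : ∀ i, i ≠ k → w.1 i < w.1 (i + 1) := by
    intro i hi
    refine (w.apply_lt_or i).resolve_right fun hd => ?_
    have hl := SInf.len_eq_len_mul_s_add_one hd
    refine Nat.find_min hex (m := (w * SInf.s i).len) (by omega) ⟨w * SInf.s i, fun j => ?_, rfl⟩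
    rw [SInf.mul_apply, hw]
    have h1 : i + 1 ≤ k ↔ i ≤ k := by
      rw [PNat.add_one_le_iff]
      exact ⟨le_of_lt, fun h => lt_of_le_of_ne h hi⟩
    rw [SInf.s, SInf.swap_apply, Equiv.swap_apply_def]
    split_ifs with h2 h3
    · rw [h2, h1]
    · rw [h3, h1]
    · rfl
  have hmono : ∀ a b, a < b → (a ≤ k → b ≤ k) → w.1 a < w.1 b := by
    intro a b hab hk'
    induction b using PNat.recOn with
    | one => exact absurd hab (not_lt.2 one_le)
    | succ b ih =>
      have hbk : b ≠ k := by
        rintro rfl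
        exact absurd (hk' (PNat.lt_add_one_iff.1 hab)) (not_le.2 (SInf.lt_add_one _))
      rcases (PNat.lt_add_one_iff.1 hab).lt_or_eq with h' | rfl
      · exact (ih h' fun h => (SInf.lt_add_one b).le.trans (hk' h)).trans (hasc b hbk)
      · exact hasc a hbk
  have hζw : ζ * (ζ⁻¹ * w) = w := mul_inv_cancel_left ζ w
  have hval : ∀ i, w.1 i = ζ.1 ((ζ⁻¹ * w).1 i) := fun i => by
    rw [← SInf.mul_apply, hζw]
  refine ⟨k, ζ⁻¹ * w, ?_⟩
  rw [hζw]
  refine ⟨fun a b ha hb => ⟨?_, ?_⟩, fun a b hab _ hw' => ?_⟩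
  · have := (hw a).2 ha
    rw [hval, hEmem, hRmem] at this
    rw [hval a]
    exact this.2
  · have := mt (hw b).1 (not_le.2 hb)
    rw [hval, hEmem, hRmem, not_and_or] at this
    rw [hval b]
    rcases this with h | h
    · refine (hn _ ?_).le
      rw [← PNat.coe_le_coe, Nat.succPNat_coe] at h
      omega
    · exact (not_le.1 h).le
  · by_contra hcon
    refine absurd (hmono a b hab fun ha => ?_) (lt_asymm hw')
    by_contra hb
    exact hcon ⟨ha, not_le.1 hb⟩

theorem isSymmetric_preceqInterval (ζ : SInf) : (preceqInterval ζ).IsSymmetric := by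
  obtain ⟨k, u, h⟩ := exists_kBruhat ζ
  exact LabeledPoset.isSymmetric_of_iso (preceqIso h) (isSymmetric_kBruhatInterval h)

theorem S_preceqInterval (h : KBruhat k u (ζ * u)) :
    (preceqInterval ζ).S = skewSchubertOf k u (ζ * u) := by
  rw [← S_kBruhatInterval h]
  exact LabeledPoset.S_eq_of_ncard_H (isSymmetric_preceqInterval ζ) (isSymmetric_kBruhatInterval h)
    (LabeledPoset.ncard_H_of_iso (preceqIso h))

theorem S_preceqInterval_eq_skewSchubert (ζ : SInf) :
    (preceqInterval ζ).S = skewSchubert ζ := by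
  have hζ : ∃ p : ℕ+ × SInf, KBruhat p.1 p.2 (ζ * p.2) := by
    obtain ⟨k, u, h⟩ := exists_kBruhat ζ
    exact ⟨(k, u), h⟩
  rw [skewSchubert, dif_pos hζ]
  exact S_preceqInterval hζ.choose_spec

end PreceqIntervals

/-! ### Intervals of Young's lattice -/

section YoungIntervals

/-- `z` arises from `x` by adding a cell in row `i`. -/
def AddsCell (x : YoungDiagram) (i : ℕ) (z : YoungDiagram) : Prop :=
  ∀ j, z.rowLen j = x.rowLen j + if j = i then 1 else 0

/-- The covers of Young's lattice, with their labels. -/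
def YoungStep (x : YoungDiagram) (c : ℤ) (z : YoungDiagram) : Prop :=
  ∃ i, AddsCell x i z ∧ c = (z.rowLen i : ℤ) - ((i : ℤ) + 1)

variable {x z lam μ : YoungDiagram} {i : ℕ}

theorem AddsCell.rowLen_self (h : AddsCell x i z) : z.rowLen i = x.rowLen i + 1 := by
  rw [h, if_pos rfl]

theorem AddsCell.le (h : AddsCell x i z) : x ≤ z :=
  le_iff_rowLen_le.2 fun j => by rw [h]; omega

theorem AddsCell.card (h : AddsCell x i z) : z.card = x.card + 1 := by
  have hz : z.rowLen (z.colLen 0 + x.colLen 0) = 0 := rowLen_eq_zero (by omega)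
  have hx : x.rowLen (z.colLen 0 + x.colLen 0) = 0 := rowLen_eq_zero (by omega)
  rw [card_eq_sum_rowLen hz, card_eq_sum_rowLen hx, Finset.sum_congr rfl fun j _ => h j,
    Finset.sum_add_distrib, Finset.sum_ite_eq', if_pos]
  rw [Finset.mem_range]
  by_contra hcon
  have h1 := h.rowLen_self
  rw [rowLen_eq_zero (by omega)] at h1
  omega

theorem exists_addsCell (h : ∀ j, j + 1 = i → x.rowLen i < x.rowLen j) :
    ∃ z, AddsCell x i z := by
  have hanti : Antitone fun j => x.rowLen j + if j = i then 1 else 0 := by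
    refine antitone_nat_of_succ_le fun j => ?_
    have h1 := x.rowLen_anti j (j + 1) (Nat.le_succ j)
    have h2 := h j
    split_ifs with h3 h4
    · omega
    · have := h2 h3
      rw [h3]
      omega
    · omega
    · omega
  have hN : (fun j => x.rowLen j + if j = i then 1 else 0) (x.colLen 0 + i + 1) = 0 := by
    beta_reduce
    rw [rowLen_eq_zero (by omega), if_neg (by omega)]
  exact ⟨ofRows _ hanti _ hN, rowLen_ofRows hanti hN⟩

theorem youngStep_rank : ∀ (x : YoungDiagram) (c : ℤ) (z : YoungDiagram), YoungStep x c z →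
    z.card = x.card + 1 := by
  rintro x c z ⟨i, h, -⟩
  exact h.card

theorem le_endpt {p : List (ℤ × YoungDiagram)} (hp : IsPath YoungStep x p) : x ≤ endpt x p := by
  induction p generalizing x with
  | nil => exact le_rfl
  | cons e p ih =>
    obtain ⟨i, h, -⟩ := hp.1
    exact h.le.trans (ih hp.2)

/-- A row that grows along a path has a step with a small label. -/
theorem exists_label_le {p : List (ℤ × YoungDiagram)} (hp : IsPath YoungStep x p) {j : ℕ}
    (hj : x.rowLen j < (endpt x p).rowLen j) :
    ∃ e ∈ p, e.1 ≤ ((endpt x p).rowLen j : ℤ) - ((j : ℤ) + 1) := by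
  induction p generalizing x with
  | nil => exact absurd hj (lt_irrefl _)
  | cons e p ih =>
    obtain ⟨i, h, hc⟩ := hp.1
    rw [endpt_cons] at hj ⊢
    by_cases hji : j = i
    · refine ⟨e, List.mem_cons_self, ?_⟩
      have := le_iff_rowLen_le.1 (le_endpt hp.2) i
      rw [hc, hji]
      omega
    · obtain ⟨e', he', hle⟩ := ih hp.2 (by rwa [h, if_neg hji, add_zero])
      exact ⟨e', List.mem_cons_of_mem _ he', hle⟩

/-- A label on a path belongs to a row that grows. -/
theorem exists_le_label {p : List (ℤ × YoungDiagram)} (hp : IsPath YoungStep x p)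
    {e : ℤ × YoungDiagram} (he : e ∈ p) :
    ∃ j, x.rowLen j < (endpt x p).rowLen j ∧ (x.rowLen j : ℤ) - j ≤ e.1 := by
  induction p generalizing x with
  | nil => simp at he
  | cons e' p ih =>
    obtain ⟨i, h, hc⟩ := hp.1
    rw [endpt_cons]
    rcases List.mem_cons.1 he with rfl | he
    · refine ⟨i, ?_, ?_⟩
      · have := le_iff_rowLen_le.1 (le_endpt hp.2) i
        rw [h.rowLen_self] at this
        omega
      · rw [hc, h.rowLen_self]
        push_cast
        linarith
    · obtain ⟨j, h1, h2⟩ := ih hp.2 he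
      have h3 := h j
      exact ⟨j, by omega, by rw [h3] at h2; push_cast at h2; split_ifs at h2 <;> omega⟩

/-- Two cells in the same column have decreasing labels from top to bottom, and the upper one is
added first. -/
theorem isStrip_of_sorted {p : List (ℤ × YoungDiagram)} (hp : IsPath YoungStep x p)
    (hs : (p.map Prod.fst).Pairwise (· ≤ ·)) : IsStrip x (endpt x p) := by
  induction p generalizing x with
  | nil => exact fun i => ⟨le_rfl, x.rowLen_anti i (i + 1) (Nat.le_succ i)⟩
  | cons e p ih =>
    obtain ⟨i, h, hc⟩ := hp.1
    rw [List.map_cons, List.pairwise_cons] at hs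
    have hst := ih hp.2 hs.2
    rw [endpt_cons]
    refine fun j => ⟨(le_iff_rowLen_le.1 h.le j).trans (hst j).1, ?_⟩
    have h1 := (hst j).2
    rw [h j] at h1
    by_cases hj : j = i
    · subst hj
      by_contra hcon
      have h2 := h (j + 1)
      rw [if_neg (by omega), add_zero] at h2
      have h3 := x.rowLen_anti j (j + 1) (Nat.le_succ j)
      obtain ⟨e', he', hle⟩ := exists_label_le hp.2 (j := j + 1) (by omega)
      have h4 := hs.1 _ (List.mem_map_of_mem he')
      rw [hc, h.rowLen_self] at h4
      push_cast at h4 hle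
      rw [if_pos rfl] at h1
      omega
    · rwa [if_neg hj, add_zero] at h1

/-- A nonempty skew shape has a last nonempty row. -/
theorem exists_last_row (h : x ≤ lam) (hne : x ≠ lam) :
    ∃ i, x.rowLen i < lam.rowLen i ∧ ∀ j, i < j → lam.rowLen j = x.rowLen j := by
  have hle := le_iff_rowLen_le.1 h
  have hex : ∃ i, x.rowLen i < lam.rowLen i := by
    by_contra hcon
    push Not at hcon
    exact hne (ext_rowLen fun i => le_antisymm (hle i) (hcon i))
  have hbd : ∀ i, x.rowLen i < lam.rowLen i → i ≤ lam.colLen 0 := by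
    intro i hi
    by_contra hcon
    rw [rowLen_eq_zero (μ := lam) (by omega)] at hi
    omega
  obtain ⟨i₀, hi₀⟩ := hex
  refine ⟨Nat.findGreatest (fun i => x.rowLen i < lam.rowLen i) (lam.colLen 0),
    Nat.findGreatest_spec (P := fun i => x.rowLen i < lam.rowLen i) (hbd _ hi₀) hi₀,
    fun j hj => ?_⟩
  by_contra hcon
  have h1 : x.rowLen j < lam.rowLen j := lt_of_le_of_ne (hle j) (Ne.symm hcon)
  exact Nat.findGreatest_is_greatest hj (hbd j h1) h1

/-- The cells of a horizontal strip can be added in exactly one way with increasing labels, namely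
from left to right. -/
theorem existsUnique_sorted (n : ℕ) (hs : IsStrip x lam) (hc : lam.card = x.card + n) :
    ∃! p, IsPath YoungStep x p ∧ endpt x p = lam ∧ (p.map Prod.fst).Pairwise (· ≤ ·) := by
  induction n generalizing x with
  | zero =>
    have hx := eq_of_le_of_card hs.le hc.le
    refine ⟨[], ⟨trivial, hx, by simp⟩, ?_⟩
    rintro p ⟨hp, hp', -⟩
    have := rank_endpt youngStep_rank hp
    rw [hp'] at this
    exact List.eq_nil_of_length_eq_zero (by omega)
  | succ n ih =>
    obtain ⟨i, hi, hlast⟩ := exists_last_row hs.le fun h => by rw [h] at hc; omega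
    obtain ⟨z, hz⟩ := exists_addsCell (x := x) (i := i) fun j hj => by
      have := (hs j).2
      rw [hj] at this
      omega
    have hs' : IsStrip z lam := by
      intro j
      have h1 := hs j
      have h2 := hz j
      by_cases hj : j = i
      · subst hj
        rw [if_pos rfl] at h2
        omega
      · rw [if_neg hj] at h2
        omega
    have hzc := hz.card
    obtain ⟨p, ⟨hp1, hp2, hp3⟩, huniq⟩ := ih hs' (by omega)
    refine ⟨((z.rowLen i : ℤ) - ((i : ℤ) + 1), z) :: p, ⟨⟨⟨i, hz, rfl⟩, hp1⟩, hp2, ?_⟩, ?_⟩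
    · rw [List.map_cons, List.pairwise_cons]
      refine ⟨fun c hcm => ?_, hp3⟩
      obtain ⟨e, he, rfl⟩ := List.mem_map.1 hcm
      obtain ⟨j, h1, h2⟩ := exists_le_label hp1 he
      rw [hp2] at h1
      have hji : j ≤ i := by
        by_contra hcon
        rw [hlast j (by omega), hz j, if_neg (by omega)] at h1
        omega
      have h3 := z.rowLen_anti j i hji
      dsimp only
      omega
    · rintro q ⟨hq1, hq2, hq3⟩
      cases q with
      | nil => rw [endpt_nil] at hq2; rw [hq2] at hi; exact absurd hi (lt_irrefl _)
      | cons e q =>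
        obtain ⟨i', hz', hc'⟩ := hq1.1
        rw [List.map_cons, List.pairwise_cons] at hq3
        rw [endpt_cons] at hq2
        have hle := le_iff_rowLen_le.1 (le_endpt hq1.2)
        rw [hq2] at hle
        have hii : i' = i := by
          rcases lt_trichotomy i' i with h | h | h
          · -- a cell would be added in row `i`, to the left of the first one
            exfalso
            obtain ⟨e', he', hle'⟩ := exists_label_le hq1.2 (j := i) (by
              rw [hq2, hz' i, if_neg h.ne']
              exact hi)
            have h1 := hq3.1 _ (List.mem_map_of_mem he')
            rw [hq2] at hle'
            rw [hc', hz'.rowLen_self] at h1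
            have h2 := (hs (i - 1)).2
            rw [show i - 1 + 1 = i by omega] at h2
            have h3 := x.rowLen_anti i' (i - 1) (by omega)
            push_cast at h1
            omega
          · exact h
          · have h1 := hle i'
            rw [hlast i' h, hz'.rowLen_self] at h1
            omega
        subst hii
        have hez : e.2 = z := ext_rowLen fun j => by rw [hz' j, hz j]
        have hq := huniq q ⟨hez ▸ hq1.2, hez ▸ hq2, hq3.2⟩
        rw [hq]
        congr 1
        exact Prod.ext (by rw [hc', hez]) hez

/-- The operator that adds horizontal strips counts the paths with increasing labels. -/
theorem countsPaths_upOp (n : ℕ) : CountsPaths YoungStep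
    (fun p => p.length = n ∧ (p.map Prod.fst).Pairwise (· ≤ ·) ∧ ∀ e ∈ p, e.1 ∈ Set.univ)
    (upOp n) := by
  intro x
  have hex : ∀ lam ∈ upStrips n x, ∃! p,
      IsPath YoungStep x p ∧ endpt x p = lam ∧ (p.map Prod.fst).Pairwise (· ≤ ·) :=
    fun lam h => existsUnique_sorted n (mem_upStrips.1 h).1 (mem_upStrips.1 h).2
  choose! f hf huniq using hex
  beta_reduce at hf
  refine ⟨(upStrips n x).image f, fun p => ?_, ?_⟩
  · simp only [Finset.mem_image, Set.mem_univ, implies_true, and_true]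
    constructor
    · rintro ⟨lam, hlam, rfl⟩
      obtain ⟨h1, h2, h3⟩ := hf lam hlam
      have h4 := rank_endpt youngStep_rank h1
      rw [h2, (mem_upStrips.1 hlam).2] at h4
      exact ⟨h1, by omega, h3⟩
    · rintro ⟨h1, h2, h3⟩
      have h4 : endpt x p ∈ upStrips n x :=
        mem_upStrips.2 ⟨isStrip_of_sorted h1 h3, by rw [rank_endpt youngStep_rank h1, h2]⟩
      exact ⟨_, h4, (huniq _ h4 p ⟨h1, rfl, h3⟩).symm⟩
  · rw [upOp_single, Finset.sum_image]
    · exact Finset.sum_congr rfl fun lam h => by rw [(hf lam h).2.1]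
    · intro lam h lam' h' heq
      rw [← (hf lam h).2.1, heq, (hf lam' h').2.1]

theorem reach_youngStep_iff : Reach YoungStep x lam ↔ x ≤ lam := by
  constructor
  · rintro ⟨p, hp, rfl⟩
    exact le_endpt hp
  · intro h
    induction hn : lam.card - x.card generalizing x with
    | zero =>
      rw [eq_of_le_of_card h (by omega)]
      exact Reach.refl lam
    | succ n ih =>
      have hle := le_iff_rowLen_le.1 h
      -- add a cell in the first row in which `x` and `lam` differ
      have hex : ∃ i, x.rowLen i < lam.rowLen i := by
        obtain ⟨i, hi, -⟩ := exists_last_row h fun h => by rw [h] at hn; omega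
        exact ⟨i, hi⟩
      obtain ⟨z, hz⟩ := exists_addsCell (x := x) (i := Nat.find hex) fun j hj => by
        have h1 := Nat.find_min hex (m := j) (by omega)
        have h2 := Nat.find_spec hex
        have h3 := lam.rowLen_anti j (Nat.find hex) (by omega)
        omega
      have hzl : z ≤ lam := le_iff_rowLen_le.2 fun j => by
        rw [hz j]
        split_ifs with hj
        · rw [hj]
          exact Nat.find_spec hex
        · exact hle j
      have hzc := hz.card
      exact (Reach.single ⟨_, hz, rfl⟩).trans (ih hzl (by omega))

theorem YoungStep.label_eq {c : ℤ} (h : YoungStep x c z) : youngLabel x z = c := by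
  obtain ⟨i, h, rfl⟩ := h
  obtain ⟨i', h', hl⟩ := Classical.epsilon_spec
    (p := fun l : ℤ =>
      ∃ i : ℕ, x.rowLen i + 1 = z.rowLen i ∧ l = (z.rowLen i : ℤ) - ((i : ℤ) + 1))
    ⟨_, i, h.rowLen_self.symm, rfl⟩
  have hii : i' = i := by
    by_contra hcon
    rw [h i', if_neg hcon] at h'
    omega
  rw [youngLabel, hl, hii]

theorem isPathInterval_young (h : μ ≤ lam) :
    IsPathInterval (youngInterval μ lam) YoungStep id Subtype.val YoungDiagram.card μ lam where
  inj := Subtype.val_injective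
  mem_range v := by
    rw [reach_youngStep_iff, reach_youngStep_iff]
    exact ⟨fun ⟨p, hp⟩ => hp ▸ p.2, fun hv => ⟨⟨v, hv⟩, rfl⟩⟩
  le_iff p q := reach_youngStep_iff.symm
  rank_step := youngStep_rank
  label_eq _ _ hl := hl.label_eq
  reach := reach_youngStep_iff.2 h

theorem ncard_H_young (h : μ ≤ lam) (α : List ℕ) :
    (((youngInterval μ lam).H α).ncard : ℤ) = blockOp upOp α (Finsupp.single μ 1) lam :=
  (isPathInterval_young h).ncard_H_eq strictMono_id countsPaths_upOp
    (fun _ _ _ _ _ => Set.mem_univ _) α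

theorem isSymmetric_youngInterval (h : μ ≤ lam) : (youngInterval μ lam).IsSymmetric := by
  refine ⟨(isPathInterval_young h).isRanked, fun α β hαβ => ?_⟩
  have := ncard_H_young h α
  rw [blockOp_perm upOp_comm hαβ, ← ncard_H_young h β] at this
  exact_mod_cast this

theorem S_youngInterval (h : μ ≤ lam) : (youngInterval μ lam).S = skewSchur lam μ := by
  refine MvPowerSeries.ext fun d => ?_
  obtain ⟨N, hN⟩ := exists_bound d
  rw [LabeledPoset.coeff_S (isSymmetric_youngInterval h) d hN, coeff_skewSchur h d hN,
    ncard_H_young h, blockOp_upOp_eq_downOp, revContent_eq]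

end YoungIntervals

/-! ### Intervals of the weak order -/

section WeakIntervals

/-- `z` covers `x` in the weak order, with the label `i`. -/
def WeakStep (x : SInf) (i : ℕ+) (z : SInf) : Prop := z = SInf.s i * x ∧ z.len = x.len + 1

variable {w x z : SInf} {i : ℕ+} {n : ℕ}

theorem reach_weakStep_iff : Reach WeakStep x z ↔ Weak x z := by
  constructor
  · rintro ⟨p, hp, rfl⟩
    induction p generalizing x with
    | nil => exact Relation.ReflTransGen.refl
    | cons e p ih => exact Relation.ReflTransGen.head ⟨e.1, hp.1⟩ (ih hp.2)
  · intro h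
    induction h with
    | refl => exact Reach.refl x
    | tail _ hc ih =>
      obtain ⟨i, hi⟩ := hc
      exact ih.trans (Reach.single hi)

theorem s_injective : Function.Injective SInf.s := by
  intro i j h
  have h1 : (SInf.s i).1 i = (SInf.s j).1 i := by rw [h]
  have h2 : (SInf.s i).1 j = (SInf.s j).1 j := by rw [h]
  simp only [SInf.s, SInf.swap_apply, Equiv.swap_apply_left, Equiv.swap_apply_def] at h1 h2
  have h3 := SInf.lt_add_one i
  have h4 := SInf.lt_add_one j
  grind

theorem WeakStep.label_eq (h : WeakStep x i z) : weakLabel x z = ((i : ℕ) : ℤ) := by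
  have hz : z * x⁻¹ = SInf.s i := by rw [h.1, mul_inv_cancel_right]
  obtain ⟨j, hj, hl⟩ := Classical.epsilon_spec
    (p := fun l : ℤ => ∃ i : ℕ+, z * x⁻¹ = SInf.s i ∧ l = ((i : ℕ) : ℤ)) ⟨_, i, hz, rfl⟩
  rw [weakLabel, hl, s_injective (hj.symm.trans hz)]

/-- The operator that applies `s_i` from the left if this increases the length. -/
def weakOp (i : ℕ+) : Module.End ℤ (SInf →₀ ℤ) :=
  opOf fun x => if x.1⁻¹ i < x.1⁻¹ (i + 1) then Finsupp.single (SInf.s i * x) 1 else 0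

theorem weakOp_single (i : ℕ+) (x : SInf) : weakOp i (Finsupp.single x 1) =
    if x.1⁻¹ i < x.1⁻¹ (i + 1) then Finsupp.single (SInf.s i * x) 1 else 0 :=
  opOf_single _ _

theorem inv_s_mul_left (x : SInf) (i : ℕ+) : (SInf.s i * x).1⁻¹ i = x.1⁻¹ (i + 1) := by
  rw [SInf.s, SInf.inv_swap_mul, Equiv.swap_apply_left]

theorem inv_s_mul_right (x : SInf) (i : ℕ+) : (SInf.s i * x).1⁻¹ (i + 1) = x.1⁻¹ i := by
  rw [SInf.s, SInf.inv_swap_mul, Equiv.swap_apply_right]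

theorem inv_s_mul_of_ne (x : SInf) {i j : ℕ+} (h1 : j ≠ i) (h2 : j ≠ i + 1) :
    (SInf.s i * x).1⁻¹ j = x.1⁻¹ j := by
  rw [SInf.s, SInf.inv_swap_mul, Equiv.swap_apply_of_ne_of_ne h1 h2]

theorem weakOp_sq (i : ℕ+) : weakOp i * weakOp i = 0 := by
  refine end_ext fun x => ?_
  rw [Module.End.mul_apply, weakOp_single]
  split_ifs with h
  · rw [weakOp_single, inv_s_mul_left, inv_s_mul_right, if_neg h.not_gt, LinearMap.zero_apply]
  · rw [map_zero, LinearMap.zero_apply]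

theorem weakOp_comm {i j : ℕ+} (h : i + 1 < j) : Commute (weakOp i) (weakOp j) := by
  have hi := SInf.lt_add_one i
  have hj := SInf.lt_add_one j
  refine end_ext fun x => ?_
  have e1 := inv_s_mul_of_ne x (i := i) (j := j) (hi.trans h).ne' h.ne'
  have e2 := inv_s_mul_of_ne x (i := i) (j := j + 1) ((hi.trans h).trans hj).ne' (h.trans hj).ne'
  have e3 := inv_s_mul_of_ne x (i := j) (j := i) (hi.trans h).ne ((hi.trans h).trans hj).ne
  have e4 := inv_s_mul_of_ne x (i := j) (j := i + 1) h.ne (h.trans hj).ne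
  rw [Module.End.mul_apply, Module.End.mul_apply, weakOp_single, weakOp_single]
  by_cases h1 : x.1⁻¹ i < x.1⁻¹ (i + 1) <;> by_cases h2 : x.1⁻¹ j < x.1⁻¹ (j + 1) <;>
    simp only [h1, h2, if_true, if_false, map_zero, weakOp_single, e1, e2, e3, e4]
  rw [← mul_assoc, ← mul_assoc, s_comm h]

theorem weakOp_braid (i : ℕ+) :
    weakOp i * weakOp (i + 1) * weakOp i = weakOp (i + 1) * weakOp i * weakOp (i + 1) := by
  have h1 := SInf.lt_add_one i
  have h2 := SInf.lt_add_one (i + 1)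
  -- the values of `x⁻¹` at `i`, `i + 1` and `i + 2` are permuted
  have e1 : ∀ y : SInf, (SInf.s i * y).1⁻¹ (i + 1 + 1) = y.1⁻¹ (i + 1 + 1) := fun y =>
    inv_s_mul_of_ne y (h1.trans h2).ne' h2.ne'
  have e2 : ∀ y : SInf, (SInf.s (i + 1) * y).1⁻¹ i = y.1⁻¹ i := fun y =>
    inv_s_mul_of_ne y h1.ne (h1.trans h2).ne
  refine end_ext fun x => ?_
  simp only [Module.End.mul_apply]
  rw [weakOp_single, weakOp_single]
  by_cases c1 : x.1⁻¹ i < x.1⁻¹ (i + 1) <;>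
    by_cases c2 : x.1⁻¹ (i + 1) < x.1⁻¹ (i + 1 + 1) <;>
    by_cases c3 : x.1⁻¹ i < x.1⁻¹ (i + 1 + 1) <;>
    simp only [c1, c2, c3, if_true, if_false, map_zero, weakOp_single, e1, e2, inv_s_mul_left,
      inv_s_mul_right]
  · rw [← mul_assoc, ← mul_assoc, ← mul_assoc, ← mul_assoc, s_braid]

theorem nilCoxeter_weakOp (n : ℕ) : NilCoxeter (fun m => weakOp m.succPNat) n where
  sq m _ := weakOp_sq _
  comm l m hlm _ := weakOp_comm (by
    rw [succPNat_add_one]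
    exact Nat.succPNat_lt_succPNat.2 hlm)
  braid m _ := weakOp_braid m.succPNat

/-- The covers of `x` in the weak order with the label `i`. -/
def weakOut (i : ℕ+) (x : SInf) : Finset SInf :=
  if x.1⁻¹ i < x.1⁻¹ (i + 1) then {SInf.s i * x} else ∅

theorem mem_weakOut : z ∈ weakOut i x ↔ WeakStep x i z := by
  unfold weakOut WeakStep
  split_ifs with h
  · rw [Finset.mem_singleton]
    exact ⟨fun hz => ⟨hz, hz ▸ SInf.len_s_mul h⟩, fun hz => hz.1⟩
  · refine iff_of_false (Finset.notMem_empty z) ?_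
    rintro ⟨rfl, hz⟩
    exact h (SInf.len_s_mul_eq_iff.1 hz)

theorem weakOp_single_eq_sum (i : ℕ+) (x : SInf) :
    weakOp i (Finsupp.single x 1) = ∑ z ∈ weakOut i x, Finsupp.single z 1 := by
  rw [weakOp_single, weakOut]
  split_ifs <;> simp

theorem not_weakStep_weakStep {v : SInf} (h : WeakStep x i z) : ¬ WeakStep z i v := by
  rintro ⟨rfl, hv⟩
  have h1 := SInf.len_s_mul_eq_iff.1 hv
  have h2 := h.2
  rw [h.1] at h1 h2
  rw [inv_s_mul_left, inv_s_mul_right] at h1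
  exact lt_asymm h1 (SInf.len_s_mul_eq_iff.1 h2)

theorem weakLabel_le_of_isPath {p : List (ℕ+ × SInf)} (hp : IsPath WeakStep x p)
    (hw : InS n (endpt x p)) : ∀ e ∈ p, (e.1 : ℕ) ≤ n := by
  induction p generalizing x with
  | nil => simp
  | cons e p ih =>
    have h2 : InS n e.2 := (reach_weakStep_iff.1 ⟨p, hp.2, rfl⟩ : Weak e.2 (endpt e.2 p)).fixes hw
    have h1 : InS n x := Weak.fixes_of_cover ⟨e.1, hp.1⟩ h2
    intro e' he'
    rcases List.mem_cons.1 he' with rfl | he'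
    · have h3 : InS n (SInf.s e'.1) := by
        have := h2.mul h1.inv
        rwa [hp.1.1, mul_inv_cancel_right] at this
      by_contra hcon
      have := h3 e'.1 (by omega)
      rw [SInf.s, SInf.swap_apply, Equiv.swap_apply_left] at this
      exact (SInf.lt_add_one e'.1).ne' this
    · exact ih hp.2 hw e' he'

theorem weak_one (w : SInf) : Weak 1 w := by
  obtain ⟨a, ha⟩ := w.exists_isReducedWord
  induction a generalizing w with
  | nil =>
    have : (1 : SInf) = w := ha.1
    rw [this]
    exact Relation.ReflTransGen.refl
  | cons i a ih =>
    obtain ⟨h1, h2⟩ := isReducedWord_cons.1 ha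
    refine Relation.ReflTransGen.tail (ih _ h2) ⟨i, ?_, h1⟩
    rw [← mul_assoc, SInf.s, SInf.swap_mul_self, one_mul]

theorem isPathInterval_weak (w : SInf) :
    IsPathInterval (weakInterval w) WeakStep (fun b => ((b : ℕ) : ℤ)) Subtype.val SInf.len 1 w where
  inj := Subtype.val_injective
  mem_range v := by
    rw [reach_weakStep_iff, reach_weakStep_iff]
    exact ⟨fun ⟨p, hp⟩ => hp ▸ p.2, fun hv => ⟨⟨v, hv⟩, rfl⟩⟩
  le_iff p q := reach_weakStep_iff.symm
  rank_step v b z hz := hz.2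
  label_eq _ _ hl := hl.label_eq
  reach := reach_weakStep_iff.2 (weak_one w)

/-- The symmetry of `[1, w]` in the weak order is the commutation of the elements
`∑ u_{b_n} ⋯ u_{b_1}`, `b_1 < ⋯ < b_n`, of the nilCoxeter algebra. -/
theorem isSymmetric_weakInterval (w : SInf) : (weakInterval w).IsSymmetric := by
  refine ⟨(isPathInterval_weak w).isRanked, fun α β hαβ => ?_⟩
  have key : ∀ γ, (((weakInterval w).H γ).ncard : ℤ) =
      blockOp (fun m => (labelPoly weakOp (labels w.size)).coeff m) γ (Finsupp.single 1 1) w :=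
    (isPathInterval_weak w).ncard_H_eq strictMono_label
      (countsPaths_coeff (fun b x z => mem_weakOut) weakOp_single_eq_sum
        (fun _ _ _ _ => not_weakStep_weakStep) (pairwise_labels w.size))
      fun p hp hpw e he => mem_labels.2 (weakLabel_le_of_isPath hp (hpw ▸ inS_size w) e he)
  have h := key α
  rw [blockOp_perm (fun k l => ?_) hαβ, ← key β] at h
  · exact_mod_cast h
  · rw [labels, labelPoly_map]
    exact coeff_labelPoly_comm (nilCoxeter_weakOp _) k l

/-- The maximal chains of `[1, w]` are the reduced words of `w`, read backwards. -/
theorem isReducedWord_iff_exists_path {a : List ℕ+} : w.IsReducedWord a ↔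
    ∃ q, IsPath WeakStep 1 q ∧ endpt 1 q = w ∧ q.map Prod.fst = a.reverse := by
  have hss : ∀ (i : ℕ+) (v : SInf), SInf.s i * (SInf.s i * v) = v := fun i v => by
    rw [← mul_assoc, SInf.s, SInf.swap_mul_self, one_mul]
  induction a generalizing w with
  | nil =>
    constructor
    · intro h
      exact ⟨[], trivial, h.1, rfl⟩
    · rintro ⟨q, -, h, hq⟩
      rw [List.map_eq_nil_iff.1 hq] at h
      exact ⟨h, by rw [← h]; exact SInf.len_one.symm⟩
  | cons i a ih =>
    refine (isReducedWord_cons.trans (and_congr_right' ih)).trans ?_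
    constructor
    · rintro ⟨h, q, h1, h2, h3⟩
      refine ⟨q ++ [(i, w)], isPath_append.2 ⟨h1, ?_, trivial⟩, endpt_append _ _ _, ?_⟩
      · rw [h2]
        exact ⟨(hss i w).symm, h⟩
      · rw [List.map_append, h3, List.reverse_cons]
        rfl
    · rintro ⟨q, h1, h2, h3⟩
      rw [List.reverse_cons, List.map_eq_append_iff] at h3
      obtain ⟨q', l, rfl, h4, h5⟩ := h3
      obtain ⟨e, rfl, rfl⟩ := List.map_eq_singleton_iff.1 h5
      rw [isPath_append] at h1
      rw [endpt_append] at h2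
      obtain rfl : e.2 = w := h2
      have h6 : endpt 1 q' = SInf.s e.1 * e.2 := by rw [h1.2.1.1, hss]
      refine ⟨?_, q', h1.1, h6, h4⟩
      rw [← h6]
      exact h1.2.1.2

theorem path_injective {p q : List (ℕ+ × SInf)} (hp : IsPath WeakStep x p)
    (hq : IsPath WeakStep x q) (h : p.map Prod.fst = q.map Prod.fst) : p = q := by
  induction p generalizing x q with
  | nil => exact (List.map_eq_nil_iff.1 h.symm).symm
  | cons e p ih =>
    cases q with
    | nil => simp at h
    | cons f q =>
      rw [List.map_cons, List.map_cons, List.cons.injEq] at h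
      have hef : e = f := Prod.ext h.1 (by rw [hp.1.1, hq.1.1, h.1])
      rw [hef, ih hp.2 (hef ▸ hq.2) h.2]

end WeakIntervals

/-! ### Stanley symmetric functions -/

section Stanley

/-- The weakly decreasing word in `1, …, N` in which `m + 1` occurs `e m` times. -/
def contentWord (e : ℕ → ℕ) : ℕ → List ℕ+
  | 0 => []
  | N + 1 => List.replicate (e N) N.succPNat ++ contentWord e N

theorem le_of_mem_contentWord {e : ℕ → ℕ} {N : ℕ} {i : ℕ+} (h : i ∈ contentWord e N) :
    (i : ℕ) ≤ N := by
  induction N with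
  | zero => simp [contentWord] at h
  | succ N ih =>
    rcases List.mem_append.1 h with h | h
    · rw [(List.mem_replicate.1 h).2, Nat.succPNat_coe]
    · exact (ih h).trans (Nat.le_succ N)

theorem pairwise_contentWord (e : ℕ → ℕ) (N : ℕ) : (contentWord e N).Pairwise (· ≥ ·) := by
  induction N with
  | zero => exact List.Pairwise.nil
  | succ N ih =>
    refine List.pairwise_append.2 ⟨List.pairwise_replicate.2 (Or.inr le_rfl), ih, ?_⟩
    intro i hi j hj
    rw [(List.mem_replicate.1 hi).2]
    have := le_of_mem_contentWord hj
    rw [ge_iff_le, ← PNat.coe_le_coe, Nat.succPNat_coe]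
    omega

theorem count_contentWord (e : ℕ → ℕ) (N m : ℕ) :
    (contentWord e N).count m.succPNat = if m < N then e m else 0 := by
  induction N with
  | zero => rfl
  | succ N ih =>
    rw [contentWord, List.count_append, ih, List.count_replicate]
    simp only [beq_iff_eq, Nat.succPNat_inj]
    by_cases h : N = m
    · subst h
      simp
    · have : m < N + 1 ↔ m < N := by omega
      simp [h, this]

/-- The condition on two letters `(a, i)` and `(a', i')`, in this order, of a monomial of the
Stanley symmetric function that is read backwards. -/
def RevCompatible (x y : ℕ+ × ℕ+) : Prop := y.2 ≤ x.2 ∧ (y.1 < x.1 → y.2 < x.2)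

/-- A word splits into weakly increasing blocks of sizes `e (N - 1), …, e 0` if and only if it is
compatible with the content `e`. -/
theorem blockSorted_revContent_iff {e : ℕ → ℕ} {N : ℕ} {c : List ℕ+} :
    BlockSorted (revContent e N) c ↔
      c.length = (contentWord e N).length ∧ (c.zip (contentWord e N)).Pairwise RevCompatible := by
  induction N generalizing c with
  | zero =>
    simp only [revContent, BlockSorted, contentWord, List.length_nil, List.zip_nil_right,
      List.Pairwise.nil, and_true, List.length_eq_zero_iff]
  | succ N ih =>
    have hblock : ∀ (b : List ℕ+) (v : ℕ+), b.length = e N →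
        ((b.zip (List.replicate (e N) v)).Pairwise RevCompatible ↔ b.Pairwise (· ≤ ·)) := by
      intro b v hb
      have h1 : b.zip (List.replicate (e N) v) = b.map fun i => (i, v) := by
        rw [← hb]
        clear hb
        induction b with
        | nil => rfl
        | cons i b ih => rw [List.length_cons, List.replicate_succ, List.zip_cons_cons, ih,
            List.map_cons]
      rw [h1, List.pairwise_map]
      simp only [RevCompatible, le_refl, lt_irrefl, true_and, imp_false, not_lt]
    simp only [revContent, BlockSorted, contentWord, ih]
    by_cases hlen : e N ≤ c.length
    · have hb : (c.take (e N)).length = e N := by simp [hlen]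
      have hzip : c.zip (List.replicate (e N) N.succPNat ++ contentWord e N) =
          (c.take (e N)).zip (List.replicate (e N) N.succPNat) ++
            (c.drop (e N)).zip (contentWord e N) := by
        rw [← List.zip_append (by rw [hb, List.length_replicate]), List.take_append_drop]
      rw [hzip, List.pairwise_append, hblock _ _ hb]
      have hl : c.length = (List.replicate (e N) N.succPNat ++ contentWord e N).length ↔
          (c.drop (e N)).length = (contentWord e N).length := by
        rw [List.length_append, List.length_replicate, List.length_drop]
        omega
      have hcross : ∀ x ∈ (c.take (e N)).zip (List.replicate (e N) N.succPNat),
          ∀ y ∈ (c.drop (e N)).zip (contentWord e N), RevCompatible x y := by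
        rintro ⟨a, i⟩ hx ⟨a', i'⟩ hy
        have h1 := (List.mem_replicate.1 (List.of_mem_zip hx).2).2
        have h2 := le_of_mem_contentWord (List.of_mem_zip hy).2
        have h3 : i' < i := by
          rw [h1, ← PNat.coe_lt_coe, Nat.succPNat_coe]
          omega
        exact ⟨h3.le, fun _ => h3⟩
      rw [hl]
      tauto
    · refine iff_of_false (fun h => hlen h.1) fun h => hlen ?_
      rw [h.1, List.length_append, List.length_replicate]
      omega

theorem isChain_iff_pairwise_reverse {p : List (ℕ+ × ℕ+)} :
    p.IsChain (fun x y => x.2 ≤ y.2 ∧ (x.1 < y.1 → x.2 < y.2)) ↔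
      p.reverse.Pairwise RevCompatible := by
  have : IsTrans (ℕ+ × ℕ+) fun x y => x.2 ≤ y.2 ∧ (x.1 < y.1 → x.2 < y.2) := by
    refine ⟨fun x y z hxy hyz => ⟨hxy.1.trans hyz.1, fun h => ?_⟩⟩
    rcases lt_or_ge x.1 y.1 with h1 | h1
    · exact (hxy.2 h1).trans_le hyz.1
    · exact hxy.1.trans_lt (hyz.2 (h1.trans_lt h))
  rw [List.isChain_iff_pairwise, List.pairwise_reverse]
  rfl

/-- A term of `F_w` is a reduced word of `w` that is compatible with the content of the monomial. -/
theorem coeff_stanley (w : SInf) (d : ℕ+ →₀ ℕ) {N : ℕ} (hN : ∀ i : ℕ+, N < i → d i = 0) :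
    MvPowerSeries.coeff d (stanley w) =
      ({c : List ℕ+ | w.IsReducedWord c.reverse ∧
        BlockSorted (revContent (expo d) N) c}.ncard : ℤ) := by
  change (({p : List (ℕ+ × ℕ+) | w.IsReducedWord (p.map Prod.fst) ∧
      p.IsChain (fun x y => x.2 ≤ y.2 ∧ (x.1 < y.1 → x.2 < y.2)) ∧
      ∀ i, (p.map Prod.snd).count i = d i}.ncard : ℕ) : ℤ) = _
  set X := contentWord (expo d) N with hX
  have hcount : ∀ i, X.count i = d i := by
    intro i
    obtain ⟨m, rfl⟩ : ∃ m : ℕ, m.succPNat = i := ⟨i.natPred, PNat.succPNat_natPred i⟩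
    rw [hX, count_contentWord]
    split_ifs with h
    · rfl
    · exact (hN _ (by rw [Nat.succPNat_coe]; omega)).symm
  rw [← Set.InjOn.ncard_image (f := fun c : List ℕ+ => (c.zip X).reverse)]
  · congr 2
    ext p
    simp only [Set.mem_image, Set.mem_ofPred_eq, blockSorted_revContent_iff, ← hX,
      isChain_iff_pairwise_reverse]
    constructor
    · rintro ⟨h1, h2, h3⟩
      have hsnd : p.reverse.map Prod.snd = X := by
        refine List.Perm.eq_of_pairwise' (r := (· ≥ ·)) ?_ (pairwise_contentWord _ _) ?_
        · exact List.pairwise_map.2 (h2.imp fun h => h.1)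
        · rw [List.perm_iff_count]
          intro i
          rw [List.map_reverse, List.count_reverse, h3, hcount]
      have hzip : (p.reverse.map Prod.fst).zip X = p.reverse :=
        (List.zip_of_prod rfl hsnd).symm
      refine ⟨p.reverse.map Prod.fst, ⟨?_, ?_, ?_⟩, ?_⟩
      · rwa [List.map_reverse, List.reverse_reverse]
      · rw [← hsnd, List.length_map, List.length_map]
      · rwa [hzip]
      · rw [hzip, List.reverse_reverse]
    · rintro ⟨c, ⟨h1, h2, h3⟩, rfl⟩
      refine ⟨?_, by rwa [List.reverse_reverse], fun i => ?_⟩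
      · rwa [List.map_reverse, List.map_fst_zip h2.le]
      · rw [List.map_reverse, List.map_snd_zip h2.ge, List.count_reverse, hcount]
  · rintro c ⟨-, hc⟩ c' ⟨-, hc'⟩ h
    have h1 := congrArg (List.map Prod.fst) (List.reverse_injective h)
    rwa [List.map_fst_zip (blockSorted_revContent_iff.1 hc).1.le,
      List.map_fst_zip (blockSorted_revContent_iff.1 hc').1.le] at h1

theorem S_weakInterval (w : SInf) : (weakInterval w).S = stanley w := by
  refine MvPowerSeries.ext fun d => ?_
  obtain ⟨N, hN⟩ := exists_bound d
  rw [LabeledPoset.coeff_S (isSymmetric_weakInterval w) d hN, coeff_stanley w d hN,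
    (isSymmetric_weakInterval w).2 _ _ (List.reverse_perm _).symm, ← revContent_eq,
    (isPathInterval_weak w).ncard_H strictMono_label,
    ← Set.InjOn.ncard_image (f := List.map Prod.fst)]
  · congr 2
    ext c
    simp only [Set.mem_image, Set.mem_ofPred_eq, isReducedWord_iff_exists_path,
      List.reverse_reverse]
    constructor
    · rintro ⟨q, ⟨h1, h2, h3⟩, rfl⟩
      exact ⟨⟨q, h1, h2, rfl⟩, h3⟩
    · rintro ⟨⟨q, h1, h2, rfl⟩, h3⟩
      exact ⟨q, ⟨h1, h2, h3⟩, rfl⟩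
  · rintro p ⟨hp, -⟩ q ⟨hq, -⟩ h
    exact path_injective hp hq h

end Stanley

end

end SkewSchubert

theorem mainTheorem3 :
    -- the construction of `S_P` makes sense for every symmetric labeled poset `P`
    ((∀ lam : YoungDiagram, schur lam ∈ Λ) ∧
      (∀ P : LabeledPoset.{u}, P.IsSymmetric → ∃! χ : Λ →ₗ[ℤ] ℤ, P.IsChi χ)) ∧
    -- (1)
    (∀ (P : LabeledPoset.{u}) (Q : LabeledPoset.{v}), P.IsSymmetric → Q.IsSymmetric →
      Nonempty (LabeledPoset.Iso P Q) → P.S = Q.S) ∧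
    -- the skew Schubert function is well defined
    ((∀ ζ : SInf, ∃ (k : ℕ+) (u : SInf), KBruhat k u (ζ * u)) ∧
      (∀ (k : ℕ+) (u ζ : SInf), KBruhat k u (ζ * u) →
        skewSchubert ζ = skewSchubertOf k u (ζ * u))) ∧
    -- (2)
    (∀ (k : ℕ+) (u w : SInf), KBruhat k u w →
      (kBruhatInterval k u w).IsSymmetric ∧
        (kBruhatInterval k u w).S = skewSchubert (w * u⁻¹)) ∧
    -- (2')
    (∀ ζ : SInf, (preceqInterval ζ).IsSymmetric ∧ (preceqInterval ζ).S = skewSchubert ζ) ∧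
    -- (3)
    (∀ μ lam : YoungDiagram, μ ≤ lam →
      (youngInterval μ lam).IsSymmetric ∧ (youngInterval μ lam).S = skewSchur lam μ) ∧
    -- (4)
    (∀ w : SInf, (weakInterval w).IsSymmetric ∧ (weakInterval w).S = stanley w) := by
  have hskew : ∀ (k : ℕ+) (u ζ : SInf), KBruhat k u (ζ * u) →
      skewSchubert ζ = skewSchubertOf k u (ζ * u) := fun k u ζ h =>
    (S_preceqInterval_eq_skewSchubert ζ).symm.trans (S_preceqInterval h)
  refine ⟨⟨schur_mem, fun P hP => LabeledPoset.existsUnique_isChi hP⟩, ?_,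
    ⟨exists_kBruhat, hskew⟩, fun k u w h => ⟨isSymmetric_kBruhatInterval h, ?_⟩,
    fun ζ => ⟨isSymmetric_preceqInterval ζ, S_preceqInterval_eq_skewSchubert ζ⟩,
    fun μ lam h => ⟨isSymmetric_youngInterval h, S_youngInterval h⟩,
    fun w => ⟨isSymmetric_weakInterval w, S_weakInterval w⟩⟩
  · rintro P Q hP hQ ⟨I⟩
    exact LabeledPoset.S_eq_of_ncard_H hP hQ (LabeledPoset.ncard_H_of_iso I)
  · rw [hskew k u (w * u⁻¹) (by rwa [inv_mul_cancel_right]), inv_mul_cancel_right]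
    exact S_kBruhatInterval h
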